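/- Notation. $A(r,s)=\{x\in\mathbb{R}^3: r\le|x|\le s\}$ and $B(0,r)=\{x\in\mathbb{R}^3:|x|<r\}$. A map $f$ on an open set $U\subset\mathbb{R}^3$ is quasiregular if it is continuous, absolutely continuous on almost all line segments parallel to the coordinate axes (in closed boxes contained in $U$), has partial derivatives in $L^3_{\mathrm{loc}}(U)$, and there is $K\ge1$ with $|f'(x)|^3\le K J_f(x)$ for a.e. $x\in U$, where $|f'(x)|$ is the operator norm of the formal derivative and $J_f$ its determinant. The smallest such $K$ is the outer dilatation $K_O(f)$; the smallest $K\ge1$ with $J_f(x)\le K\min_{|v|=1}|f'(x)v|^3$ for a.e. $x\in U$ is the inner dilatation $K_I(f)$; and $K(f)=\max\{K_I(f),K_O(f)\}$ is the (maximal) dilatation. A map on a closed ring is called quasiregular if it is continuous on the closed ring and quasiregular in its interior; its dilatation is that of its restriction to the interior. The Zorich map $\mathcal{Z}:\mathbb{R}^3\to\mathbb{R}^3\setminus\{0\}$ is defined on the beam $[-1,1]^2\times\mathbb{R}$ by $$\mathcal{Z}(x_1,x_2,x_3)=e^{x_3}\left(\frac{x_1\sin(\pi M/2)}{\sqrt{x_1^2+x_2^2}},\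 \frac{x_2\sin(\pi M/2)}{\sqrt{x_1^2+x_2^2}},\ \cos(\pi M/2)\right),\qquad M=\max\{|x_1|,|x_2|\}$$ (the first two entries being $0$ when $x_1=x_2=0$), and is extended to $\mathbb{R}^3$ so that a reflection of the domain in a plane $\{x_1=n\}$ or $\{x_2=n\}$, $n$ odd, corresponds to the reflection of the range in $\{x_3=0\}$. For an odd positive integer $d$, the Zorich power map $p_d:\mathbb{R}^3\to\mathbb{R}^3$ is the map given by $p_d(0)=0$ and $p_d(\mathcal{Z}(x))=\mathcal{Z}(dx)$ for all $x\in\mathbb{R}^3$. Theorem. There is a constant $K<\infty$ such that for every odd positive integer $d$ there exists a quasiregular map $$P: A(1,e^{1/d})\to\overline{B(0,e^3)}$$ with dilatation $K(P)\le K$, such that $P(x)=p_d(x)$ whenever $|x|=1$ and $P(x)=p_{3d}(x)$ whenever $|x|=e^{1/d}$. -/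

import Mathlib

open MeasureTheory

noncomputable section

namespace QRInterp

/-- Euclidean three-space. -/
abbrev E3 := EuclideanSpace ℝ (Fin 3)

/-! ### Quasiregular maps (analytic definition) -/

/-- The `i`-th standard unit vector. -/
def unitVec (i : Fin 3) : E3 := EuclideanSpace.single i 1

/-- The `i`-th partial derivative of `f` at `x` (meaningful where it exists). -/
def partialDeriv (f : E3 → E3) (i : Fin 3) (x : E3) : E3 := lineDeriv ℝ f x (unitVec i)

/-- The formal derivative `f'(x)`: the linear map whose matrix is made of the partial derivatives
of `f` at `x`. -/
def formalDeriv (f : E3 → E3) (x : E3) : E3 →L[ℝ] E3 :=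
  ∑ i : Fin 3, (EuclideanSpace.proj i : E3 →L[ℝ] ℝ).smulRight (partialDeriv f i x)

/-- The Jacobian determinant of `f` at `x`. -/
def jacobian (f : E3 → E3) (x : E3) : ℝ := (formalDeriv f x).det

/-- The minimal stretching `ℓ(T) = inf_{|v| = 1} |T v|` of a linear map. -/
def minStretch (T : E3 →L[ℝ] E3) : ℝ := ⨅ v : Metric.sphere (0 : E3) 1, ‖T v‖

/-- `f` is absolutely continuous on lines in `U`: for every closed box contained in `U` and every
coordinate direction, `f` is absolutely continuous on almost every segment in which the box meets
a line in that direction. (The segment through `x` does not depend on the `i`-th coordinate of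
`x`, so by Fubini "almost every `x` in the box" is the same as "almost every segment".) -/
def ACL (f : E3 → E3) (U : Set E3) : Prop :=
  ∀ a b : Fin 3 → ℝ, {x : E3 | ∀ j, x j ∈ Set.Icc (a j) (b j)} ⊆ U →
    ∀ i : Fin 3, ∀ᵐ x : E3, (∀ j, x j ∈ Set.Icc (a j) (b j)) →
      AbsolutelyContinuousOnInterval (fun t : ℝ => f (x + (t - x i) • unitVec i)) (a i) (b i)

/-- `ACL³` maps on an open set `U`: continuous, absolutely continuous on lines, with partial
derivatives locally in `L³`. -/
structure IsACL3 (f : E3 → E3) (U : Set E3) : Prop where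
  continuousOn : ContinuousOn f U
  acl : ACL f U
  memLp : ∀ i : Fin 3, ∀ C : Set E3, IsCompact C → C ⊆ U →
    MemLp (partialDeriv f i) 3 (volume.restrict C)

/-- `|f'(x)|³ ≤ K J_f(x)` for almost every `x` in `U`. -/
def OuterBound (f : E3 → E3) (U : Set E3) (K : ℝ) : Prop :=
  ∀ᵐ x ∂volume.restrict U, ‖formalDeriv f x‖ ^ 3 ≤ K * jacobian f x

/-- `J_f(x) ≤ K ℓ(f'(x))³` for almost every `x` in `U`. -/
def InnerBound (f : E3 → E3) (U : Set E3) (K : ℝ) : Prop :=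
  ∀ᵐ x ∂volume.restrict U, jacobian f x ≤ K * minStretch (formalDeriv f x) ^ 3

/-- Quasiregular maps on an open set `U`. -/
structure IsQuasiregularOnOpen (f : E3 → E3) (U : Set E3) : Prop where
  isACL3 : IsACL3 f U
  exists_outerBound : ∃ K : ℝ, 1 ≤ K ∧ OuterBound f U K

/-- The outer dilatation `K_O(f)` on `U`: the smallest `K ≥ 1` with `|f'|³ ≤ K J_f` a.e. -/
def outerDilatation (f : E3 → E3) (U : Set E3) : ENNReal :=
  ⨅ K : {K : ℝ // 1 ≤ K ∧ OuterBound f U K}, ENNReal.ofReal K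

/-- The inner dilatation `K_I(f)` on `U`: the smallest `K ≥ 1` with `J_f ≤ K ℓ(f')³` a.e. -/
def innerDilatation (f : E3 → E3) (U : Set E3) : ENNReal :=
  ⨅ K : {K : ℝ // 1 ≤ K ∧ InnerBound f U K}, ENNReal.ofReal K

/-- The maximal dilatation `K(f) = max (K_I(f), K_O(f))` on `U`. -/
def maximalDilatation (f : E3 → E3) (U : Set E3) : ENNReal :=
  max (innerDilatation f U) (outerDilatation f U)

/-- A map is quasiregular on a closed region `A` if it is continuous on `A` and quasiregular in
the interior of `A`. -/
structure IsQuasiregularOn (f : E3 → E3) (A : Set E3) : Prop where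
  continuousOn : ContinuousOn f A
  quasiregular : IsQuasiregularOnOpen f (interior A)

/-- The closed ring `A(r, s) = {x : r ≤ |x| ≤ s}`. -/
def closedRing (r s : ℝ) : Set E3 := {x | r ≤ ‖x‖ ∧ ‖x‖ ≤ s}

/-! ### The Zorich map -/

/-- The number of the interval `[2m - 1, 2m + 1]` in which `t` lies. -/
def foldIndex (t : ℝ) : ℤ := round (t / 2)

/-- The point of `[-1, 1]` to which `t` is carried by successive reflections in odd integers: the
interval `[2m - 1, 2m + 1]` is carried onto `[-1, 1]` by `|m|` such reflections. -/
def fold (t : ℝ) : ℝ := (-1) ^ foldIndex t * (t - 2 * foldIndex t)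

/-- The map `h` from the square `[-1, 1]²` onto the closed upper unit hemisphere. -/
def hemi (s t : ℝ) : E3 :=
  !₂[s * Real.sin (Real.pi * max |s| |t| / 2) / Real.sqrt (s ^ 2 + t ^ 2),
     t * Real.sin (Real.pi * max |s| |t| / 2) / Real.sqrt (s ^ 2 + t ^ 2),
     Real.cos (Real.pi * max |s| |t| / 2)]

/-- The reflection in the plane `{x₃ = 0}`. -/
def reflect3 (x : E3) : E3 := !₂[x 0, x 1, -x 2]

/-- The Zorich map: on the beam `[-1, 1]² × ℝ` it is `x ↦ e^{x₃} h(x₁, x₂)`, and it is continued to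
space by reflecting in the sides of beams in the domain and in `{x₃ = 0}` in the range (one
reflection in the range for each reflection in the domain). -/
def zorich (x : E3) : E3 :=
  reflect3^[(foldIndex (x 0) + foldIndex (x 1)).natAbs]
    (Real.exp (x 2) • hemi (fold (x 0)) (fold (x 1)))

open Classical in
/-- The Zorich power map `p_d`: the solution of the Schröder equation `p_d ∘ Z = Z ∘ (d · )`,
with `p_d(0) = 0` (see `powerMap_zorich` and `exists_zorich_eq`). -/
def powerMap (d : ℕ) (y : E3) : E3 :=
  if h : ∃ x, zorich x = y then zorich ((d : ℝ) • h.choose) else 0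

/-! ### The power maps are well defined -/

lemma neg_one_zpow_cases (m : ℤ) : ((-1 : ℝ) ^ m = 1) ∨ ((-1 : ℝ) ^ m = -1) := by
  rcases Int.even_or_odd m with h | h
  · exact Or.inl h.neg_one_zpow
  · exact Or.inr h.neg_one_zpow

lemma abs_fold_le (t : ℝ) : |fold t| ≤ 1 := by
  have h := abs_sub_round (t / 2)
  have h1 : |fold t| = |t - 2 * foldIndex t| := by
    unfold fold
    rcases neg_one_zpow_cases (foldIndex t) with h | h <;> rw [h] <;> simp [abs_sub_comm]
  rw [h1]
  unfold foldIndex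
  rw [abs_le] at *
  constructor <;> linarith [h.1, h.2]

lemma sin_fold (t : ℝ) : Real.sin (Real.pi * fold t / 2) = Real.sin (Real.pi * t / 2) := by
  have e : Real.pi * t / 2
      = Real.pi * (t - 2 * foldIndex t) / 2 + foldIndex t * Real.pi := by ring
  rw [e, Real.sin_add_int_mul_pi]
  unfold fold
  rcases neg_one_zpow_cases (foldIndex t) with h | h <;> rw [h]
  · simp
  · rw [neg_one_mul (Real.sin _), ← Real.sin_neg]
    congr 1
    ring

lemma cos_fold (t : ℝ) :
    (-1) ^ foldIndex t * Real.cos (Real.pi * fold t / 2) = Real.cos (Real.pi * t / 2) := by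
  have e : Real.pi * t / 2
      = Real.pi * (t - 2 * foldIndex t) / 2 + foldIndex t * Real.pi := by ring
  rw [e, Real.cos_add_int_mul_pi]
  unfold fold
  rcases neg_one_zpow_cases (foldIndex t) with h | h <;> rw [h]
  · simp
  · congr 1
    rw [← Real.cos_neg]
    congr 1
    ring

lemma fold_eq_arcsin (t : ℝ) :
    fold t = 2 / Real.pi * Real.arcsin (Real.sin (Real.pi * t / 2)) := by
  have h := abs_le.1 (abs_fold_le t)
  have hp := Real.pi_pos
  rw [← sin_fold, Real.arcsin_sin]
  · field_simp
  · nlinarith [h.1]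
  · nlinarith [h.2]

lemma reflect3_iterate (n : ℕ) (x : E3) :
    reflect3^[n] x = !₂[x 0, x 1, (-1) ^ n * x 2] := by
  induction n generalizing x with
  | zero => ext i; fin_cases i <;> simp
  | succ k ih =>
    rw [Function.iterate_succ_apply, ih]
    ext i; fin_cases i <;> simp [reflect3, pow_succ]

lemma neg_one_pow_natAbs (m : ℤ) : (-1 : ℝ) ^ m.natAbs = (-1) ^ m := by
  rcases Int.even_or_odd m with h | h
  · rw [h.neg_one_zpow, (Int.natAbs_even.2 h).neg_one_pow]
  · rw [h.neg_one_zpow, (Int.natAbs_odd.2 h).neg_one_pow]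

/-- The signed height: `± cos (π M / 2)`. -/
def heightSign (s t : ℝ) : ℝ :=
  (-1) ^ foldIndex s * (-1) ^ foldIndex t *
    Real.cos (Real.pi * max |fold s| |fold t| / 2)

lemma zorich_eq (x : E3) : zorich x = Real.exp (x 2) •
    !₂[(hemi (fold (x 0)) (fold (x 1))) 0, (hemi (fold (x 0)) (fold (x 1))) 1,
      heightSign (x 0) (x 1)] := by
  have h : (-1 : ℝ) ≠ 0 := by norm_num
  unfold zorich
  rw [reflect3_iterate, neg_one_pow_natAbs, zpow_add₀ h]
  ext i; fin_cases i <;> simp [hemi, heightSign] <;> ring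

lemma heightSign_eq (s t : ℝ) : heightSign s t =
    Real.sign (Real.cos (Real.pi * s / 2) * Real.cos (Real.pi * t / 2)) *
      min |Real.cos (Real.pi * s / 2)| |Real.cos (Real.pi * t / 2)| := by
  have hp := Real.pi_pos
  have hs := abs_fold_le s
  have ht := abs_fold_le t
  have nn : ∀ u : ℝ, |u| ≤ 1 → 0 ≤ Real.cos (Real.pi * u / 2) := by
    intro u hu
    rw [abs_le] at hu
    apply Real.cos_nonneg_of_neg_pi_div_two_le_of_le <;> nlinarith [hu.1, hu.2]
  have ca : ∀ u : ℝ, Real.cos (Real.pi * |u| / 2) = Real.cos (Real.pi * u / 2) := by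
    intro u
    rcases abs_choice u with h | h <;> rw [h]
    rw [← Real.cos_neg]; congr 1; ring
  have anti : ∀ u v : ℝ, |u| ≤ |v| → |v| ≤ 1 →
      Real.cos (Real.pi * v / 2) ≤ Real.cos (Real.pi * u / 2) := by
    intro u v huv hv
    rw [← ca u, ← ca v]
    apply Real.cos_le_cos_of_nonneg_of_le_pi
    · positivity
    · nlinarith
    · nlinarith
  have key : Real.cos (Real.pi * max |fold s| |fold t| / 2) =
      min (Real.cos (Real.pi * fold s / 2)) (Real.cos (Real.pi * fold t / 2)) := by
    rcases le_total |fold s| |fold t| with h | h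
    · rw [max_eq_right h, ca, min_eq_right (anti _ _ h ht)]
    · rw [max_eq_left h, ca, min_eq_left (anti _ _ h hs)]
  have h1 := nn _ hs
  have h2 := nn _ ht
  unfold heightSign
  rw [key, ← cos_fold s, ← cos_fold t]
  generalize Real.cos (Real.pi * fold s / 2) = p at *
  generalize Real.cos (Real.pi * fold t / 2) = q at *
  have hpq : min p q * Real.sign (p * q) = min p q := by
    rcases h1.eq_or_lt with h | h
    · subst h; simp [h2]
    rcases h2.eq_or_lt with h' | h'
    · subst h'; simp [h1]
    rw [Real.sign_of_pos (mul_pos h h'), mul_one]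
  have hpq' : min p q * Real.sign (-(p * q)) = -min p q := by
    rw [Real.sign_neg, mul_neg, hpq]
  rcases neg_one_zpow_cases (foldIndex s) with h | h <;>
  rcases neg_one_zpow_cases (foldIndex t) with h' | h' <;> rw [h, h'] <;>
  simp [abs_of_nonneg h1, abs_of_nonneg h2] <;> linarith

lemma hemi_sq (s t : ℝ) : (hemi s t) 0 ^ 2 + (hemi s t) 1 ^ 2
    = Real.sin (Real.pi * max |s| |t| / 2) ^ 2 := by
  rcases eq_or_ne (s ^ 2 + t ^ 2) 0 with h | h
  · have hs : s = 0 := by nlinarith [sq_nonneg s, sq_nonneg t]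
    have ht : t = 0 := by nlinarith [sq_nonneg s, sq_nonneg t]
    subst hs; subst ht; simp [hemi]
  · have hh : 0 ≤ s ^ 2 + t ^ 2 := by positivity
    simp only [hemi, PiLp.toLp_apply, Matrix.cons_val_zero, Matrix.cons_val_one, div_pow, mul_pow,
      Real.sq_sqrt hh]
    field_simp

lemma heightSign_sq (s t : ℝ) :
    heightSign s t ^ 2 = Real.cos (Real.pi * max |fold s| |fold t| / 2) ^ 2 := by
  unfold heightSign
  rcases neg_one_zpow_cases (foldIndex s) with h | h <;>
  rcases neg_one_zpow_cases (foldIndex t) with h' | h' <;> rw [h, h'] <;> ring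

/-- `|Z(x)| = e^{x₃}`. -/
lemma norm_zorich (x : E3) : ‖zorich x‖ = Real.exp (x 2) := by
  rw [zorich_eq, norm_smul, Real.norm_of_nonneg (Real.exp_pos _).le, EuclideanSpace.norm_eq]
  have : ∑ i : Fin 3, ‖(!₂[(hemi (fold (x 0)) (fold (x 1))) 0, (hemi (fold (x 0)) (fold (x 1))) 1,
      heightSign (x 0) (x 1)] : E3) i‖ ^ 2 = 1 := by
    simp only [Fin.sum_univ_three, Real.norm_eq_abs, sq_abs]
    have h1 := hemi_sq (fold (x 0)) (fold (x 1))
    have h2 := heightSign_sq (x 0) (x 1)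
    have h3 := Real.sin_sq_add_cos_sq (Real.pi * max |fold (x 0)| |fold (x 1)| / 2)
    simp
    linarith
  rw [this]; simp

lemma hemi_inj {s t s' t' : ℝ} (hs : |s| ≤ 1) (ht : |t| ≤ 1) (hs' : |s'| ≤ 1) (ht' : |t'| ≤ 1)
    (h0 : (hemi s t) 0 = (hemi s' t') 0) (h1 : (hemi s t) 1 = (hemi s' t') 1)
    (h2 : Real.cos (Real.pi * max |s| |t| / 2) ^ 2 = Real.cos (Real.pi * max |s'| |t'| / 2) ^ 2) :
    s = s' ∧ t = t' := by
  have hp := Real.pi_pos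
  have hM : max |s| |t| ≤ 1 := max_le hs ht
  have hM' : max |s'| |t'| ≤ 1 := max_le hs' ht'
  have hM0 : 0 ≤ max |s| |t| := le_max_of_le_left (abs_nonneg _)
  have hM0' : 0 ≤ max |s'| |t'| := le_max_of_le_left (abs_nonneg _)
  have hc : Real.cos (Real.pi * max |s| |t| / 2) = Real.cos (Real.pi * max |s'| |t'| / 2) := by
    refine (pow_left_inj₀ ?_ ?_ two_ne_zero).1 h2 <;>
    · apply Real.cos_nonneg_of_neg_pi_div_two_le_of_le <;> nlinarith
  have hMM : max |s| |t| = max |s'| |t'| := by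
    have := Real.injOn_cos ⟨by positivity, by nlinarith⟩ ⟨by positivity, by nlinarith⟩ hc
    have h3 : Real.pi * max |s| |t| = Real.pi * max |s'| |t'| := by linarith
    exact mul_left_cancel₀ hp.ne' h3
  rcases hM0.eq_or_lt with h | h
  · have a1 : |s| ≤ 0 := (le_max_left _ _).trans h.symm.le
    have a2 : |t| ≤ 0 := (le_max_right _ _).trans h.symm.le
    have a3 : |s'| ≤ 0 := (le_max_left _ _).trans (hMM ▸ h.symm.le)
    have a4 : |t'| ≤ 0 := (le_max_right _ _).trans (hMM ▸ h.symm.le)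
    rw [abs_nonpos_iff] at a1 a2 a3 a4
    simp [a1, a2, a3, a4]
  · have hsin : 0 < Real.sin (Real.pi * max |s| |t| / 2) :=
      Real.sin_pos_of_pos_of_lt_pi (by positivity) (by nlinarith)
    have pos : ∀ u v : ℝ, 0 < max |u| |v| → 0 < Real.sqrt (u ^ 2 + v ^ 2) := by
      intro u v huv
      apply Real.sqrt_pos.2
      rcases lt_max_iff.1 huv with h | h
      · have := abs_pos.1 h; positivity
      · have := abs_pos.1 h; positivity
    have q := pos s t h
    have q' := pos s' t' (hMM ▸ h)
    simp only [hemi, PiLp.toLp_apply, Matrix.cons_val_zero, Matrix.cons_val_one, ← hMM] at h0 h1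
    set r := Real.sqrt (s ^ 2 + t ^ 2)
    set r' := Real.sqrt (s' ^ 2 + t' ^ 2)
    have e0 : s * r' = s' * r := by
      field_simp at h0; linarith
    have e1 : t * r' = t' * r := by
      field_simp at h1; linarith
    have em : max |s| |t| * r' = max |s'| |t'| * r := by
      rw [max_mul_of_nonneg _ _ q'.le, max_mul_of_nonneg _ _ q.le]
      have m1 : ∀ u v : ℝ, 0 < v → |u| * v = |u * v| := fun u v hv => by
        rw [abs_mul, abs_of_pos hv]
      rw [m1 s r' q', m1 t r' q', m1 s' r q, m1 t' r q, e0, e1]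
    rw [← hMM] at em
    have er : r' = r := mul_left_cancel₀ h.ne' em
    rw [er] at e0 e1
    exact ⟨mul_right_cancel₀ q.ne' e0, mul_right_cancel₀ q.ne' e1⟩

/-- Points with the same image under `Z`. -/
lemma zorich_eq_zorich {a b : E3} (h : zorich a = zorich b) :
    a 2 = b 2 ∧ fold (a 0) = fold (b 0) ∧ fold (a 1) = fold (b 1) ∧
      heightSign (a 0) (a 1) = heightSign (b 0) (b 1) := by
  have h2 : a 2 = b 2 := by
    apply Real.exp_injective
    rw [← norm_zorich, ← norm_zorich, h]
  have e := h
  rw [zorich_eq, zorich_eq, h2] at e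
  have e' := smul_right_injective E3 (Real.exp_pos (b 2)).ne' e
  have c0 := congrArg (fun x : E3 => x 0) e'
  have c1 := congrArg (fun x : E3 => x 1) e'
  have c2 := congrArg (fun x : E3 => x 2) e'
  simp at c0 c1 c2
  have := hemi_inj (abs_fold_le _) (abs_fold_le _) (abs_fold_le _) (abs_fold_le _) c0 c1
    (by rw [← heightSign_sq, ← heightSign_sq, c2])
  exact ⟨h2, this.1, this.2, c2⟩

/-- If `sin x = sin y` then, for odd `d`, `sin dx = sin dy`, and `cos` changes by the same sign at
`x` and at `dx`. -/
lemma odd_mul_trig {d : ℕ} (hd : Odd d) {x y : ℝ} (h : Real.sin x = Real.sin y) :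
    Real.sin (d * x) = Real.sin (d * y) ∧ ∃ τ : ℝ, (τ = 1 ∨ τ = -1) ∧
      Real.cos y = τ * Real.cos x ∧ Real.cos (d * y) = τ * Real.cos (d * x) := by
  obtain ⟨k, hk | hk⟩ := Real.sin_eq_sin_iff.1 h
  · have e : y = x + k * (2 * Real.pi) := by linarith
    have e' : d * y = d * x + (d * k : ℤ) * (2 * Real.pi) := by rw [e]; push_cast; ring
    rw [e', e]
    simp only [Real.sin_add_int_mul_two_pi, Real.cos_add_int_mul_two_pi]
    exact ⟨trivial, 1, Or.inl rfl, by simp, by simp⟩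
  · have e : y = (Real.pi - x) + k * (2 * Real.pi) := by linarith
    obtain ⟨j, hj⟩ := hd
    have e' : d * y = (Real.pi - d * x) + (d * k + j : ℤ) * (2 * Real.pi) := by
      rw [e, hj]; push_cast; ring
    rw [e', e]
    simp only [Real.sin_add_int_mul_two_pi, Real.cos_add_int_mul_two_pi, Real.sin_pi_sub,
      Real.cos_pi_sub]
    exact ⟨trivial, -1, Or.inr rfl, by simp, by simp⟩

lemma cos_odd_mul_eq_zero {d : ℕ} (hd : Odd d) {x : ℝ} (h : Real.cos x = 0) :
    Real.cos (d * x) = 0 := by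
  obtain ⟨k, hk⟩ := Real.cos_eq_zero_iff.1 h
  obtain ⟨j, hj⟩ := hd
  rw [Real.cos_eq_zero_iff]
  refine ⟨d * k + j, ?_⟩
  rw [hk, hj]; push_cast; ring

lemma fold_eq_iff (s t : ℝ) :
    fold s = fold t ↔ Real.sin (Real.pi * s / 2) = Real.sin (Real.pi * t / 2) := by
  constructor
  · intro h; rw [← sin_fold s, ← sin_fold t, h]
  · intro h; rw [fold_eq_arcsin, fold_eq_arcsin, h]

/-- For odd `d`, `Z(dx)` depends only on `Z(x)`. -/
lemma zorich_odd_smul {d : ℕ} (hd : Odd d) {a b : E3} (h : zorich a = zorich b) :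
    zorich ((d : ℝ) • a) = zorich ((d : ℝ) • b) := by
  obtain ⟨h2, h0, h1, hh⟩ := zorich_eq_zorich h
  rw [fold_eq_iff] at h0 h1
  have r : ∀ t : ℝ, Real.pi * (d * t) / 2 = d * (Real.pi * t / 2) := fun t => by ring
  obtain ⟨s0, τ0, t0, c0, C0⟩ := odd_mul_trig hd h0
  obtain ⟨s1, τ1, t1, c1, C1⟩ := odd_mul_trig hd h1
  have f0 : fold (d * a 0) = fold (d * b 0) := by rw [fold_eq_iff, r, r]; exact s0
  have f1 : fold (d * a 1) = fold (d * b 1) := by rw [fold_eq_iff, r, r]; exact s1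
  have H : heightSign (d * a 0) (d * a 1) = heightSign (d * b 0) (d * b 1) := by
    rw [heightSign_eq, heightSign_eq] at hh ⊢
    simp only [r]
    rw [c0, c1] at hh
    rw [C0, C1]
    have z0 := @cos_odd_mul_eq_zero d hd (Real.pi * a 0 / 2)
    have z1 := @cos_odd_mul_eq_zero d hd (Real.pi * a 1 / 2)
    generalize Real.cos (Real.pi * a 0 / 2) = p at *
    generalize Real.cos (Real.pi * a 1 / 2) = q at *
    generalize Real.cos (d * (Real.pi * a 0 / 2)) = p' at *
    generalize Real.cos (d * (Real.pi * a 1 / 2)) = q' at *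
    have main : ∀ u v : ℝ, Real.sign (u * v) * min |u| |v|
        = -(Real.sign (u * v) * min |u| |v|) → u = 0 ∨ v = 0 := by
      intro u v huv
      have hz : Real.sign (u * v) * min |u| |v| = 0 := by linarith
      rcases mul_eq_zero.1 hz with hz | hz
      · exact mul_eq_zero.1 (Real.sign_eq_zero_iff.1 hz)
      · rcases min_choice |u| |v| with hm | hm <;> rw [hm, abs_eq_zero] at hz
        · exact Or.inl hz
        · exact Or.inr hz
    rcases t0 with rfl | rfl <;> rcases t1 with rfl | rfl
    · simp
    · simp only [one_mul, neg_mul, mul_neg, Real.sign_neg, abs_neg] at hh ⊢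
      rcases main p q hh with hz | hz
      · simp [z0 hz]
      · simp [z1 hz]
    · simp only [one_mul, neg_mul, Real.sign_neg, abs_neg] at hh ⊢
      rcases main p q hh with hz | hz
      · simp [z0 hz]
      · simp [z1 hz]
    · simp
  rw [zorich_eq, zorich_eq]
  simp only [PiLp.smul_apply, smul_eq_mul, f0, f1, H, h2]

/-- The Schröder equation `p_d(Z(x)) = Z(dx)` for odd `d`. -/
theorem powerMap_zorich {d : ℕ} (hd : Odd d) (x : E3) :
    powerMap d (zorich x) = zorich ((d : ℝ) • x) := by
  have h : ∃ x', zorich x' = zorich x := ⟨x, rfl⟩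
  rw [powerMap, dif_pos h]
  exact zorich_odd_smul hd h.choose_spec

theorem powerMap_zero (d : ℕ) : powerMap d 0 = 0 := by
  rw [powerMap, dif_neg]
  rintro ⟨x, hx⟩
  have := norm_zorich x
  rw [hx, norm_zero] at this
  exact (Real.exp_pos _).ne this

/-- On the central beam `Z(x) = e^{x₃} h(x₁, x₂)`. -/
theorem zorich_beam (x : E3) (h0 : |x 0| ≤ 1) (h1 : |x 1| ≤ 1) :
    zorich x = Real.exp (x 2) • hemi (x 0) (x 1) := by
  have hp := Real.pi_pos
  have ff : ∀ t : ℝ, |t| ≤ 1 → fold t = t := by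
    intro t ht
    have := abs_le.1 ht
    rw [fold_eq_arcsin, Real.arcsin_sin (by nlinarith) (by nlinarith)]
    field_simp
  have cc : ∀ t : ℝ, |t| ≤ 1 → 0 ≤ Real.cos (Real.pi * t / 2) := by
    intro t ht
    have := abs_le.1 ht
    apply Real.cos_nonneg_of_neg_pi_div_two_le_of_le <;> nlinarith
  have hs : heightSign (x 0) (x 1) = Real.cos (Real.pi * max |x 0| |x 1| / 2) := by
    have h := heightSign_sq (x 0) (x 1)
    rw [ff _ h0, ff _ h1] at h
    refine (pow_left_inj₀ ?_ ?_ two_ne_zero).1 h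
    · rw [heightSign_eq]
      have := mul_nonneg (cc _ h0) (cc _ h1)
      refine mul_nonneg ?_ (by positivity)
      rcases this.eq_or_lt with h' | h'
      · rw [← h', Real.sign_zero]
      · rw [Real.sign_of_pos h']; exact zero_le_one
    · have := cc (max |x 0| |x 1|) (by
        rw [abs_of_nonneg (le_max_of_le_left (abs_nonneg _))]; exact max_le h0 h1)
      exact this
  rw [zorich_eq, ff _ h0, ff _ h1, hs]
  congr 1

/-- Reflecting in a plane `{x_i = n}` with `i ∈ {1, 2}` and `n` odd in the domain amounts to
reflecting in `{x₃ = 0}` in the range. -/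
theorem zorich_reflect (x : E3) (n : ℤ) (hn : Odd n) :
    zorich !₂[2 * n - x 0, x 1, x 2] = reflect3 (zorich x) ∧
    zorich !₂[x 0, 2 * n - x 1, x 2] = reflect3 (zorich x) := by
  have e : ∀ t : ℝ, Real.pi * (2 * n - t) / 2 = -(Real.pi * t / 2) + n * Real.pi := fun t => by ring
  have ff : ∀ t : ℝ, fold (2 * n - t) = fold t := by
    intro t
    rw [fold_eq_iff, e, Real.sin_add_int_mul_pi, hn.neg_one_zpow, Real.sin_neg]
    ring
  have cc : ∀ t : ℝ, Real.cos (Real.pi * (2 * n - t) / 2) = -Real.cos (Real.pi * t / 2) := by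
    intro t
    rw [e, Real.cos_add_int_mul_pi, hn.neg_one_zpow, Real.cos_neg]
    ring
  have g0 : ∀ s t, heightSign (2 * n - s) t = -heightSign s t := by
    intro s t
    rw [heightSign_eq, heightSign_eq, cc, neg_mul, Real.sign_neg, abs_neg, neg_mul]
  have g1 : ∀ s t, heightSign s (2 * n - t) = -heightSign s t := by
    intro s t
    rw [heightSign_eq, heightSign_eq, cc, mul_neg, Real.sign_neg, abs_neg, neg_mul]
  constructor <;> rw [zorich_eq, zorich_eq] <;> ext i <;> fin_cases i <;>
    simp [reflect3, ff, g0, g1]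

/-- Every nonzero point is in the image of `Z`. -/
theorem exists_zorich_eq (y : E3) (hy : y ≠ 0) : ∃ x, zorich x = y := by
  have hp := Real.pi_pos
  have hn : 0 < ‖y‖ := norm_pos_iff.2 hy
  suffices H : ∀ y : E3, y ≠ 0 → 0 ≤ y 2 → ∃ x, zorich x = y by
    rcases le_total 0 (y 2) with h | h
    · exact H y hy h
    · have hr : reflect3 (reflect3 y) = y := by
        ext i; fin_cases i <;> simp [reflect3]
      obtain ⟨x, hx⟩ := H (reflect3 y) (by
        intro h0
        rw [h0] at hr
        apply hy
        rw [← hr]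
        ext i; fin_cases i <;> simp [reflect3]) (by simpa [reflect3] using h)
      refine ⟨!₂[2 * (1 : ℤ) - x 0, x 1, x 2], ?_⟩
      rw [(zorich_reflect x 1 odd_one).1, hx, hr]
  clear hy hn y
  intro y hy h2
  have hn : 0 < ‖y‖ := norm_pos_iff.2 hy
  have hsq : ‖y‖ ^ 2 = y 0 ^ 2 + y 1 ^ 2 + y 2 ^ 2 := by
    rw [EuclideanSpace.norm_sq_eq]; simp [Fin.sum_univ_three]
  have hle : y 2 / ‖y‖ ≤ 1 := by
    rw [div_le_one hn]; nlinarith [sq_nonneg (y 0), sq_nonneg (y 1)]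
  have hge : 0 ≤ y 2 / ‖y‖ := by positivity
  obtain ⟨M, hM0, hM1, hMc⟩ : ∃ M : ℝ, 0 ≤ M ∧ M ≤ 1 ∧ Real.cos (Real.pi * M / 2) = y 2 / ‖y‖ := by
    refine ⟨2 / Real.pi * Real.arccos (y 2 / ‖y‖), by have := Real.arccos_nonneg (y 2 / ‖y‖); positivity,
      ?_, ?_⟩
    · have := Real.arccos_le_pi_div_two.2 hge
      rw [div_mul_eq_mul_div, div_le_one hp]; linarith
    · rw [show Real.pi * (2 / Real.pi * Real.arccos (y 2 / ‖y‖)) / 2 = Real.arccos (y 2 / ‖y‖) by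
        field_simp]
      exact Real.cos_arccos (by linarith) hle
  have hMs : ‖y‖ ^ 2 * Real.sin (Real.pi * M / 2) ^ 2 = y 0 ^ 2 + y 1 ^ 2 := by
    have h3 := Real.sin_sq_add_cos_sq (Real.pi * M / 2)
    rw [hMc] at h3
    field_simp at h3
    nlinarith
  have hS0 : 0 ≤ Real.sin (Real.pi * M / 2) :=
    Real.sin_nonneg_of_nonneg_of_le_pi (by positivity) (by nlinarith)
  set m := max |y 0| |y 1| with hm
  rcases (le_max_of_le_left (abs_nonneg _) : 0 ≤ m).eq_or_lt with h | h
  · have a1 : |y 0| ≤ 0 := (le_max_left _ _).trans h.symm.le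
    have a2 : |y 1| ≤ 0 := (le_max_right _ _).trans h.symm.le
    rw [abs_nonpos_iff] at a1 a2
    refine ⟨!₂[0, 0, Real.log ‖y‖], ?_⟩
    rw [zorich_beam _ (by simp) (by simp)]
    have : ‖y‖ = y 2 := by
      have : ‖y‖ ^ 2 = y 2 ^ 2 := by rw [hsq, a1, a2]; ring
      exact (pow_left_inj₀ hn.le h2 two_ne_zero).1 this
    rw [show (!₂[0, 0, Real.log ‖y‖] : E3) 2 = Real.log ‖y‖ from rfl, Real.exp_log hn]
    ext i; fin_cases i <;> simp [hemi, a1, a2, this]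
  · have hq : 0 < y 0 ^ 2 + y 1 ^ 2 := by
      rcases lt_max_iff.1 h with h | h
      · have := abs_pos.1 h; positivity
      · have := abs_pos.1 h; positivity
    have hroot : Real.sqrt (y 0 ^ 2 + y 1 ^ 2) = ‖y‖ * Real.sin (Real.pi * M / 2) := by
      rw [← hMs, ← mul_pow, Real.sqrt_sq (by positivity)]
    have hS : 0 < Real.sin (Real.pi * M / 2) := by
      rcases hS0.eq_or_lt with h' | h'
      · rw [← h'] at hMs; simp at hMs; linarith
      · exact h'
    have hMpos : 0 < M := by
      rcases hM0.eq_or_lt with h' | h'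
      · rw [← h'] at hS; simp at hS
      · exact h'
    have hc : 0 < M / m := by positivity
    have hb0 : |M / m * y 0| = M / m * |y 0| := by rw [abs_mul, abs_of_pos hc]
    have hb1 : |M / m * y 1| = M / m * |y 1| := by rw [abs_mul, abs_of_pos hc]
    have hmax : max |M / m * y 0| |M / m * y 1| = M := by
      rw [hb0, hb1, ← mul_max_of_nonneg _ _ hc.le, ← hm, div_mul_cancel₀ _ h.ne']
    have hsq' : Real.sqrt ((M / m * y 0) ^ 2 + (M / m * y 1) ^ 2)
        = M / m * (‖y‖ * Real.sin (Real.pi * M / 2)) := by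
      rw [← hroot, show (M / m * y 0) ^ 2 + (M / m * y 1) ^ 2
        = (M / m) ^ 2 * (y 0 ^ 2 + y 1 ^ 2) by ring, Real.sqrt_mul (by positivity),
        Real.sqrt_sq hc.le]
    obtain ⟨u, hu⟩ : ∃ u, u = M / m * y 0 := ⟨_, rfl⟩
    obtain ⟨v, hv⟩ : ∃ v, v = M / m * y 1 := ⟨_, rfl⟩
    rw [← hu, ← hv] at hmax hsq'
    refine ⟨!₂[u, v, Real.log ‖y‖], ?_⟩
    rw [zorich_beam _ ((le_max_left |u| |v|).trans (hmax.le.trans hM1))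
      ((le_max_right |u| |v|).trans (hmax.le.trans hM1))]
    change Real.exp (Real.log ‖y‖) • hemi u v = y
    rw [Real.exp_log hn]
    unfold hemi
    rw [hmax, hsq', hMc]
    generalize Real.sin (Real.pi * M / 2) = S at hS ⊢
    ext i
    fin_cases i
    · simp [hu]
      have hmn : m ≠ 0 := ne_of_gt h
      field_simp
    · simp [hv]
      have hmn : m ≠ 0 := ne_of_gt h
      field_simp
    · simp; field_simp

end QRInterp

end

open MeasureTheory

noncomputable section

namespace QRInterp

open Set Filter Topology

/-! ### Linear algebra in three-space -/

lemma sum_smul_unitVec (v : E3) : ∑ i, v i • unitVec i = v := by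
  ext j
  fin_cases j <;> simp [unitVec, Fin.sum_univ_three]

lemma norm_unitVec (i : Fin 3) : ‖unitVec i‖ = 1 := by simp [unitVec]

lemma abs_apply_le_norm (v : E3) (i : Fin 3) : |v i| ≤ ‖v‖ := by
  simpa using PiLp.norm_apply_le v i

lemma norm_le_sum_abs (v : E3) : ‖v‖ ≤ |v 0| + |v 1| + |v 2| := by
  rw [EuclideanSpace.norm_eq, Fin.sum_univ_three]
  apply Real.sqrt_le_iff.2
  constructor
  · positivity
  · simp only [Real.norm_eq_abs]
    nlinarith [mul_nonneg (abs_nonneg (v 0)) (abs_nonneg (v 1)),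
      mul_nonneg (abs_nonneg (v 0)) (abs_nonneg (v 2)),
      mul_nonneg (abs_nonneg (v 1)) (abs_nonneg (v 2))]

lemma det_eq_entries (T : E3 →L[ℝ] E3) : T.det =
    T (unitVec 0) 0 * T (unitVec 1) 1 * T (unitVec 2) 2
    - T (unitVec 0) 0 * T (unitVec 2) 1 * T (unitVec 1) 2
    - T (unitVec 1) 0 * T (unitVec 0) 1 * T (unitVec 2) 2
    + T (unitVec 1) 0 * T (unitVec 2) 1 * T (unitVec 0) 2
    + T (unitVec 2) 0 * T (unitVec 0) 1 * T (unitVec 1) 2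
    - T (unitVec 2) 0 * T (unitVec 1) 1 * T (unitVec 0) 2 := by
  have h : ∀ i j, LinearMap.toMatrix (EuclideanSpace.basisFun (Fin 3) ℝ).toBasis
      (EuclideanSpace.basisFun (Fin 3) ℝ).toBasis (T : E3 →ₗ[ℝ] E3) i j = T (unitVec j) i := by
    intro i j
    simp [LinearMap.toMatrix_apply, unitVec]
  rw [ContinuousLinearMap.det, ← LinearMap.det_toMatrix
    (EuclideanSpace.basisFun (Fin 3) ℝ).toBasis, Matrix.det_fin_three]
  simp only [h]

lemma abs_det_le (T : E3 →L[ℝ] E3) (v : E3) (hv : ‖v‖ = 1) :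
    |T.det| ≤ ‖T‖ ^ 2 * ‖T v‖ := by
  have : Fact (Module.finrank ℝ E3 = 3) := ⟨by simp⟩
  have hon : Orthonormal ℝ (({0} : Set (Fin 3)).domRestrict (fun _ : Fin 3 => v)) := by
    constructor
    · intro i; exact hv
    · intro i j hij
      exact absurd (Subsingleton.elim i j) hij
  obtain ⟨b, hb⟩ := hon.exists_orthonormalBasis_extension_of_card_eq (by simp)
  have hb0 : b 0 = v := hb 0 rfl
  let o := b.toBasis.orientation
  have hvol : o.volumeForm = b.toBasis.det := o.volumeForm_robust b rfl
  have h1 := o.abs_volumeForm_apply_le (fun i => T (b i))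
  rw [hvol] at h1
  have h2 := Module.Basis.det_comp b.toBasis (T : E3 →ₗ[ℝ] E3) b.toBasis
  rw [Module.Basis.det_self, mul_one] at h2
  have h3 : ((T : E3 →ₗ[ℝ] E3) : E3 → E3) ∘ b.toBasis = fun i => T (b i) := by
    ext; simp
  rw [h3] at h2
  rw [h2, Fin.prod_univ_three, hb0] at h1
  have hn : ∀ i, ‖T (b i)‖ ≤ ‖T‖ := fun i => by
    simpa [b.norm_eq_one] using T.le_opNorm (b i)
  calc |T.det| ≤ ‖T v‖ * ‖T (b 1)‖ * ‖T (b 2)‖ := h1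
    _ ≤ ‖T v‖ * ‖T‖ * ‖T‖ := by gcongr <;> exact hn _
    _ = _ := by ring

/-! ### Maps that are Lipschitz with Jacobian bounded below -/

lemma formalDeriv_eq_fderiv {f : E3 → E3} {x : E3} (h : DifferentiableAt ℝ f x) :
    formalDeriv f x = fderiv ℝ f x := by
  ext1 v
  conv_rhs => rw [← sum_smul_unitVec v]
  simp only [formalDeriv, partialDeriv, h.lineDeriv_eq_fderiv, map_sum, map_smul]
  simp

lemma ae_mem_of_locally {p : E3 → Prop} {U : Set E3}
    (h : ∀ x ∈ U, ∃ V ∈ 𝓝 x, ∀ᵐ y : E3, y ∈ V → p y) : ∀ᵐ y : E3, y ∈ U → p y := by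
  have : volume {y : E3 | y ∈ U ∧ ¬ p y} = 0 := by
    refine measure_null_of_locally_null _ fun x hx => ?_
    obtain ⟨V, hV, hp⟩ := h x hx.1
    refine ⟨{y | y ∈ V ∧ ¬ p y}, ?_, ?_⟩
    · filter_upwards [mem_nhdsWithin_of_mem_nhds hV, self_mem_nhdsWithin] with y hy hy'
      exact ⟨hy, hy'.2⟩
    · have := ae_iff.1 hp
      simpa [Classical.not_imp] using this
  rw [ae_iff]
  simpa [Classical.not_imp] using this

/-- `f` is Lipschitz with constant `L` on each convex subset of `A`. -/
def LipschitzOnConvex (L : NNReal) (f : E3 → E3) (A : Set E3) : Prop :=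
  ∀ B ⊆ A, Convex ℝ B → LipschitzOnWith L f B

namespace LipschitzOnConvex

variable {L : NNReal} {f : E3 → E3} {A : Set E3}

lemma exists_ball (h : LipschitzOnConvex L f A) {x : E3} (hx : x ∈ interior A) :
    ∃ V ∈ 𝓝 x, IsOpen V ∧ LipschitzOnWith L f V := by
  obtain ⟨ε, hε, hb⟩ := Metric.isOpen_iff.1 isOpen_interior x hx
  exact ⟨Metric.ball x ε, Metric.ball_mem_nhds x hε, Metric.isOpen_ball,
    h _ (hb.trans interior_subset) (convex_ball x ε)⟩

lemma norm_fderiv_le (h : LipschitzOnConvex L f A) {x : E3} (hx : x ∈ interior A) :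
    ‖fderiv ℝ f x‖ ≤ L := by
  obtain ⟨V, hV, -, hL⟩ := h.exists_ball hx
  exact norm_fderiv_le_of_lipschitzOn ℝ hV hL

lemma ae_differentiableAt (h : LipschitzOnConvex L f A) :
    ∀ᵐ x : E3, x ∈ interior A → DifferentiableAt ℝ f x := by
  refine ae_mem_of_locally fun x hx => ?_
  obtain ⟨V, hV, hVo, hL⟩ := h.exists_ball hx
  refine ⟨V, hV, ?_⟩
  filter_upwards [hL.ae_differentiableWithinAt_of_mem (μ := volume)] with y hy hyV
  exact (hy hyV).differentiableAt (hVo.mem_nhds hyV)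

lemma acl (h : LipschitzOnConvex L f A) : ACL f (interior A) := by
  intro a b hab i
  filter_upwards with x hx
  have hle : a i ≤ b i := (hx i).1.trans (hx i).2
  set box : Set E3 := {x : E3 | ∀ j, x j ∈ Set.Icc (a j) (b j)} with hbox
  have hconv : Convex ℝ box := by
    have : box = ⋂ j, (EuclideanSpace.proj j : E3 →L[ℝ] ℝ) ⁻¹' Set.Icc (a j) (b j) := by
      ext; simp [hbox]
    rw [this]
    exact convex_iInter fun j => (convex_Icc _ _).linear_preimage
      (EuclideanSpace.proj j : E3 →L[ℝ] ℝ).toLinearMap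
  have hL := h box (hab.trans interior_subset) hconv
  apply LipschitzOnWith.absolutelyContinuousOnInterval (K := L)
  rw [Set.uIcc_of_le hle]
  refine LipschitzOnWith.of_dist_le_mul fun s hs t ht => ?_
  have hm : ∀ s ∈ Set.Icc (a i) (b i), x + (s - x i) • unitVec i ∈ box := by
    intro s hs j
    by_cases hij : j = i
    · subst hij; simpa [unitVec] using hs
    · simpa [unitVec, hij] using hx j
  refine (hL.dist_le_mul _ (hm s hs) _ (hm t ht)).trans_eq ?_
  congr 1
  rw [dist_eq_norm, dist_eq_norm, add_sub_add_left_eq_sub, ← sub_smul, norm_smul, norm_unitVec,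
    mul_one]
  congr 1; ring

lemma isACL3 (h : LipschitzOnConvex L f A) : IsACL3 f (interior A) where
  continuousOn := by
    intro x hx
    obtain ⟨V, hV, -, hL⟩ := h.exists_ball hx
    exact (hL.continuousOn.continuousAt hV).continuousWithinAt
  acl := h.acl
  memLp := by
    intro i C hC hCU
    have : IsFiniteMeasure (volume.restrict C) := ⟨by simpa using hC.measure_lt_top⟩
    have hae : ∀ᵐ x ∂volume.restrict C, DifferentiableAt ℝ f x ∧ x ∈ C := by
      rw [ae_restrict_iff' hC.measurableSet]
      filter_upwards [h.ae_differentiableAt] with x hx hxC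
      exact ⟨hx (hCU hxC), hxC⟩
    refine MemLp.of_bound ?_ L ?_
    · refine ((measurable_fderiv ℝ f).apply_continuousLinearMap
        (unitVec i)).aestronglyMeasurable.congr ?_
      filter_upwards [hae] with x hx
      exact hx.1.lineDeriv_eq_fderiv.symm
    · filter_upwards [hae] with x hx
      rw [partialDeriv, hx.1.lineDeriv_eq_fderiv]
      refine ((fderiv ℝ f x).le_opNorm _).trans ?_
      rw [norm_unitVec, mul_one]
      exact h.norm_fderiv_le (hCU hx.2)

end LipschitzOnConvex

lemma le_minStretch {T : E3 →L[ℝ] E3} {m : ℝ} (h : ∀ v : E3, ‖v‖ = 1 → m ≤ ‖T v‖) :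
    m ≤ minStretch T := by
  have : Nonempty (Metric.sphere (0 : E3) 1) := ⟨⟨unitVec 0, by simp [norm_unitVec]⟩⟩
  exact le_ciInf fun v => h v (by simp)

/-- A map that is Lipschitz and whose Jacobian is bounded below is quasiregular, with a bound on
its dilatation. -/
theorem isQuasiregularOn_of_lipschitz {f : E3 → E3} {A : Set E3} {L : NNReal} {c K : ℝ}
    (hc : 0 < c) (hcont : ContinuousOn f A) (hL : LipschitzOnConvex L f A)
    (hJ : ∀ᵐ x : E3, x ∈ interior A → DifferentiableAt ℝ f x → c ≤ (fderiv ℝ f x).det)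
    (hK : 1 ≤ K) (hKO : (L : ℝ) ^ 3 ≤ K * c) (hKI : (L : ℝ) ^ 6 ≤ K * c ^ 2) :
    IsQuasiregularOn f A ∧ maximalDilatation f (interior A) ≤ ENNReal.ofReal K := by
  have hae : ∀ᵐ x ∂volume.restrict (interior A),
      formalDeriv f x = fderiv ℝ f x ∧ c ≤ (fderiv ℝ f x).det ∧ ‖fderiv ℝ f x‖ ≤ L := by
    rw [ae_restrict_iff' isOpen_interior.measurableSet]
    filter_upwards [hJ, hL.ae_differentiableAt] with x h1 h2 hx
    exact ⟨formalDeriv_eq_fderiv (h2 hx), h1 hx (h2 hx), hL.norm_fderiv_le hx⟩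
  have hO : OuterBound f (interior A) K := by
    filter_upwards [hae] with x hx
    rw [jacobian, hx.1]
    calc ‖fderiv ℝ f x‖ ^ 3 ≤ (L : ℝ) ^ 3 := by gcongr; exact hx.2.2
      _ ≤ K * c := hKO
      _ ≤ _ := by gcongr; exact hx.2.1
  have hI : InnerBound f (interior A) K := by
    filter_upwards [hae] with x hx
    rw [jacobian, hx.1]
    obtain ⟨-, h1, h2⟩ := hx
    set T := fderiv ℝ f x
    have hLpos : 0 < (L : ℝ) := by
      rcases L.2.eq_or_lt with h | h
      · have h0 : ‖T‖ = 0 := le_antisymm (h2.trans_eq h.symm) (norm_nonneg _)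
        have := abs_det_le T (unitVec 0) (norm_unitVec 0)
        rw [h0] at this
        have := le_abs_self T.det
        nlinarith
      · exact h
    have hm : T.det / (L : ℝ) ^ 2 ≤ minStretch T := by
      refine le_minStretch fun v hv => ?_
      rw [div_le_iff₀ (by positivity)]
      calc T.det ≤ |T.det| := le_abs_self _
        _ ≤ ‖T‖ ^ 2 * ‖T v‖ := abs_det_le T v hv
        _ ≤ (L : ℝ) ^ 2 * ‖T v‖ := by gcongr
        _ = _ := mul_comm _ _
    have hd : 0 < T.det := hc.trans_le h1
    calc T.det = (L : ℝ) ^ 6 * T.det / (L : ℝ) ^ 6 := by field_simp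
      _ ≤ K * T.det ^ 2 * T.det / (L : ℝ) ^ 6 := by
        gcongr
        exact hKI.trans (by gcongr)
      _ = K * (T.det / (L : ℝ) ^ 2) ^ 3 := by field_simp
      _ ≤ _ := by gcongr
  refine ⟨⟨hcont, hL.isACL3, K, hK, hO⟩, max_le ?_ ?_⟩
  · exact iInf_le (fun K : {K : ℝ // 1 ≤ K ∧ InnerBound f (interior A) K} =>
      ENNReal.ofReal K) ⟨K, hK, hI⟩
  · exact iInf_le (fun K : {K : ℝ // 1 ≤ K ∧ OuterBound f (interior A) K} =>
      ENNReal.ofReal K) ⟨K, hK, hO⟩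

/-! ### Folding -/

lemma fold_of_abs_le {t : ℝ} (ht : |t| ≤ 1) : fold t = t := by
  have := abs_le.1 ht
  have hp := Real.pi_pos
  rw [fold_eq_arcsin, Real.arcsin_sin (by nlinarith) (by nlinarith)]
  field_simp

lemma fold_neg (t : ℝ) : fold (-t) = -fold t := by
  rw [fold_eq_arcsin, fold_eq_arcsin, mul_neg, neg_div, Real.sin_neg, Real.arcsin_neg, mul_neg]

lemma fold_two_mul_sub {n : ℤ} (hn : Odd n) (t : ℝ) : fold (2 * n - t) = fold t := by
  rw [fold_eq_iff, show Real.pi * (2 * n - t) / 2 = -(Real.pi * t / 2) + n * Real.pi by ring,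
    Real.sin_add_int_mul_pi, hn.neg_one_zpow, Real.sin_neg]
  ring

lemma fold_two_sub (t : ℝ) : fold (2 - t) = fold t := by
  simpa using fold_two_mul_sub odd_one t

lemma fold_one_add (t : ℝ) : fold (1 + t) = fold (1 - t) := by
  rw [← fold_two_sub]; congr 1; ring

lemma fold_one_sub_two_mul_sub {n : ℤ} (hn : Odd n) (t : ℝ) :
    fold (1 - (2 * n - t)) = -fold (1 - t) := by
  rw [show 1 - (2 * n - t) = -(2 * n - (1 + t)) by ring, fold_neg, fold_two_mul_sub hn,
    fold_one_add]

lemma sin_fold_one_sub (t : ℝ) :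
    Real.sin (Real.pi * fold (1 - t) / 2) = Real.cos (Real.pi * t / 2) := by
  rw [sin_fold, show Real.pi * (1 - t) / 2 = Real.pi / 2 - Real.pi * t / 2 by ring,
    Real.sin_pi_div_two_sub]

lemma fold_one_sub (s : ℝ) : fold (1 - s) = (-1) ^ foldIndex s * (1 - |fold s|) := by
  have hp := Real.pi_pos
  have hw := abs_fold_le s
  have hz := abs_fold_le (1 - s)
  have hc : Real.cos (Real.pi * fold s / 2) = Real.sin (Real.pi * (1 - |fold s|) / 2) := by
    rw [show Real.pi * (1 - |fold s|) / 2 = Real.pi / 2 - Real.pi * |fold s| / 2 by ring,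
      Real.sin_pi_div_two_sub]
    rcases abs_choice (fold s) with h | h <;> rw [h]
    rw [← Real.cos_neg]; congr 1; ring
  have h1 := sin_fold_one_sub s
  rw [← cos_fold, hc] at h1
  have h2 : Real.sin (Real.pi * fold (1 - s) / 2)
      = Real.sin (Real.pi * ((-1) ^ foldIndex s * (1 - |fold s|)) / 2) := by
    rw [h1]
    rcases neg_one_zpow_cases (foldIndex s) with h | h <;> rw [h]
    · simp
    · rw [neg_one_mul, neg_one_mul, ← Real.sin_neg]; congr 1; ring
  rw [← fold_eq_iff, fold_of_abs_le hz, fold_of_abs_le (t := (-1) ^ foldIndex s * _)] at h2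
  · exact h2
  · rw [abs_mul, abs_of_nonneg (by linarith : 0 ≤ 1 - |fold s|)]
    have := abs_nonneg (fold s)
    rcases neg_one_zpow_cases (foldIndex s) with h | h <;> rw [h] <;> simp

lemma abs_fold_one_sub (s : ℝ) : |fold (1 - s)| = 1 - |fold s| := by
  have hw := abs_fold_le s
  rw [fold_one_sub, abs_mul, abs_of_nonneg (by linarith : 0 ≤ 1 - |fold s|)]
  rcases neg_one_zpow_cases (foldIndex s) with h | h <;> rw [h] <;> simp

lemma abs_sub_foldIndex_le (t : ℝ) : |t - 2 * foldIndex t| ≤ 1 := by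
  have h := abs_fold_le t
  rw [fold, abs_mul] at h
  rcases neg_one_zpow_cases (foldIndex t) with h' | h' <;> rw [h'] at h <;> simpa using h

lemma two_le_add_fold {t : ℝ} (ht : 1 ≤ t) : 2 ≤ t + fold t := by
  have h1 := abs_le.1 (abs_fold_le t)
  have h2 := abs_le.1 (abs_sub_foldIndex_le t)
  rcases le_or_gt 3 t with h | h
  · linarith
  · have hk : foldIndex t < 2 := by
      have : (foldIndex t : ℝ) < 2 := by linarith
      exact_mod_cast this
    have hk0 : 0 ≤ foldIndex t := by
      have : (-1 : ℝ) < foldIndex t := by linarith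
      have : -1 < foldIndex t := by exact_mod_cast this
      omega
    have h3 : fold t = (-1) ^ foldIndex t * (t - 2 * foldIndex t) := rfl
    obtain h0 | h0 : foldIndex t = 0 ∨ foldIndex t = 1 := by omega
    · rw [h0] at h3; simp at h3; linarith
    · rw [h0] at h3; simp at h3; linarith

lemma fold_unfold (k : ℤ) (t : ℝ) : fold ((-1) ^ k * (t - 2 * k)) = fold t := by
  rw [fold_eq_iff, show Real.pi * t / 2 = Real.pi * (t - 2 * k) / 2 + k * Real.pi by ring,
    Real.sin_add_int_mul_pi]
  rcases neg_one_zpow_cases k with h | h <;> rw [h]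
  · simp
  · rw [neg_one_mul, neg_one_mul, ← Real.sin_neg]; congr 1; ring

lemma abs_fold_sub_fold_le (s t : ℝ) : |fold s - fold t| ≤ |s - t| := by
  have key : ∀ s t : ℝ, |s| ≤ 1 → |s - fold t| ≤ |s - t| := by
    have pos : ∀ s t : ℝ, |s| ≤ 1 → 1 ≤ t → |s - fold t| ≤ |s - t| := by
      intro s t hs ht
      have h1 := two_le_add_fold ht
      have h2 := abs_le.1 (abs_fold_le t)
      have h3 := abs_le.1 hs
      rw [abs_of_nonpos (by linarith : s - t ≤ 0), abs_le]
      constructor <;> linarith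
    intro s t hs
    rcases le_total |t| 1 with h | h
    · rw [fold_of_abs_le h]
    rcases le_abs.1 h with h | h
    · exact pos s t hs h
    · have := pos (-s) (-t) (by rwa [abs_neg]) h
      rwa [fold_neg, ← neg_sub', abs_neg, ← neg_sub', abs_neg] at this
  have := key (fold s) ((-1) ^ foldIndex s * (t - 2 * foldIndex s)) (abs_fold_le s)
  rw [fold_unfold] at this
  refine this.trans_eq ?_
  rw [fold, ← mul_sub, abs_mul]
  rcases neg_one_zpow_cases (foldIndex s) with h | h <;> rw [h] <;> simp

lemma hasDerivAt_fold {s : ℝ} (hs : |fold s| < 1) :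
    HasDerivAt fold ((-1 : ℝ) ^ foldIndex s) s := by
  have h1 : |s - 2 * foldIndex s| < 1 := by
    rw [fold, abs_mul] at hs
    rcases neg_one_zpow_cases (foldIndex s) with h' | h' <;> rw [h'] at hs <;> simpa using hs
  have h2 : ∀ᶠ x : ℝ in 𝓝 s, |x - 2 * foldIndex s| < 1 :=
    (by fun_prop : Continuous fun x : ℝ => |x - 2 * foldIndex s|).continuousAt.eventually_lt
      continuousAt_const h1
  have h3 : fold =ᶠ[𝓝 s] fun x : ℝ => (-1 : ℝ) ^ foldIndex s * (x - 2 * foldIndex s) := by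
    filter_upwards [h2] with x hx
    have : foldIndex x = foldIndex s := by
      rw [abs_lt] at hx
      rw [foldIndex, round_eq, Int.floor_eq_iff]
      constructor <;> linarith
    rw [fold, this]
  have h4 : HasDerivAt (fun x : ℝ => (-1 : ℝ) ^ foldIndex s * (x - 2 * foldIndex s))
      ((-1) ^ foldIndex s * 1) s := ((hasDerivAt_id s).sub_const _).const_mul _
  rw [mul_one] at h4
  exact h4.congr_of_eventuallyEq h3

lemma fold_three_mul (s : ℝ) :
    fold (3 * s) = 3 * fold s - max 0 (6 * fold s - 2) + max 0 (-6 * fold s - 2) := by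
  have h1 : fold (3 * s) = fold (3 * fold s) := by
    rw [fold_eq_iff, show Real.pi * (3 * s) / 2 = 3 * (Real.pi * s / 2) by ring,
      show Real.pi * (3 * fold s) / 2 = 3 * (Real.pi * fold s / 2) by ring,
      Real.sin_three_mul, Real.sin_three_mul, sin_fold]
  have h2 := abs_le.1 (abs_fold_le s)
  rw [h1]
  generalize fold s = w at *
  rcases le_total (3 * w) 1 with h3 | h3
  · rcases le_total (-1) (3 * w) with h4 | h4
    · rw [fold_of_abs_le (abs_le.2 ⟨h4, h3⟩), max_eq_left (by linarith), max_eq_left (by linarith)]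
      ring
    · rw [max_eq_left (by linarith), max_eq_right (by linarith),
        show 3 * w = -(2 - (2 + 3 * w)) by ring, fold_neg, fold_two_sub, fold_of_abs_le]
      · ring
      · rw [abs_le]; constructor <;> linarith
  · rw [max_eq_right (by linarith), max_eq_left (by linarith), ← fold_two_sub, fold_of_abs_le]
    · ring
    · rw [abs_le]; constructor <;> linarith

lemma fold_one_sub_three_mul (s : ℝ) : fold (1 - 3 * s) = -fold (3 * (1 - s)) := by
  rw [← fold_neg, ← fold_two_mul_sub (n := -1) (by decide) (-(3 * (1 - s)))]
  congr 1; push_cast; ring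

/-! ### The product of signs with the smaller modulus -/

/-- The number with the sign of `x * y` and the smaller of the moduli of `x` and `y`. -/
def sgnMin (x y : ℝ) : ℝ := (|x + y| - |x - y|) / 2

lemma sgnMin_comm (x y : ℝ) : sgnMin x y = sgnMin y x := by
  rw [sgnMin, sgnMin, add_comm, abs_sub_comm]

lemma sgnMin_neg_left (x y : ℝ) : sgnMin (-x) y = -sgnMin x y := by
  rw [sgnMin, sgnMin, ← abs_neg (-x + y), ← abs_neg (-x - y)]
  rw [show -(-x + y) = x - y by ring, show -(-x - y) = x + y by ring]
  ring

lemma sgnMin_neg_right (x y : ℝ) : sgnMin x (-y) = -sgnMin x y := by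
  rw [sgnMin_comm, sgnMin_neg_left, sgnMin_comm]

lemma sgnMin_of_nonneg {x y : ℝ} (hx : 0 ≤ x) (hy : 0 ≤ y) : sgnMin x y = min x y := by
  rw [sgnMin, abs_of_nonneg (add_nonneg hx hy), min_def]
  split_ifs with h
  · rw [abs_of_nonpos (by linarith)]; ring
  · rw [abs_of_nonneg (by linarith)]; ring

lemma sgnMin_mul {r : ℝ} (hr : 0 ≤ r) (x y : ℝ) : sgnMin (r * x) (r * y) = r * sgnMin x y := by
  rw [sgnMin, sgnMin, ← mul_add, ← mul_sub, abs_mul, abs_mul, abs_of_nonneg hr]; ring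

lemma abs_sgnMin (x y : ℝ) : |sgnMin x y| = min |x| |y| := by
  rcases le_total 0 x with hx | hx <;> rcases le_total 0 y with hy | hy
  · rw [sgnMin_of_nonneg hx hy, abs_of_nonneg hx, abs_of_nonneg hy, abs_of_nonneg (le_min hx hy)]
  · rw [← neg_neg y, sgnMin_neg_right, sgnMin_of_nonneg hx (by linarith), abs_neg, abs_neg,
      abs_of_nonneg hx, abs_of_nonneg (by linarith : 0 ≤ -y),
      abs_of_nonneg (le_min hx (by linarith))]
  · rw [← neg_neg x, sgnMin_neg_left, sgnMin_of_nonneg (by linarith) hy, abs_neg, abs_neg,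
      abs_of_nonneg hy, abs_of_nonneg (by linarith : 0 ≤ -x),
      abs_of_nonneg (le_min (by linarith) hy)]
  · rw [← neg_neg x, ← neg_neg y, sgnMin_neg_left, sgnMin_neg_right,
      sgnMin_of_nonneg (by linarith) (by linarith), neg_neg, neg_neg, neg_neg, abs_of_nonpos hx,
      abs_of_nonpos hy, abs_of_nonneg (le_min (by linarith) (by linarith))]

lemma abs_sgnMin_sub_le (x y x' y' : ℝ) :
    |sgnMin x y - sgnMin x' y'| ≤ |x - x'| + |y - y'| := by
  have h1 := abs_abs_sub_abs_le (x + y) (x' + y')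
  have h2 := abs_abs_sub_abs_le (x - y) (x' - y')
  have h3 : |x + y - (x' + y')| ≤ |x - x'| + |y - y'| := by
    rw [show x + y - (x' + y') = (x - x') + (y - y') by ring]; exact abs_add_le _ _
  have h4 : |x - y - (x' - y')| ≤ |x - x'| + |y - y'| := by
    rw [show x - y - (x' - y') = (x - x') - (y - y') by ring]; exact abs_sub _ _
  rw [sgnMin, sgnMin, abs_le]
  have h5 := abs_le.1 (h1.trans h3)
  have h6 := abs_le.1 (h2.trans h4)
  constructor <;> linarith

/-! ### A planar interpolation and its extension to space -/

/-- An odd function of `a`, which is `a` for `r = 1` and the threefold fold for `r = R`. -/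
def bendRe (R r a : ℝ) : ℝ :=
  3 * a - max 0 (max (2 * a - 4 * (r - 1)) (6 * a - (R + r)))
    + max 0 (max (-2 * a - 4 * (r - 1)) (-6 * a - (R + r)))

/-- An odd function of `c`, which is `c` for `r = 1` and minus the threefold fold for `r = R`. -/
def bendIm (R r c : ℝ) : ℝ :=
  c - max 0 (min (4 * c) ((5 * r - R) / 2 - 2 * c))
    + max 0 (min (-4 * c) ((5 * r - R) / 2 + 2 * c))

def planarRe (R r s : ℝ) : ℝ := bendRe R r (r * fold s)

def planarIm (R r s : ℝ) : ℝ := bendIm R r (r * fold (1 - s))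

/-- The map interpolating, for `1 ≤ x 2 ≤ R`, between two piecewise linear Zorich maps. -/
def interp (R : ℝ) (x : E3) : E3 :=
  !₂[planarRe R (x 2) (x 0), planarRe R (x 2) (x 1),
    sgnMin (planarIm R (x 2) (x 0)) (planarIm R (x 2) (x 1))]

/-- The parametrization of the octahedron-like surface `max |a| |b| + |c| = 1` that corresponds
to the Zorich map. -/
def octa (s t : ℝ) : E3 := !₂[fold s, fold t, sgnMin (fold (1 - s)) (fold (1 - t))]

/-- The gauge of the octahedron-like body `max |a| |b| + |c| ≤ 1`. -/
def gauge (v : E3) : ℝ := max |v 0| |v 1| + |v 2|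

lemma bendRe_neg (R r a : ℝ) : bendRe R r (-a) = -bendRe R r a := by
  unfold bendRe
  rw [show -2 * -a = 2 * a by ring, show -6 * -a = 6 * a by ring,
    show 2 * -a = -2 * a by ring, show 6 * -a = -6 * a by ring]
  ring

lemma bendIm_neg (R r c : ℝ) : bendIm R r (-c) = -bendIm R r c := by
  unfold bendIm
  rw [show -4 * -c = 4 * c by ring, show 4 * -c = -4 * c by ring,
    show (5 * r - R) / 2 - 2 * -c = (5 * r - R) / 2 + 2 * c by ring,
    show (5 * r - R) / 2 + 2 * -c = (5 * r - R) / 2 - 2 * c by ring]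
  ring

lemma bendRe_of_nonneg {R r a : ℝ} (hR : 0 ≤ R) (hr : 1 ≤ r) (ha : 0 ≤ a) :
    bendRe R r a = min (min (3 * a) (a + 4 * (r - 1))) (R + r - 3 * a) := by
  unfold bendRe
  rw [max_eq_left (b := max (-2 * a - _) _) (max_le (by linarith) (by linarith)),
    min_assoc, min_def, min_def, max_def, max_def]
  split_ifs <;> linarith

lemma bendIm_of_nonneg {R r c : ℝ} (hc : 0 ≤ c) :
    bendIm R r c = min c (max (-3 * c) (3 * c - (5 * r - R) / 2)) := by
  unfold bendIm
  rw [max_eq_left (b := min (-4 * c) _) (min_le_of_left_le (by linarith)),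
    min_def, min_def, max_def, max_def]
  split_ifs <;> linarith

lemma abs_max_max_sub_le {a b a' b' C : ℝ} (ha : |a - a'| ≤ C) (hb : |b - b'| ≤ C) :
    |max 0 (max a b) - max 0 (max a' b')| ≤ C := by
  have h0 : 0 ≤ C := (abs_nonneg _).trans ha
  refine (abs_max_sub_max_le_max _ _ _ _).trans (max_le (by simpa using h0) ?_)
  exact (abs_max_sub_max_le_max _ _ _ _).trans (max_le ha hb)

lemma abs_max_min_sub_le {a b a' b' C : ℝ} (ha : |a - a'| ≤ C) (hb : |b - b'| ≤ C) :
    |max 0 (min a b) - max 0 (min a' b')| ≤ C := by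
  have h0 : 0 ≤ C := (abs_nonneg _).trans ha
  refine (abs_max_sub_max_le_max _ _ _ _).trans (max_le (by simpa using h0) ?_)
  exact (abs_min_sub_min_le_max _ _ _ _).trans (max_le ha hb)

lemma abs_bendRe_sub_le (R r a r' a' : ℝ) :
    |bendRe R r a - bendRe R r' a'| ≤ 15 * (|r - r'| + |a - a'|) := by
  have hr := abs_nonneg (r - r')
  have ha := abs_nonneg (a - a')
  have r1 := le_abs_self (r - r')
  have r2 := neg_abs_le (r - r')
  have a1 := le_abs_self (a - a')
  have a2 := neg_abs_le (a - a')
  have h1 : |max 0 (max (2 * a - 4 * (r - 1)) (6 * a - (R + r)))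
      - max 0 (max (2 * a' - 4 * (r' - 1)) (6 * a' - (R + r')))| ≤ 6 * (|r - r'| + |a - a'|) := by
    apply abs_max_max_sub_le <;> rw [abs_le] <;> constructor <;> linarith
  have h2 : |max 0 (max (-2 * a - 4 * (r - 1)) (-6 * a - (R + r)))
      - max 0 (max (-2 * a' - 4 * (r' - 1)) (-6 * a' - (R + r')))|
      ≤ 6 * (|r - r'| + |a - a'|) := by
    apply abs_max_max_sub_le <;> rw [abs_le] <;> constructor <;> linarith
  unfold bendRe
  rw [abs_le] at *
  constructor <;> linarith [h1.1, h1.2, h2.1, h2.2]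

lemma abs_bendIm_sub_le (R r a r' a' : ℝ) :
    |bendIm R r a - bendIm R r' a'| ≤ 15 * (|r - r'| + |a - a'|) := by
  have hr := abs_nonneg (r - r')
  have ha := abs_nonneg (a - a')
  have r1 := le_abs_self (r - r')
  have r2 := neg_abs_le (r - r')
  have a1 := le_abs_self (a - a')
  have a2 := neg_abs_le (a - a')
  have h1 : |max 0 (min (4 * a) ((5 * r - R) / 2 - 2 * a))
      - max 0 (min (4 * a') ((5 * r' - R) / 2 - 2 * a'))| ≤ 6 * (|r - r'| + |a - a'|) := by
    apply abs_max_min_sub_le <;> rw [abs_le] <;> constructor <;> linarith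
  have h2 : |max 0 (min (-4 * a) ((5 * r - R) / 2 + 2 * a))
      - max 0 (min (-4 * a') ((5 * r' - R) / 2 + 2 * a'))|
      ≤ 6 * (|r - r'| + |a - a'|) := by
    apply abs_max_min_sub_le <;> rw [abs_le] <;> constructor <;> linarith
  unfold bendIm
  rw [abs_le] at *
  constructor <;> linarith [h1.1, h1.2, h2.1, h2.2]

lemma abs_mul_fold_sub_le {R r r' : ℝ} (hr : 0 ≤ r) (hrR : r ≤ R) (s s' : ℝ) :
    |r * fold s - r' * fold s'| ≤ |r - r'| + R * |s - s'| := by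
  have h1 := abs_fold_sub_fold_le s s'
  have h2 := abs_fold_le s'
  rw [show r * fold s - r' * fold s' = (r - r') * fold s' + r * (fold s - fold s') by ring]
  refine (abs_add_le _ _).trans ?_
  rw [abs_mul, abs_mul, abs_of_nonneg hr]
  have h3 := abs_nonneg (r - r')
  have h4 := abs_nonneg (fold s - fold s')
  have hR : 0 ≤ R := hr.trans hrR
  gcongr
  · nlinarith

lemma abs_planarRe_sub_le {R r r' : ℝ} (hr : 0 ≤ r) (hrR : r ≤ R) (s s' : ℝ) :
    |planarRe R r s - planarRe R r' s'| ≤ 30 * |r - r'| + 15 * R * |s - s'| := by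
  have h1 := abs_bendRe_sub_le R r (r * fold s) r' (r' * fold s')
  have h2 := abs_mul_fold_sub_le (r' := r') hr hrR s s'
  unfold planarRe
  linarith

lemma abs_planarIm_sub_le {R r r' : ℝ} (hr : 0 ≤ r) (hrR : r ≤ R) (s s' : ℝ) :
    |planarIm R r s - planarIm R r' s'| ≤ 30 * |r - r'| + 15 * R * |s - s'| := by
  have h1 := abs_bendIm_sub_le R r (r * fold (1 - s)) r' (r' * fold (1 - s'))
  have h2 := abs_mul_fold_sub_le (r' := r') hr hrR (1 - s) (1 - s')
  rw [show 1 - s - (1 - s') = -(s - s') by ring, abs_neg] at h2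
  unfold planarIm
  linarith

lemma norm_interp_sub_le {R : ℝ} {x y : E3} (hx : 0 ≤ x 2) (hxR : x 2 ≤ R) :
    ‖interp R x - interp R y‖
      ≤ 120 * |x 2 - y 2| + 30 * R * (|x 0 - y 0| + |x 1 - y 1|) := by
  have h0 := abs_planarRe_sub_le (r' := y 2) hx hxR (x 0) (y 0)
  have h1 := abs_planarRe_sub_le (r' := y 2) hx hxR (x 1) (y 1)
  have h2 := abs_planarIm_sub_le (r' := y 2) hx hxR (x 0) (y 0)
  have h3 := abs_planarIm_sub_le (r' := y 2) hx hxR (x 1) (y 1)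
  have h4 := abs_sgnMin_sub_le (planarIm R (x 2) (x 0)) (planarIm R (x 2) (x 1))
    (planarIm R (y 2) (y 0)) (planarIm R (y 2) (y 1))
  refine (norm_le_sum_abs _).trans ?_
  simp only [interp, PiLp.sub_apply, Matrix.cons_val_zero, Matrix.cons_val_one,
    Matrix.cons_val]
  linarith

lemma interp_inner {R : ℝ} (hR : 20 ≤ R) {x : E3} (hx : x 2 = 1) :
    interp R x = octa (x 0) (x 1) := by
  have h1 : ∀ s, planarRe R 1 s = fold s := by
    intro s
    have := abs_le.1 (abs_fold_le s)
    unfold planarRe bendRe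
    simp only [max_def]
    split_ifs <;> linarith
  have h2 : ∀ s, planarIm R 1 s = fold (1 - s) := by
    intro s
    have := abs_le.1 (abs_fold_le (1 - s))
    unfold planarIm bendIm
    simp only [max_def, min_def]
    split_ifs <;> linarith
  simp only [interp, hx, h1, h2, octa]

lemma interp_outer {R : ℝ} (hR : 20 ≤ R) {x : E3} (hx : x 2 = R) :
    interp R x = R • octa (3 * x 0) (3 * x 1) := by
  have h1 : ∀ s, planarRe R R s = R * fold (3 * s) := by
    intro s
    rw [fold_three_mul, mul_add, mul_sub, mul_max_of_nonneg _ _ (by linarith : 0 ≤ R),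
      mul_max_of_nonneg _ _ (by linarith : 0 ≤ R)]
    have h := abs_le.1 (abs_fold_le s)
    have h3 : R * fold s ≤ R := by nlinarith
    have h4 : -R ≤ R * fold s := by nlinarith
    unfold planarRe bendRe
    simp only [max_def]
    split_ifs <;> linarith
  have h2 : ∀ s, planarIm R R s = R * fold (1 - 3 * s) := by
    intro s
    rw [fold_one_sub_three_mul, fold_three_mul, mul_neg, mul_add, mul_sub,
      mul_max_of_nonneg _ _ (by linarith : 0 ≤ R), mul_max_of_nonneg _ _ (by linarith : 0 ≤ R)]
    have h := abs_le.1 (abs_fold_le (1 - s))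
    have h3 : R * fold (1 - s) ≤ R := by nlinarith
    have h4 : -R ≤ R * fold (1 - s) := by nlinarith
    unfold planarIm bendIm
    simp only [max_def, min_def]
    split_ifs <;> linarith
  simp only [interp, hx, h1, h2, octa, sgnMin_mul (by linarith : 0 ≤ R)]
  ext i
  fin_cases i <;> simp

lemma gauge_octa (s t : ℝ) : gauge (octa s t) = 1 := by
  simp only [gauge, octa, PiLp.toLp_apply, Matrix.cons_val_zero, Matrix.cons_val_one,
    Matrix.cons_val, abs_sgnMin, abs_fold_one_sub]
  rw [max_def, min_def]
  split_ifs <;> linarith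

lemma abs_planarRe_add_abs_planarIm_le {R r : ℝ} (hr : 1 ≤ r) (hrR : r ≤ R) (s : ℝ) :
    |planarRe R r s| + |planarIm R r s| ≤ R := by
  have e1 : |planarRe R r s| = |bendRe R r (r * |fold s|)| := by
    rcases abs_choice (fold s) with h | h <;> rw [h, planarRe]
    rw [mul_neg, bendRe_neg, abs_neg]
  have e2 : |planarIm R r s| = |bendIm R r (r - r * |fold s|)| := by
    rw [show r - r * |fold s| = r * |fold (1 - s)| by rw [abs_fold_one_sub]; ring]
    rcases abs_choice (fold (1 - s)) with h | h <;> rw [h, planarIm]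
    rw [mul_neg, bendIm_neg, abs_neg]
  have h1 := abs_fold_le s
  have h2 : 0 ≤ r * |fold s| := by positivity
  have h3 : r * |fold s| ≤ r := by nlinarith
  rw [e1, e2]
  generalize r * |fold s| = m at *
  rw [bendRe_of_nonneg (by linarith) hr h2, bendIm_of_nonneg (by linarith)]
  have key : ∀ A B : ℝ, A + B ≤ R → A - B ≤ R → -A + B ≤ R → -A - B ≤ R → |A| + |B| ≤ R := by
    intro A B h1 h2 h3 h4
    rcases abs_choice A with h | h <;> rcases abs_choice B with h' | h' <;> rw [h, h'] <;> linarith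
  simp only [min_def, max_def]
  apply key <;> split_ifs <;> linarith

lemma gauge_interp_le {R : ℝ} {x : E3} (hx : 1 ≤ x 2) (hxR : x 2 ≤ R) :
    gauge (interp R x) ≤ R := by
  have h0 := abs_planarRe_add_abs_planarIm_le hx hxR (x 0)
  have h1 := abs_planarRe_add_abs_planarIm_le hx hxR (x 1)
  simp only [gauge, interp, PiLp.toLp_apply, Matrix.cons_val_zero, Matrix.cons_val_one,
    Matrix.cons_val, abs_sgnMin]
  rcases max_cases |planarRe R (x 2) (x 0)| |planarRe R (x 2) (x 1)| with h | h <;> rw [h.1]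
  · linarith [min_le_left |planarIm R (x 2) (x 0)| |planarIm R (x 2) (x 1)|]
  · linarith [min_le_right |planarIm R (x 2) (x 0)| |planarIm R (x 2) (x 1)|]

/-! ### Derivatives of locally Lipschitz functions -/

/-- The `i`-th coordinate as a continuous linear functional. -/
abbrev coord (i : Fin 3) : E3 →L[ℝ] ℝ := EuclideanSpace.proj i

lemma hasFDerivAt_coord (i : Fin 3) (x : E3) : HasFDerivAt (fun y : E3 => y i) (coord i) x :=
  (coord i).hasFDerivAt

lemma locallyLipschitz_coord (i : Fin 3) : LocallyLipschitz fun y : E3 => y i :=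
  (coord i).lipschitz.locallyLipschitz

lemma exists_hasFDerivAt_of_coords {f : E3 → E3} {x : E3} {D : Fin 3 → E3 →L[ℝ] ℝ}
    (h : ∀ i, HasFDerivAt (fun y => f y i) (D i) x) :
    ∃ T : E3 →L[ℝ] E3, HasFDerivAt f T x ∧ ∀ v i, T v i = D i v := by
  have hf : DifferentiableAt ℝ f x := differentiableAt_euclidean.2 fun i => (h i).differentiableAt
  refine ⟨_, hf.hasFDerivAt, fun v i => ?_⟩
  have h1 := (coord i).hasFDerivAt.comp x hf.hasFDerivAt
  have h2 := h1.unique (h i)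
  rw [← h2]
  rfl

lemma LocallyLipschitz.ae_differentiableAt {F : Type*} [NormedAddCommGroup F] [NormedSpace ℝ F]
    [FiniteDimensional ℝ F] {u : E3 → F} (hu : LocallyLipschitz u) :
    ∀ᵐ x : E3, DifferentiableAt ℝ u x := by
  have := ae_mem_of_locally (p := fun x => DifferentiableAt ℝ u x) (U := univ) fun x _ => by
    obtain ⟨K, t, ht, hK⟩ := hu x
    refine ⟨interior t, interior_mem_nhds.2 ht, ?_⟩
    filter_upwards [(hK.mono interior_subset).ae_differentiableWithinAt_of_mem (μ := volume)]
      with y hy hyV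
    exact (hy hyV).differentiableAt (isOpen_interior.mem_nhds hyV)
  simpa using this

lemma hasFDerivAt_max_cases {u v : E3 → ℝ} {u' v' : E3 →L[ℝ] ℝ} {x : E3}
    (hu : HasFDerivAt u u' x) (hv : HasFDerivAt v v' x)
    (hm : DifferentiableAt ℝ (fun y => max (u y) (v y)) x) :
    (v x ≤ u x ∧ HasFDerivAt (fun y => max (u y) (v y)) u' x) ∨
      (u x ≤ v x ∧ HasFDerivAt (fun y => max (u y) (v y)) v' x) := by
  rcases le_total (v x) (u x) with h | h
  · refine Or.inl ⟨h, ?_⟩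
    have h1 : IsLocalMin (fun y => max (u y) (v y) - u y) x := by
      refine Eventually.of_forall fun y => ?_
      simp only [max_eq_left h, sub_self, sub_nonneg, le_max_left]
    have h2 := h1.hasFDerivAt_eq_zero (hm.hasFDerivAt.sub hu)
    rw [← sub_eq_zero.1 h2]
    exact hm.hasFDerivAt
  · refine Or.inr ⟨h, ?_⟩
    have h1 : IsLocalMin (fun y => max (u y) (v y) - v y) x := by
      refine Eventually.of_forall fun y => ?_
      simp only [max_eq_right h, sub_self, sub_nonneg, le_max_right]
    have h2 := h1.hasFDerivAt_eq_zero (hm.hasFDerivAt.sub hv)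
    rw [← sub_eq_zero.1 h2]
    exact hm.hasFDerivAt

lemma hasFDerivAt_min_cases {u v : E3 → ℝ} {u' v' : E3 →L[ℝ] ℝ} {x : E3}
    (hu : HasFDerivAt u u' x) (hv : HasFDerivAt v v' x)
    (hm : DifferentiableAt ℝ (fun y => min (u y) (v y)) x) :
    (u x ≤ v x ∧ HasFDerivAt (fun y => min (u y) (v y)) u' x) ∨
      (v x ≤ u x ∧ HasFDerivAt (fun y => min (u y) (v y)) v' x) := by
  rcases le_total (u x) (v x) with h | h
  · refine Or.inl ⟨h, ?_⟩
    have h1 : IsLocalMax (fun y => min (u y) (v y) - u y) x := by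
      refine Eventually.of_forall fun y => ?_
      simp only [min_eq_left h, sub_self, sub_nonpos, min_le_left]
    have h2 := h1.hasFDerivAt_eq_zero (hm.hasFDerivAt.sub hu)
    rw [← sub_eq_zero.1 h2]
    exact hm.hasFDerivAt
  · refine Or.inr ⟨h, ?_⟩
    have h1 : IsLocalMax (fun y => min (u y) (v y) - v y) x := by
      refine Eventually.of_forall fun y => ?_
      simp only [min_eq_right h, sub_self, sub_nonpos, min_le_right]
    have h2 := h1.hasFDerivAt_eq_zero (hm.hasFDerivAt.sub hv)
    rw [← sub_eq_zero.1 h2]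
    exact hm.hasFDerivAt

lemma hasFDerivAt_abs_cases {u : E3 → ℝ} {u' : E3 →L[ℝ] ℝ} {x : E3}
    (hu : HasFDerivAt u u' x) (hm : DifferentiableAt ℝ (fun y => |u y|) x) :
    (0 ≤ u x ∧ HasFDerivAt (fun y => |u y|) u' x) ∨
      (u x ≤ 0 ∧ HasFDerivAt (fun y => |u y|) (-u') x) := by
  rcases hasFDerivAt_max_cases hu hu.neg hm with h | h
  · exact Or.inl ⟨by simpa using h.1, h.2⟩
  · exact Or.inr ⟨by simpa using h.1, h.2⟩

lemma LocallyLipschitz.abs {u : E3 → ℝ} (hu : LocallyLipschitz u) :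
    LocallyLipschitz fun x => |u x| :=
  lipschitzWith_one_norm.locallyLipschitz.comp hu

lemma LocallyLipschitz.mul_real {u v : E3 → ℝ} (hu : LocallyLipschitz u)
    (hv : LocallyLipschitz v) : LocallyLipschitz fun x => u x * v x :=
  (contDiff_mul (𝕜 := ℝ) (𝔸 := ℝ) (n := 1)).locallyLipschitz.comp (hu.prodMk hv)

/-- At almost every zero of a locally Lipschitz function its derivative vanishes. -/
lemma LocallyLipschitz.ae_eq_zero_imp {u : E3 → ℝ} (hu : LocallyLipschitz u) :
    ∀ᵐ x : E3, ∀ u' : E3 →L[ℝ] ℝ, HasFDerivAt u u' x → u x = 0 → u' = 0 := by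
  filter_upwards [LocallyLipschitz.ae_differentiableAt (LocallyLipschitz.abs hu)]
    with x hx u' hu' h0
  have h1 : IsLocalMin (fun y => |u y|) x :=
    Eventually.of_forall fun y => by simp [h0]
  have h2 := h1.fderiv_eq_zero
  rcases hasFDerivAt_abs_cases hu' hx with h | h
  · rw [← h.2.fderiv, h2]
  · rw [← neg_eq_zero, ← h.2.fderiv, h2]

lemma coord_ne_zero (i : Fin 3) : coord i ≠ 0 := by
  intro h
  have := congrArg (fun T : E3 →L[ℝ] ℝ => T (unitVec i)) h
  simp [unitVec] at this

lemma ae_coord_ne (i : Fin 3) (c : ℝ) : ∀ᵐ x : E3, x i ≠ c := by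
  have h : LocallyLipschitz fun x : E3 => x i - c :=
    (IsometryEquiv.subRight c).isometry.lipschitz.locallyLipschitz.comp (locallyLipschitz_coord i)
  filter_upwards [LocallyLipschitz.ae_eq_zero_imp h] with x hx h0
  exact coord_ne_zero i (hx _ ((hasFDerivAt_coord i x).sub_const c) (sub_eq_zero.2 h0))

/-! ### The Jacobian of the interpolation -/

lemma locallyLipschitz_fold : LocallyLipschitz fold :=
  (LipschitzWith.of_dist_le_mul (K := 1) fun s t => by
    simpa [Real.dist_eq] using abs_fold_sub_fold_le s t).locallyLipschitz

lemma exists_int_of_fold_eq_zero {t : ℝ} (h : fold t = 0) : ∃ k : ℤ, t = 2 * k := by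
  refine ⟨foldIndex t, ?_⟩
  rw [fold] at h
  rcases neg_one_zpow_cases (foldIndex t) with h' | h' <;> rw [h'] at h <;> linarith

lemma ae_fold_ne_zero (i : Fin 3) :
    ∀ᵐ x : E3, fold (x i) ≠ 0 ∧ fold (1 - x i) ≠ 0 := by
  filter_upwards [ae_all_iff.2 fun k : ℤ => ae_coord_ne i (2 * k),
    ae_all_iff.2 fun k : ℤ => ae_coord_ne i (1 - 2 * k)] with x h1 h2
  constructor
  · intro h
    obtain ⟨k, hk⟩ := exists_int_of_fold_eq_zero h
    exact h1 k hk
  · intro h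
    obtain ⟨k, hk⟩ := exists_int_of_fold_eq_zero h
    exact h2 k (by linarith)

/-- The derivatives of the planar interpolation on the first fundamental interval, where
`M = (r |fold s|, r)`. -/
lemma bend_branches {R r m : ℝ} (hR : 20 ≤ R) (hr : 1 < r)
    (hmr : m < r) {M : E3 → ℝ × ℝ} {x : E3} {dm dr : E3 →L[ℝ] ℝ} (hM : M x = (m, r))
    (h1 : HasFDerivAt (fun y => (M y).1) dm x) (h2 : HasFDerivAt (fun y => (M y).2) dr x)
    (d1 : DifferentiableAt ℝ (fun y => min (3 * (M y).1) ((M y).1 + 4 * ((M y).2 - 1))) x)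
    (d2 : DifferentiableAt ℝ (fun y => min (min (3 * (M y).1) ((M y).1 + 4 * ((M y).2 - 1)))
      (R + (M y).2 - 3 * (M y).1)) x)
    (d3 : DifferentiableAt ℝ (fun y => max (-3 * ((M y).2 - (M y).1))
      (3 * ((M y).2 - (M y).1) - (5 * (M y).2 - R) / 2)) x)
    (d4 : DifferentiableAt ℝ (fun y => min ((M y).2 - (M y).1) (max (-3 * ((M y).2 - (M y).1))
      (3 * ((M y).2 - (M y).1) - (5 * (M y).2 - R) / 2))) x) :
    ∃ α β γ δ : ℝ,
      HasFDerivAt (fun y => min (min (3 * (M y).1) ((M y).1 + 4 * ((M y).2 - 1)))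
        (R + (M y).2 - 3 * (M y).1)) (α • dm + β • dr) x ∧
      HasFDerivAt (fun y => min ((M y).2 - (M y).1) (max (-3 * ((M y).2 - (M y).1))
        (3 * ((M y).2 - (M y).1) - (5 * (M y).2 - R) / 2))) (γ • dm + δ • dr) x ∧
      3 / 2 ≤ α * δ - β * γ ∧
      (0 < min (r - m) (max (-3 * (r - m)) (3 * (r - m) - (5 * r - R) / 2)) → 1 ≤ α) ∧
      (min (r - m) (max (-3 * (r - m)) (3 * (r - m) - (5 * r - R) / 2)) < 0 → α ≤ -1) := by
  have a1 : HasFDerivAt (fun y => 3 * (M y).1) ((3 : ℝ) • dm) x := h1.const_mul 3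
  have a2 : HasFDerivAt (fun y => (M y).1 + 4 * ((M y).2 - 1)) (dm + (4 : ℝ) • dr) x :=
    h1.add ((h2.sub_const 1).const_mul 4)
  have a3 : HasFDerivAt (fun y => R + (M y).2 - 3 * (M y).1) (dr - (3 : ℝ) • dm) x :=
    (h2.const_add R).sub a1
  have b1 : HasFDerivAt (fun y => (M y).2 - (M y).1) (dr - dm) x := h2.sub h1
  have b2 : HasFDerivAt (fun y => -3 * ((M y).2 - (M y).1)) ((-3 : ℝ) • (dr - dm)) x :=
    b1.const_mul (-3)
  have b3 : HasFDerivAt (fun y => 3 * ((M y).2 - (M y).1) - (5 * (M y).2 - R) / 2)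
      ((3 : ℝ) • (dr - dm) - (5 / 2 : ℝ) • dr) x := by
    have := (b1.const_mul 3).sub (((h2.const_mul 5).sub_const R).const_mul (1 / 2))
    refine (this.congr_of_eventuallyEq (Eventually.of_forall fun y => ?_)).congr_fderiv ?_
    · simp only [Pi.sub_apply]; ring
    · module
  have c1 : ∃ α β : ℝ, HasFDerivAt (fun y => min (min (3 * (M y).1) ((M y).1 + 4 * ((M y).2 - 1)))
        (R + (M y).2 - 3 * (M y).1)) (α • dm + β • dr) x ∧
      ((α = 3 ∧ β = 0 ∧ 6 * m ≤ R + r) ∨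
        (α = 1 ∧ β = 4 ∧ m + 4 * (r - 1) ≤ 3 * m ∧ 4 * m + 4 * (r - 1) ≤ R + r) ∨
        (α = -3 ∧ β = 1 ∧ R + r ≤ 6 * m)) := by
    rcases hasFDerivAt_min_cases a1 a2 d1 with ⟨e1, e2⟩ | ⟨e1, e2⟩ <;>
    rcases hasFDerivAt_min_cases e2 a3 d2 with ⟨e3, e4⟩ | ⟨e3, e4⟩ <;>
    simp only [hM] at e1 e3
    · exact ⟨3, 0, e4.congr_fderiv (by module), Or.inl ⟨rfl, rfl, by
        rw [min_eq_left e1] at e3; linarith⟩⟩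
    · exact ⟨-3, 1, e4.congr_fderiv (by module), Or.inr (Or.inr ⟨rfl, rfl, by
        rw [min_eq_left e1] at e3; linarith⟩)⟩
    · exact ⟨1, 4, e4.congr_fderiv (by module), Or.inr (Or.inl ⟨rfl, rfl, e1, by
        rw [min_eq_right e1] at e3; linarith⟩)⟩
    · exact ⟨-3, 1, e4.congr_fderiv (by module), Or.inr (Or.inr ⟨rfl, rfl, by
        rw [min_eq_right e1] at e3; linarith⟩)⟩
  have c2 : ∃ γ δ : ℝ, HasFDerivAt (fun y => min ((M y).2 - (M y).1)
        (max (-3 * ((M y).2 - (M y).1))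
        (3 * ((M y).2 - (M y).1) - (5 * (M y).2 - R) / 2))) (γ • dm + δ • dr) x ∧
      ((γ = -1 ∧ δ = 1 ∧ r - m ≤ 3 * (r - m) - (5 * r - R) / 2) ∨
        (γ = 3 ∧ δ = -3 ∧ 3 * (r - m) - (5 * r - R) / 2 ≤ -3 * (r - m)) ∨
        (γ = -3 ∧ δ = 1 / 2 ∧ -3 * (r - m) ≤ 3 * (r - m) - (5 * r - R) / 2)) := by
    rcases hasFDerivAt_max_cases b2 b3 d3 with ⟨e1, e2⟩ | ⟨e1, e2⟩ <;>
    rcases hasFDerivAt_min_cases b1 e2 d4 with ⟨e3, e4⟩ | ⟨e3, e4⟩ <;>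
    simp only [hM] at e1 e3
    · rw [max_eq_left e1] at e3
      linarith
    · exact ⟨3, -3, e4.congr_fderiv (by module), Or.inr (Or.inl ⟨rfl, rfl, e1⟩)⟩
    · exact ⟨-1, 1, e4.congr_fderiv (by module), Or.inl ⟨rfl, rfl, by
        rwa [max_eq_right e1] at e3⟩⟩
    · exact ⟨-3, 1 / 2, e4.congr_fderiv (by module), Or.inr (Or.inr ⟨rfl, rfl, e1⟩)⟩
  obtain ⟨α, β, hα, hα'⟩ := c1
  obtain ⟨γ, δ, hγ, hγ'⟩ := c2
  refine ⟨α, β, γ, δ, hα, hγ, ?_, ?_, ?_⟩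
  · rcases hα' with ⟨rfl, rfl, h⟩ | ⟨rfl, rfl, h, h'⟩ | ⟨rfl, rfl, h⟩ <;>
    rcases hγ' with ⟨rfl, rfl, h''⟩ | ⟨rfl, rfl, h''⟩ | ⟨rfl, rfl, h''⟩ <;> linarith
  · intro h0
    have h0' := (lt_min_iff.1 h0).2
    rcases hα' with ⟨rfl, rfl, h⟩ | ⟨rfl, rfl, h, h'⟩ | ⟨rfl, rfl, h⟩
    · norm_num
    · norm_num
    · rcases lt_max_iff.1 h0' with h1 | h1 <;> linarith
  · intro h0
    have h0' := (min_lt_iff.1 h0).resolve_left (by linarith)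
    have h0'' := (max_lt_iff.1 h0').2
    rcases hα' with ⟨rfl, rfl, h⟩ | ⟨rfl, rfl, h, h'⟩ | ⟨rfl, rfl, h⟩ <;> linarith

lemma exists_sign (t : ℝ) (ht : t ≠ 0) : ∃ η : ℝ, (η = 1 ∨ η = -1) ∧ ∀ᶠ u in 𝓝 t, |u| = η * u := by
  rcases ht.lt_or_gt with h | h
  · refine ⟨-1, Or.inr rfl, ?_⟩
    filter_upwards [eventually_lt_nhds h] with u hu
    rw [abs_of_neg hu]; ring
  · refine ⟨1, Or.inl rfl, ?_⟩
    filter_upwards [eventually_gt_nhds h] with u hu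
    rw [abs_of_pos hu]; ring

lemma locallyLipschitz_planarRe (R : ℝ) (i : Fin 3) :
    LocallyLipschitz fun x : E3 => planarRe R (x 2) (x i) := by
  have h1 : LocallyLipschitz fun x : E3 => x 2 * fold (x i) :=
    LocallyLipschitz.mul_real (locallyLipschitz_coord 2)
      (locallyLipschitz_fold.comp (locallyLipschitz_coord i))
  have h2 : LipschitzWith 30 fun p : ℝ × ℝ => bendRe R p.1 p.2 := by
    refine LipschitzWith.of_dist_le_mul fun p q => ?_
    have := abs_bendRe_sub_le R p.1 p.2 q.1 q.2
    rw [Prod.dist_eq, Real.dist_eq, Real.dist_eq, Real.dist_eq]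
    have h3 := le_max_left |p.1 - q.1| |p.2 - q.2|
    have h4 := le_max_right |p.1 - q.1| |p.2 - q.2|
    push_cast
    linarith
  exact h2.locallyLipschitz.comp ((locallyLipschitz_coord 2).prodMk h1)

lemma locallyLipschitz_planarIm (R : ℝ) (i : Fin 3) :
    LocallyLipschitz fun x : E3 => planarIm R (x 2) (x i) := by
  have h0 : LocallyLipschitz fun x : E3 => 1 - x i :=
    (IsometryEquiv.subLeft 1).isometry.lipschitz.locallyLipschitz.comp (locallyLipschitz_coord i)
  have h1 : LocallyLipschitz fun x : E3 => x 2 * fold (1 - x i) :=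
    LocallyLipschitz.mul_real (locallyLipschitz_coord 2) (locallyLipschitz_fold.comp h0)
  have h2 : LipschitzWith 30 fun p : ℝ × ℝ => bendIm R p.1 p.2 := by
    refine LipschitzWith.of_dist_le_mul fun p q => ?_
    have := abs_bendIm_sub_le R p.1 p.2 q.1 q.2
    rw [Prod.dist_eq, Real.dist_eq, Real.dist_eq, Real.dist_eq]
    have h3 := le_max_left |p.1 - q.1| |p.2 - q.2|
    have h4 := le_max_right |p.1 - q.1| |p.2 - q.2|
    push_cast
    linarith
  exact h2.locallyLipschitz.comp ((locallyLipschitz_coord 2).prodMk h1)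

lemma locallyLipschitz_bend_re (R : ℝ) :
    LocallyLipschitz (fun p : ℝ × ℝ => min (3 * p.1) (p.1 + 4 * (p.2 - 1))) ∧
    LocallyLipschitz (fun p : ℝ × ℝ =>
      min (min (3 * p.1) (p.1 + 4 * (p.2 - 1))) (R + p.2 - 3 * p.1)) := by
  have h0 : ∀ f : ℝ × ℝ → ℝ, ContDiff ℝ 1 f → LocallyLipschitz f :=
    fun f hf => hf.locallyLipschitz
  have h1 : LocallyLipschitz (fun p : ℝ × ℝ => min (3 * p.1) (p.1 + 4 * (p.2 - 1))) :=
    (h0 _ (by fun_prop)).min (h0 _ (by fun_prop))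
  exact ⟨h1, h1.min (h0 _ (by fun_prop))⟩

lemma locallyLipschitz_bend_im (R : ℝ) :
    LocallyLipschitz (fun p : ℝ × ℝ =>
      max (-3 * (p.2 - p.1)) (3 * (p.2 - p.1) - (5 * p.2 - R) / 2)) ∧
    LocallyLipschitz (fun p : ℝ × ℝ => min (p.2 - p.1)
      (max (-3 * (p.2 - p.1)) (3 * (p.2 - p.1) - (5 * p.2 - R) / 2))) := by
  have h0 : ∀ f : ℝ × ℝ → ℝ, ContDiff ℝ 1 f → LocallyLipschitz f :=
    fun f hf => hf.locallyLipschitz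
  have h1 : LocallyLipschitz (fun p : ℝ × ℝ =>
      max (-3 * (p.2 - p.1)) (3 * (p.2 - p.1) - (5 * p.2 - R) / 2)) :=
    (h0 _ (by fun_prop)).max (h0 _ (by fun_prop))
  exact ⟨h1, (h0 _ (by fun_prop)).min h1⟩

/-- The derivatives of the planar interpolation. -/
lemma ae_planar {R : ℝ} (hR : 20 ≤ R) (i : Fin 3) : ∀ᵐ x : E3, 1 < x 2 → x 2 < R →
    ∃ p p' q q' : ℝ,
      HasFDerivAt (fun y : E3 => planarRe R (y 2) (y i)) (p • coord i + p' • coord 2) x ∧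
      HasFDerivAt (fun y : E3 => planarIm R (y 2) (y i)) (q • coord i + q' • coord 2) x ∧
      3 / 2 ≤ p * q' - p' * q ∧ (0 < planarIm R (x 2) (x i) → 1 ≤ p) ∧
      (planarIm R (x 2) (x i) < 0 → p ≤ -1) := by
  have hm : LocallyLipschitz fun y : E3 => y 2 * |fold (y i)| :=
    LocallyLipschitz.mul_real (locallyLipschitz_coord 2)
      (LocallyLipschitz.abs (locallyLipschitz_fold.comp (locallyLipschitz_coord i)))
  have hM := hm.prodMk (locallyLipschitz_coord 2)
  filter_upwards [ae_fold_ne_zero i,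
    LocallyLipschitz.ae_differentiableAt ((locallyLipschitz_bend_re R).1.comp hM),
    LocallyLipschitz.ae_differentiableAt ((locallyLipschitz_bend_re R).2.comp hM),
    LocallyLipschitz.ae_differentiableAt ((locallyLipschitz_bend_im R).1.comp hM),
    LocallyLipschitz.ae_differentiableAt ((locallyLipschitz_bend_im R).2.comp hM)]
    with x hx d1 d2 d3 d4 h1 hR'
  obtain ⟨hw, hz⟩ := hx
  have hzw := abs_fold_one_sub (x i)
  have hw0 : 0 < |fold (x i)| := abs_pos.2 hw
  have hw1 : |fold (x i)| < 1 := by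
    have : 0 < |fold (1 - x i)| := abs_pos.2 hz
    linarith
  set σ : ℝ := (-1) ^ foldIndex (x i) with hσ
  have hσ' : σ = 1 ∨ σ = -1 := neg_one_zpow_cases _
  have hσ2 : σ * σ = 1 := by rcases hσ' with h | h <;> rw [h] <;> norm_num
  obtain ⟨η, hη, hηw⟩ := exists_sign _ hw
  have hη2 : η * η = 1 := by rcases hη with h | h <;> rw [h] <;> norm_num
  have hfold : HasFDerivAt (fun y : E3 => fold (y i)) (σ • coord i) x := by
    have h := (hasDerivAt_fold hw1).comp_hasFDerivAt (f := fun y : E3 => y i) x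
      (hasFDerivAt_coord i x)
    exact h
  have ev1 : ∀ᶠ y : E3 in 𝓝 x, |fold (y i)| = η * fold (y i) :=
    hfold.continuousAt.eventually hηw
  obtain ⟨σ', hσ'', hσz⟩ := exists_sign _ hz
  have hσσ : σ' = σ := by
    have h1 := hσz.self_of_nhds
    have h2 := fold_one_sub (x i)
    rw [hzw] at h1
    rw [← hσ] at h2
    rw [h2] at h1
    have h3 : 0 < 1 - |fold (x i)| := by linarith
    rcases hσ'' with h | h <;> rcases hσ' with h' | h' <;> rw [h, h'] at h1 ⊢ <;> linarith
  rw [hσσ] at hσz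
  have ev2 : ∀ᶠ y : E3 in 𝓝 x, |fold (1 - y i)| = σ * fold (1 - y i) := by
    have hc : ContinuousAt (fun y : E3 => fold (1 - y i)) x :=
      (locallyLipschitz_fold.continuous.comp
        (continuous_const.sub (coord i).continuous)).continuousAt
    exact hc.eventually hσz
  have ev3 : ∀ᶠ y : E3 in 𝓝 x, 1 < y 2 := (coord 2).continuous.continuousAt.eventually_const_lt h1
  have e1 : (fun y : E3 => planarRe R (y 2) (y i)) =ᶠ[𝓝 x] fun y =>
      η * min (min (3 * (y 2 * |fold (y i)|)) (y 2 * |fold (y i)| + 4 * (y 2 - 1)))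
        (R + y 2 - 3 * (y 2 * |fold (y i)|)) := by
    filter_upwards [ev1, ev3] with y hy hy3
    rw [← bendRe_of_nonneg (by linarith) hy3.le
      (mul_nonneg (by linarith) (abs_nonneg _)), hy, planarRe]
    rcases hη with h | h <;> rw [h]
    · simp
    · rw [neg_one_mul, neg_one_mul, mul_neg, bendRe_neg, neg_neg]
  have e2 : (fun y : E3 => planarIm R (y 2) (y i)) =ᶠ[𝓝 x] fun y =>
      σ * min (y 2 - y 2 * |fold (y i)|) (max (-3 * (y 2 - y 2 * |fold (y i)|))
        (3 * (y 2 - y 2 * |fold (y i)|) - (5 * y 2 - R) / 2)) := by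
    filter_upwards [ev2, ev3] with y hy hy3
    rw [abs_fold_one_sub] at hy
    rw [show y 2 - y 2 * |fold (y i)| = y 2 * (σ * fold (1 - y i)) by rw [← hy]; ring,
      ← bendIm_of_nonneg (mul_nonneg (by linarith) (by rw [← hy]; linarith [abs_fold_le (y i)])),
      planarIm]
    rcases hσ' with h | h <;> rw [h]
    · simp
    · rw [neg_one_mul, neg_one_mul, mul_neg, bendIm_neg, neg_neg]
  have hdm : HasFDerivAt (fun y : E3 => y 2 * |fold (y i)|)
      ((x 2 * (η * σ)) • coord i + |fold (x i)| • coord 2) x := by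
    have h3 : HasFDerivAt (fun y : E3 => |fold (y i)|) (η • σ • coord i) x :=
      (hfold.const_mul η).congr_of_eventuallyEq ev1
    exact ((hasFDerivAt_coord 2 x).mul h3).congr_fderiv (by module)
  obtain ⟨α, β, γ, δ, hα, hγ, hdet, hpos, hneg⟩ := bend_branches (m := x 2 * |fold (x i)|) hR h1
    (by nlinarith) (M := fun y : E3 => (y 2 * |fold (y i)|, y 2)) (x := x) rfl hdm
    (hasFDerivAt_coord 2 x) d1 d2 d3 d4
  have hIm := e2.self_of_nhds
  beta_reduce at hIm
  refine ⟨α * (x 2 * σ), η * (α * |fold (x i)| + β), γ * (x 2 * η),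
    σ * (γ * |fold (x i)| + δ), ?_, ?_, ?_, ?_, ?_⟩
  · refine ((hα.const_mul η).congr_of_eventuallyEq e1).congr_fderiv ?_
    have : α * (x 2 * σ) = (η * η) * (α * (x 2 * σ)) := by rw [hη2, one_mul]
    rw [this]
    module
  · refine ((hγ.const_mul σ).congr_of_eventuallyEq e2).congr_fderiv ?_
    have : γ * (x 2 * η) = (σ * σ) * (γ * (x 2 * η)) := by rw [hσ2, one_mul]
    rw [this]
    module
  · have : α * (x 2 * σ) * (σ * (γ * |fold (x i)| + δ))
        - η * (α * |fold (x i)| + β) * (γ * (x 2 * η))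
        = x 2 * ((σ * σ) * (α * (γ * |fold (x i)| + δ))
          - (η * η) * ((α * |fold (x i)| + β) * γ)) := by ring
    rw [this, hσ2, hη2]
    nlinarith
  · intro h
    rw [hIm] at h
    rcases hσ' with h' | h' <;> rw [h'] at h ⊢
    · rw [one_mul] at h
      nlinarith [hpos h]
    · rw [neg_one_mul, neg_pos] at h
      nlinarith [hneg h]
  · intro h
    rw [hIm] at h
    rcases hσ' with h' | h' <;> rw [h'] at h ⊢
    · rw [one_mul] at h
      nlinarith [hneg h]
    · rw [neg_one_mul, neg_lt_zero] at h
      nlinarith [hpos h]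

lemma hasFDerivAt_sgnMin_cases {u v : E3 → ℝ} {u' v' : E3 →L[ℝ] ℝ} {x : E3}
    (hu : HasFDerivAt u u' x) (hv : HasFDerivAt v v' x)
    (h1 : DifferentiableAt ℝ (fun y => |u y + v y|) x)
    (h2 : DifferentiableAt ℝ (fun y => |u y - v y|) x) :
    ∃ ε : ℝ, (ε = 1 ∨ ε = -1) ∧
      ((|v x| ≤ ε * u x ∧ HasFDerivAt (fun y => sgnMin (u y) (v y)) (ε • v') x) ∨
        (|u x| ≤ ε * v x ∧ HasFDerivAt (fun y => sgnMin (u y) (v y)) (ε • u') x)) := by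
  have e : ∀ y, (fun y => sgnMin (u y) (v y)) y = 1 / 2 * (|u y + v y| - |u y - v y|) := by
    intro y; simp only [sgnMin]; ring
  have key : ∀ a' b' c' : E3 →L[ℝ] ℝ, HasFDerivAt (fun y => |u y + v y|) a' x →
      HasFDerivAt (fun y => |u y - v y|) b' x → (1 / 2 : ℝ) • (a' - b') = c' →
      HasFDerivAt (fun y => sgnMin (u y) (v y)) c' x := by
    intro a' b' c' ha hb hc
    exact (((ha.sub hb).const_mul (1 / 2)).congr_of_eventuallyEq
      (Eventually.of_forall e)).congr_fderiv hc
  rcases hasFDerivAt_abs_cases (hu.add hv) h1 with ⟨a1, a2⟩ | ⟨a1, a2⟩ <;>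
  rcases hasFDerivAt_abs_cases (hu.sub hv) h2 with ⟨b1, b2⟩ | ⟨b1, b2⟩ <;>
  simp only [Pi.add_apply, Pi.sub_apply] at a1 b1
  · exact ⟨1, Or.inl rfl, Or.inl ⟨abs_le.2 ⟨by linarith, by linarith⟩,
      key _ _ _ a2 b2 (by module)⟩⟩
  · exact ⟨1, Or.inl rfl, Or.inr ⟨abs_le.2 ⟨by linarith, by linarith⟩,
      key _ _ _ a2 b2 (by module)⟩⟩
  · exact ⟨-1, Or.inr rfl, Or.inr ⟨abs_le.2 ⟨by linarith, by linarith⟩,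
      key _ _ _ a2 b2 (by module)⟩⟩
  · exact ⟨-1, Or.inr rfl, Or.inl ⟨abs_le.2 ⟨by linarith, by linarith⟩,
      key _ _ _ a2 b2 (by module)⟩⟩

/-- The Jacobian of the interpolation is bounded below. -/
lemma ae_det_interp {R : ℝ} (hR : 20 ≤ R) : ∀ᵐ x : E3, 1 < x 2 → x 2 < R →
    ∃ T : E3 →L[ℝ] E3, HasFDerivAt (interp R) T x ∧ 3 / 2 ≤ T.det := by
  have l0 := locallyLipschitz_planarIm R 0
  have l1 := locallyLipschitz_planarIm R 1
  filter_upwards [ae_planar hR 0, ae_planar hR 1,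
    LocallyLipschitz.ae_differentiableAt (LocallyLipschitz.abs (l0.add l1)),
    LocallyLipschitz.ae_differentiableAt (LocallyLipschitz.abs (l0.sub l1)),
    LocallyLipschitz.ae_eq_zero_imp l0, LocallyLipschitz.ae_eq_zero_imp l1]
    with x h0 h1 d1 d2 z0 z1 hx hxR
  obtain ⟨p, p', q, q', hp, hq, hdet, hpos, hneg⟩ := h0 hx hxR
  obtain ⟨a, a', b, b', ha, hb, hdet', hpos', hneg'⟩ := h1 hx hxR
  have n0 : planarIm R (x 2) (x 0) ≠ 0 := by
    intro h
    have h2 := z0 _ hq h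
    have h3 := congrArg (fun T : E3 →L[ℝ] ℝ => T (unitVec 0)) h2
    have h4 := congrArg (fun T : E3 →L[ℝ] ℝ => T (unitVec 2)) h2
    simp [unitVec] at h3 h4
    rw [h3, h4] at hdet
    linarith
  have n1 : planarIm R (x 2) (x 1) ≠ 0 := by
    intro h
    have h2 := z1 _ hb h
    have h3 := congrArg (fun T : E3 →L[ℝ] ℝ => T (unitVec 1)) h2
    have h4 := congrArg (fun T : E3 →L[ℝ] ℝ => T (unitVec 2)) h2
    simp [unitVec] at h3 h4
    rw [h3, h4] at hdet'
    linarith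
  obtain ⟨ε, hε, hc⟩ := hasFDerivAt_sgnMin_cases hq hb d1 d2
  have main : ∀ D : E3 →L[ℝ] ℝ, HasFDerivAt (fun y : E3 =>
      sgnMin (planarIm R (y 2) (y 0)) (planarIm R (y 2) (y 1))) D x →
      3 / 2 ≤ p * (a * D (unitVec 2) - a' * D (unitVec 1)) - p' * a * D (unitVec 0) →
      ∃ T : E3 →L[ℝ] E3, HasFDerivAt (interp R) T x ∧ 3 / 2 ≤ T.det := by
    intro D hD hdetD
    obtain ⟨T, hT, hTe⟩ := exists_hasFDerivAt_of_coords (f := interp R) (x := x)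
      (D := ![p • coord 0 + p' • coord 2, a • coord 1 + a' • coord 2, D]) (by
        intro i
        fin_cases i
        · exact hp
        · exact ha
        · exact hD)
    refine ⟨T, hT, hdetD.trans_eq ?_⟩
    rw [det_eq_entries]
    simp [hTe, unitVec]
    ring
  rcases hc with ⟨hc, hD⟩ | ⟨hc, hD⟩
  · refine main _ hD ?_
    have h3 : 1 ≤ ε * p := by
      have h4 : 0 ≤ ε * planarIm R (x 2) (x 0) := (abs_nonneg _).trans hc
      rcases hε with h | h <;> rw [h] at h4 ⊢
      · rw [one_mul] at h4 ⊢
        exact hpos (lt_of_le_of_ne h4 (Ne.symm n0))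
      · have := hneg (lt_of_le_of_ne (by linarith) n0)
        linarith
    simp [unitVec]
    nlinarith
  · refine main _ hD ?_
    have h3 : 1 ≤ ε * a := by
      have h4 : 0 ≤ ε * planarIm R (x 2) (x 1) := (abs_nonneg _).trans hc
      rcases hε with h | h <;> rw [h] at h4 ⊢
      · rw [one_mul] at h4 ⊢
        exact hpos' (lt_of_le_of_ne h4 (Ne.symm n1))
      · have := hneg' (lt_of_le_of_ne (by linarith) n1)
        linarith
    simp [unitVec]
    nlinarith

/-! ### Rounding the octahedron-like body -/

/-- The homogeneous map that carries the octahedron-like body to the ball and through which the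
Zorich map factors. -/
def roundMap (v : E3) : E3 :=
  gauge v • !₂[hemi (v 0 / gauge v) (v 1 / gauge v) 0, hemi (v 0 / gauge v) (v 1 / gauge v) 1,
    Real.sin (Real.pi * (v 2 / gauge v) / 2)]

lemma gauge_nonneg (v : E3) : 0 ≤ gauge v :=
  add_nonneg (le_max_of_le_left (abs_nonneg _)) (abs_nonneg _)

lemma gauge_smul {r : ℝ} (hr : 0 ≤ r) (v : E3) : gauge (r • v) = r * gauge v := by
  simp only [gauge, PiLp.smul_apply, smul_eq_mul, abs_mul, abs_of_nonneg hr]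
  rw [mul_add, mul_max_of_nonneg _ _ hr]

lemma abs_div_gauge_le (v : E3) :
    |v 0 / gauge v| ≤ 1 ∧ |v 1 / gauge v| ≤ 1 ∧ |v 2 / gauge v| ≤ 1 := by
  have h0 := le_max_left |v 0| |v 1|
  have h1 := le_max_right |v 0| |v 1|
  have h2 := abs_nonneg (v 2)
  have h3 := abs_nonneg (v 0)
  have hg := gauge_nonneg v
  simp only [abs_div, abs_of_nonneg hg]
  refine ⟨div_le_one_of_le₀ ?_ hg, div_le_one_of_le₀ ?_ hg, div_le_one_of_le₀ ?_ hg⟩ <;>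
  · unfold gauge; linarith

lemma sgnMin_eq_sign_mul (x y : ℝ) : sgnMin x y = Real.sign (x * y) * min |x| |y| := by
  rcases eq_or_ne x 0 with rfl | hx
  · simp [sgnMin]
  rcases eq_or_ne y 0 with rfl | hy
  · simp [sgnMin]
  rcases hx.lt_or_gt with hx | hx <;> rcases hy.lt_or_gt with hy | hy
  · rw [Real.sign_of_pos (mul_pos_of_neg_of_neg hx hy), abs_of_neg hx, abs_of_neg hy, one_mul,
      ← sgnMin_of_nonneg (by linarith) (by linarith), sgnMin_neg_left, sgnMin_neg_right, neg_neg]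
  · rw [Real.sign_of_neg (mul_neg_of_neg_of_pos hx hy), ← neg_neg x,
      sgnMin_neg_left, sgnMin_of_nonneg (by linarith) (by linarith), abs_neg,
      abs_of_pos (by linarith : 0 < -x), abs_of_pos hy]
    ring
  · rw [Real.sign_of_neg (mul_neg_of_pos_of_neg hx hy), ← neg_neg y,
      sgnMin_neg_right, sgnMin_of_nonneg (by linarith) (by linarith), abs_neg,
      abs_of_pos (by linarith : 0 < -y), abs_of_pos hx]
    ring
  · rw [Real.sign_of_pos (mul_pos hx hy), sgnMin_of_nonneg hx.le hy.le, abs_of_pos hx,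
      abs_of_pos hy, one_mul]

lemma sin_sgnMin {x y : ℝ} (hx : |x| ≤ 1) (hy : |y| ≤ 1) :
    Real.sin (Real.pi * sgnMin x y / 2) =
      sgnMin (Real.sin (Real.pi * x / 2)) (Real.sin (Real.pi * y / 2)) := by
  have hp := Real.pi_pos
  have sneg : ∀ u : ℝ, Real.sin (Real.pi * -u / 2) = -Real.sin (Real.pi * u / 2) := by
    intro u; rw [← Real.sin_neg]; congr 1; ring
  have pos : ∀ x y : ℝ, 0 ≤ x → 0 ≤ y → x ≤ 1 → y ≤ 1 → Real.sin (Real.pi * sgnMin x y / 2) =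
      sgnMin (Real.sin (Real.pi * x / 2)) (Real.sin (Real.pi * y / 2)) := by
    intro x y hx hy hx1 hy1
    have mono : ∀ u v : ℝ, 0 ≤ u → u ≤ v → v ≤ 1 →
        Real.sin (Real.pi * u / 2) ≤ Real.sin (Real.pi * v / 2) := by
      intro u v hu huv hv
      apply Real.sin_le_sin_of_le_of_le_pi_div_two <;> nlinarith
    have nn : ∀ u : ℝ, 0 ≤ u → u ≤ 1 → 0 ≤ Real.sin (Real.pi * u / 2) := by
      intro u hu hu1
      apply Real.sin_nonneg_of_nonneg_of_le_pi <;> nlinarith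
    rw [sgnMin_of_nonneg hx hy, sgnMin_of_nonneg (nn x hx hx1) (nn y hy hy1)]
    rcases le_total x y with h | h
    · rw [min_eq_left h, min_eq_left (mono _ _ hx h hy1)]
    · rw [min_eq_right h, min_eq_right (mono _ _ hy h hx1)]
  obtain ⟨hx0, hx1⟩ := abs_le.1 hx
  obtain ⟨hy0, hy1⟩ := abs_le.1 hy
  rcases le_total 0 x with h | h <;> rcases le_total 0 y with h' | h'
  · exact pos x y h h' hx1 hy1
  · have := pos x (-y) h (by linarith) hx1 (by linarith)
    rwa [sgnMin_neg_right, sneg, sneg, sgnMin_neg_right, neg_inj] at this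
  · have := pos (-x) y (by linarith) h' (by linarith) hy1
    rwa [sgnMin_neg_left, sneg, sneg, sgnMin_neg_left, neg_inj] at this
  · have := pos (-x) (-y) (by linarith) (by linarith) (by linarith) (by linarith)
    rwa [sgnMin_neg_left, sgnMin_neg_right, neg_neg, sneg, sneg, sgnMin_neg_left,
      sgnMin_neg_right, neg_neg] at this

lemma sin_sgnMin_fold (s t : ℝ) :
    Real.sin (Real.pi * sgnMin (fold (1 - s)) (fold (1 - t)) / 2) = heightSign s t := by
  rw [sin_sgnMin (abs_fold_le _) (abs_fold_le _), sin_fold_one_sub, sin_fold_one_sub,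
    sgnMin_eq_sign_mul, heightSign_eq]

lemma zorich_eq_roundMap (x : E3) :
    zorich x = roundMap (Real.exp (x 2) • octa (x 0) (x 1)) := by
  have he := Real.exp_pos (x 2)
  have hg : gauge (Real.exp (x 2) • octa (x 0) (x 1)) = Real.exp (x 2) := by
    rw [gauge_smul he.le, gauge_octa, mul_one]
  have e : ∀ i, (Real.exp (x 2) • octa (x 0) (x 1)) i / Real.exp (x 2) = octa (x 0) (x 1) i := by
    intro i
    rw [PiLp.smul_apply, smul_eq_mul, mul_div_cancel_left₀ _ he.ne']
  rw [zorich_eq, roundMap, hg, e, e, e]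
  simp only [octa, PiLp.toLp_apply, Matrix.cons_val_zero, Matrix.cons_val_one,
    Matrix.cons_val, sin_sgnMin_fold]

lemma norm_roundMap (v : E3) : ‖roundMap v‖ = gauge v := by
  rcases (gauge_nonneg v).eq_or_lt with h | h
  · rw [roundMap, ← h]; simp
  · rw [roundMap, norm_smul, Real.norm_of_nonneg h.le, EuclideanSpace.norm_eq]
    have h1 := hemi_sq (v 0 / gauge v) (v 1 / gauge v)
    have h2 : |v 2 / gauge v| = 1 - max |v 0 / gauge v| |v 1 / gauge v| := by
      simp only [abs_div, abs_of_pos h]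
      rw [max_div_div_right h.le, eq_sub_iff_add_eq, ← add_div, div_eq_one_iff_eq h.ne', gauge,
        add_comm]
    have h3 : Real.sin (Real.pi * (v 2 / gauge v) / 2) ^ 2
        = Real.sin (Real.pi * |v 2 / gauge v| / 2) ^ 2 := by
      rcases abs_choice (v 2 / gauge v) with h | h <;> rw [h]
      rw [mul_neg, neg_div, Real.sin_neg, neg_sq]
    rw [h2, mul_sub, mul_one, sub_div, Real.sin_pi_div_two_sub] at h3
    have h4 := Real.sin_sq_add_cos_sq (Real.pi * max |v 0 / gauge v| |v 1 / gauge v| / 2)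
    have : ∑ i : Fin 3, ‖(!₂[hemi (v 0 / gauge v) (v 1 / gauge v) 0,
        hemi (v 0 / gauge v) (v 1 / gauge v) 1,
        Real.sin (Real.pi * (v 2 / gauge v) / 2)] : E3) i‖ ^ 2 = 1 := by
      simp only [Fin.sum_univ_three, Real.norm_eq_abs, sq_abs]
      simp
      linarith
    rw [this]; simp

lemma abs_sin_sub_sin_le (a b : ℝ) :
    |Real.sin (Real.pi * a / 2) - Real.sin (Real.pi * b / 2)| ≤ 2 * |a - b| := by
  have h := Real.abs_sin_sub_sin_le (Real.pi * a / 2) (Real.pi * b / 2)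
  refine h.trans ?_
  rw [show Real.pi * a / 2 - Real.pi * b / 2 = Real.pi / 2 * (a - b) by ring, abs_mul,
    abs_of_pos (by positivity)]
  have := Real.pi_le_four
  gcongr
  linarith

lemma abs_hemi_sub_le (s t s' t' : ℝ) :
    |hemi s t 0 - hemi s' t' 0| ≤ 6 * (|s - s'| + |t - t'|) := by
  set m := max |s| |t| with hm
  set m' := max |s'| |t'| with hm'
  set q := Real.sqrt (s ^ 2 + t ^ 2) with hq
  set q' := Real.sqrt (s' ^ 2 + t' ^ 2) with hq'
  set A := Real.sin (Real.pi * m / 2) with hA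
  set A' := Real.sin (Real.pi * m' / 2) with hA'
  have hs0 := abs_nonneg (s - s')
  have ht0 := abs_nonneg (t - t')
  have h1 : hemi s t 0 = s / q * A := by
    simp only [hemi, PiLp.toLp_apply, Matrix.cons_val_zero]; ring
  have h2 : hemi s' t' 0 = s' / q' * A' := by
    simp only [hemi, PiLp.toLp_apply, Matrix.cons_val_zero]; ring
  have hsq : ∀ u v : ℝ, |u| ≤ Real.sqrt (u ^ 2 + v ^ 2) := fun u v =>
    Real.abs_le_sqrt (by nlinarith [sq_nonneg v])
  have hm'q : m' ≤ q' := max_le (hsq _ _) (by rw [hq', add_comm]; exact hsq _ _)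
  have hm0 : 0 ≤ m' := le_max_of_le_left (abs_nonneg _)
  have hA'm : |A'| ≤ 2 * m' := by
    refine (Real.abs_sin_le_abs).trans ?_
    rw [abs_of_nonneg (by positivity)]
    nlinarith [Real.pi_le_four]
  have hmm : |m - m'| ≤ |s - s'| + |t - t'| := by
    refine (abs_max_sub_max_le_max _ _ _ _).trans (max_le ?_ ?_)
    · linarith [abs_abs_sub_abs_le s s']
    · linarith [abs_abs_sub_abs_le t t']
  have hAA : |A - A'| ≤ 2 * (|s - s'| + |t - t'|) :=
    (abs_sin_sub_sin_le m m').trans (by linarith)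
  have hqq : |q - q'| ≤ |s - s'| + |t - t'| := by
    have e : ∀ u v : ℝ, Real.sqrt (u ^ 2 + v ^ 2) = ‖(⟨u, v⟩ : ℂ)‖ := fun u v => by
      rw [Complex.norm_eq_sqrt_sq_add_sq]
    rw [hq, hq', e, e]
    refine (abs_norm_sub_norm_le _ _).trans ((Complex.norm_le_abs_re_add_abs_im _).trans_eq ?_)
    simp
  have hs1 : |s / q| ≤ 1 := by
    rw [abs_div, abs_of_nonneg (Real.sqrt_nonneg _)]
    exact div_le_one_of_le₀ (hsq s t) (Real.sqrt_nonneg _)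
  have hs1' : |s' / q'| ≤ 1 := by
    rw [abs_div, abs_of_nonneg (Real.sqrt_nonneg _)]
    exact div_le_one_of_le₀ (hsq s' t') (Real.sqrt_nonneg _)
  have h3 : |A'| * |s / q - s' / q'| ≤ 4 * (|s - s'| + |t - t'|) := by
    rcases (Real.sqrt_nonneg _ : 0 ≤ q').eq_or_lt with h | h
    · have : |A'| = 0 := le_antisymm (by linarith) (abs_nonneg _)
      rw [this, zero_mul]; linarith
    rcases (Real.sqrt_nonneg _ : 0 ≤ q).eq_or_lt with h' | h'
    · have hs : s = 0 := abs_nonpos_iff.1 ((hsq s t).trans_eq h'.symm)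
      have ht : t = 0 := abs_nonpos_iff.1 (by
        have := hsq t s; rw [add_comm] at this; exact this.trans_eq h'.symm)
      rw [hs, ht] at hmm ⊢
      have : m = 0 := by rw [hm, hs, ht]; simp
      rw [this, zero_sub, abs_neg, abs_of_nonneg hm0] at hmm
      rw [zero_div, zero_sub, abs_neg]
      calc |A'| * |s' / q'| ≤ |A'| * 1 := by gcongr
        _ ≤ _ := by linarith
    · have hq0 : q ≠ 0 := ne_of_gt h'
      have hq0' : q' ≠ 0 := ne_of_gt h
      have e : s / q - s' / q' = (s - s' + s / q * (q' - q)) / q' := by field_simp; ring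
      rw [e, abs_div, abs_of_pos h]
      have h4 : |s - s' + s / q * (q' - q)| ≤ 2 * (|s - s'| + |t - t'|) := by
        refine (abs_add_le _ _).trans ?_
        rw [abs_mul, abs_sub_comm q' q]
        nlinarith [abs_nonneg (q - q')]
      calc |A'| * (|s - s' + s / q * (q' - q)| / q')
          ≤ (2 * q') * (2 * (|s - s'| + |t - t'|) / q') := by gcongr; linarith
        _ = _ := by field_simp; ring
  rw [h1, h2, show s / q * A - s' / q' * A' = s / q * (A - A') + A' * (s / q - s' / q') by ring]
  refine (abs_add_le _ _).trans ?_
  rw [abs_mul, abs_mul]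
  nlinarith [abs_nonneg (A - A')]

lemma hemi_one (s t : ℝ) : hemi s t 1 = hemi t s 0 := by
  simp only [hemi, PiLp.toLp_apply, Matrix.cons_val_zero, Matrix.cons_val_one, max_comm |s| |t|,
    add_comm (s ^ 2)]

lemma abs_hemi_le (s t : ℝ) : |hemi s t 0| ≤ 1 := by
  rw [← sq_le_one_iff_abs_le_one]
  nlinarith [hemi_sq s t, sq_nonneg (hemi s t 1), Real.sin_sq_le_one (Real.pi * max |s| |t| / 2)]

lemma abs_gauge_sub_le (v w : E3) :
    |gauge v - gauge w| ≤ |v 0 - w 0| + |v 1 - w 1| + |v 2 - w 2| := by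
  have h0 := abs_nonneg (v 0 - w 0)
  have h1 := abs_nonneg (v 1 - w 1)
  have h : abs (max |v 0| |v 1| - max |w 0| |w 1|) ≤ |v 0 - w 0| + |v 1 - w 1| := by
    refine (abs_max_sub_max_le_max _ _ _ _).trans (max_le ?_ ?_)
    · linarith [abs_abs_sub_abs_le (v 0) (w 0)]
    · linarith [abs_abs_sub_abs_le (v 1) (w 1)]
  have h2 := abs_abs_sub_abs_le (v 2) (w 2)
  rw [gauge, gauge, show ∀ a b c d : ℝ, a + b - (c + d) = (a - c) + (b - d) by intros; ring]
  exact (abs_add_le _ _).trans (add_le_add h h2)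

lemma abs_mul_sub_mul_le {g g' x x' C : ℝ} (hg : 0 ≤ g) (hg' : 0 ≤ g') (hx : |x| ≤ 1)
    (hx' : |x'| ≤ 1) (hC : |g - g'| ≤ C) (h : 0 < g → 0 < g' → g * |x - x'| ≤ 24 * C) :
    |g * x - g' * x'| ≤ 25 * C := by
  have hC0 := (abs_nonneg _).trans hC
  rcases hg.eq_or_lt with h0 | h0
  · rw [← h0] at hC ⊢
    rw [zero_sub, abs_neg, abs_of_nonneg hg'] at hC
    rw [zero_mul, zero_sub, abs_neg, abs_mul, abs_of_nonneg hg']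
    nlinarith
  rcases hg'.eq_or_lt with h1 | h1
  · rw [← h1] at hC ⊢
    rw [sub_zero, abs_of_nonneg hg] at hC
    rw [zero_mul, sub_zero, abs_mul, abs_of_nonneg hg]
    nlinarith
  rw [show g * x - g' * x' = (g - g') * x' + g * (x - x') by ring]
  refine (abs_add_le _ _).trans ?_
  rw [abs_mul, abs_mul, abs_of_nonneg hg]
  nlinarith [h h0 h1, abs_nonneg (g - g')]

lemma norm_roundMap_sub_le (v w : E3) : ‖roundMap v - roundMap w‖ ≤ 225 * ‖v - w‖ := by
  set C := |v 0 - w 0| + |v 1 - w 1| + |v 2 - w 2| with hC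
  have hC3 : C ≤ 3 * ‖v - w‖ := by
    have h0 := abs_apply_le_norm (v - w) 0
    have h1 := abs_apply_le_norm (v - w) 1
    have h2 := abs_apply_le_norm (v - w) 2
    simp only [PiLp.sub_apply] at h0 h1 h2
    linarith
  have hg := abs_gauge_sub_le v w
  have p0 := abs_nonneg (v 0 - w 0)
  have p1 := abs_nonneg (v 1 - w 1)
  have p2 := abs_nonneg (v 2 - w 2)
  obtain ⟨w0, w1, w2⟩ := abs_div_gauge_le w
  have quot : ∀ x x' δ : ℝ, |x' / gauge w| ≤ 1 → |x - x'| ≤ δ → 0 < gauge v → 0 < gauge w →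
      gauge v * |x / gauge v - x' / gauge w| ≤ δ + C := by
    intro x x' δ hx' hδ h0 h1
    rw [← abs_of_pos h0, ← abs_mul, abs_of_pos h0,
      show gauge v * (x / gauge v - x' / gauge w)
        = (x - x') + x' / gauge w * (gauge w - gauge v) by field_simp; ring]
    refine (abs_add_le _ _).trans ?_
    rw [abs_mul, abs_sub_comm (gauge w)]
    nlinarith [abs_nonneg (gauge v - gauge w)]
  have H : ∀ i j : Fin 3, |w i / gauge w| ≤ 1 → |w j / gauge w| ≤ 1 →
      |v i - w i| + |v j - w j| ≤ C →
      |gauge v * hemi (v i / gauge v) (v j / gauge v) 0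
        - gauge w * hemi (w i / gauge w) (w j / gauge w) 0| ≤ 25 * C := by
    intro i j hi hj hij
    refine abs_mul_sub_mul_le (gauge_nonneg v) (gauge_nonneg w) (abs_hemi_le _ _)
      (abs_hemi_le _ _) hg fun h0 h1 => ?_
    have h2 := quot (v i) _ _ hi le_rfl h0 h1
    have h3 := quot (v j) _ _ hj le_rfl h0 h1
    have h4 := abs_hemi_sub_le (v i / gauge v) (v j / gauge v) (w i / gauge w) (w j / gauge w)
    nlinarith
  have h0 := H 0 1 w0 w1 (by linarith)
  have h1 := H 1 0 w1 w0 (by linarith)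
  have h2 : |gauge v * Real.sin (Real.pi * (v 2 / gauge v) / 2)
      - gauge w * Real.sin (Real.pi * (w 2 / gauge w) / 2)| ≤ 25 * C := by
    refine abs_mul_sub_mul_le (gauge_nonneg v) (gauge_nonneg w) (Real.abs_sin_le_one _)
      (Real.abs_sin_le_one _) hg fun h0 h1 => ?_
    have h2 := quot (v 2) _ _ w2 le_rfl h0 h1
    have h4 := abs_sin_sub_sin_le (v 2 / gauge v) (w 2 / gauge w)
    nlinarith
  refine (norm_le_sum_abs _).trans ?_
  simp only [roundMap, PiLp.sub_apply, PiLp.smul_apply, smul_eq_mul, Matrix.cons_val_zero,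
    Matrix.cons_val_one, Matrix.cons_val, hemi_one]
  linarith

/-! ### The parametrization of a chamber by hemispheres -/

/-- The Zorich map with the exponential function removed from the last coordinate. -/
def beam (x : E3) : E3 := x 2 • hemi (x 0) (x 1)

lemma hemi_two (s t : ℝ) : hemi s t 2 = Real.cos (Real.pi * max |s| |t| / 2) := rfl

lemma norm_hemi (s t : ℝ) : ‖hemi s t‖ = 1 := by
  have h : ‖hemi s t‖ ^ 2 = 1 := by
    rw [EuclideanSpace.norm_sq_eq, Fin.sum_univ_three]
    simp only [Real.norm_eq_abs, sq_abs]
    rw [hemi_sq, hemi_two, Real.sin_sq_add_cos_sq]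
  exact (pow_eq_one_iff_of_nonneg (norm_nonneg _) two_ne_zero).1 h

lemma norm_beam {x : E3} (hx : 0 ≤ x 2) : ‖beam x‖ = x 2 := by
  rw [beam, norm_smul, norm_hemi, mul_one, Real.norm_of_nonneg hx]

lemma beam_apply {x : E3} (h1 : 0 ≤ x 1) (h01 : x 1 ≤ x 0) :
    beam x 0 = x 2 * x 0 * Real.sin (Real.pi * x 0 / 2) * (Real.sqrt (x 0 ^ 2 + x 1 ^ 2))⁻¹ ∧
    beam x 1 = x 2 * x 1 * Real.sin (Real.pi * x 0 / 2) * (Real.sqrt (x 0 ^ 2 + x 1 ^ 2))⁻¹ ∧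
    beam x 2 = x 2 * Real.cos (Real.pi * x 0 / 2) := by
  have hm : max |x 0| |x 1| = x 0 := by
    rw [abs_of_nonneg h1, abs_of_nonneg (h1.trans h01), max_eq_left h01]
  simp only [beam, hemi, hm, PiLp.smul_apply, smul_eq_mul, Matrix.cons_val_zero,
    Matrix.cons_val_one, Matrix.cons_val]
  refine ⟨by ring, by ring, trivial⟩

lemma hasFDerivAt_beam {x : E3} (h1 : 0 < x 1) (h01 : x 1 < x 0) :
    ∃ T : E3 →L[ℝ] E3, HasFDerivAt beam T x ∧ T.det =
      x 2 ^ 2 * (Real.pi / 2) * Real.sin (Real.pi * x 0 / 2) * x 0 / (x 0 ^ 2 + x 1 ^ 2) := by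
  have ev : ∀ᶠ y : E3 in 𝓝 x, 0 ≤ y 1 ∧ y 1 ≤ y 0 := by
    filter_upwards [(coord 1).continuous.continuousAt.eventually_const_lt h1,
      (coord 1).continuous.continuousAt.eventually_lt (coord 0).continuous.continuousAt h01]
      with y hy1 hy2
    exact ⟨hy1.le, hy2.le⟩
  set A := Real.sin (Real.pi * x 0 / 2) with hA
  set C := Real.cos (Real.pi * x 0 / 2) with hC
  set h := Real.pi / 2 with hh
  have hq : 0 < x 0 ^ 2 + x 1 ^ 2 := by positivity
  set b := (Real.sqrt (x 0 ^ 2 + x 1 ^ 2))⁻¹ with hb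
  have hb2 : b ^ 2 * (x 0 ^ 2 + x 1 ^ 2) = 1 := by
    rw [hb, inv_pow, Real.sq_sqrt hq.le, inv_mul_cancel₀ hq.ne']
  have dang : HasFDerivAt (fun y : E3 => Real.pi * y 0 / 2) (h • coord 0) x := by
    have := (hasFDerivAt_coord 0 x).const_mul h
    refine this.congr_of_eventuallyEq (Eventually.of_forall fun y => ?_)
    simp only [hh]; ring
  have dA : HasFDerivAt (fun y : E3 => Real.sin (Real.pi * y 0 / 2)) (C • h • coord 0) x :=
    dang.sin
  have dC : HasFDerivAt (fun y : E3 => Real.cos (Real.pi * y 0 / 2)) (-A • h • coord 0) x :=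
    dang.cos
  have dq : HasFDerivAt (fun y : E3 => y 0 ^ 2 + y 1 ^ 2)
      ((2 * x 0) • coord 0 + (2 * x 1) • coord 1) x := by
    have := ((hasFDerivAt_coord 0 x).pow 2).add ((hasFDerivAt_coord 1 x).pow 2)
    refine this.congr_fderiv ?_
    ext v; simp
  have dB : HasFDerivAt (fun y : E3 => (Real.sqrt (y 0 ^ 2 + y 1 ^ 2))⁻¹)
      ((-(x 0) * b ^ 3) • coord 0 + (-(x 1) * b ^ 3) • coord 1) x := by
    have hs := dq.sqrt hq.ne'
    have hn : Real.sqrt (x 0 ^ 2 + x 1 ^ 2) ≠ 0 := (Real.sqrt_pos.2 hq).ne'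
    have := (hasDerivAt_inv hn).comp_hasFDerivAt (f := fun y : E3 => Real.sqrt (y 0 ^ 2 + y 1 ^ 2))
      x hs
    refine HasFDerivAt.congr_fderiv (f' := _) this ?_
    rw [hb]
    ext v
    simp
    field_simp
  have d2 := hasFDerivAt_coord 2 x
  have d0 := hasFDerivAt_coord 0 x
  have d1 := hasFDerivAt_coord 1 x
  have e0 := (((d2.mul d0).mul dA).mul dB).congr_of_eventuallyEq
    (f₁ := fun y => beam y 0) (ev.mono fun y hy => (beam_apply hy.1 hy.2).1)
  have e1 := (((d2.mul d1).mul dA).mul dB).congr_of_eventuallyEq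
    (f₁ := fun y => beam y 1) (ev.mono fun y hy => (beam_apply hy.1 hy.2).2.1)
  have e2 := (d2.mul dC).congr_of_eventuallyEq
    (f₁ := fun y => beam y 2) (ev.mono fun y hy => (beam_apply hy.1 hy.2).2.2)
  have g0 := e0.congr_fderiv (g' := (x 2 * A * b ^ 3 * x 1 ^ 2 + x 2 * x 0 * b * h * C) • coord 0
      + (-(x 2 * x 0 * A * x 1 * b ^ 3)) • coord 1 + (x 0 * A * b) • coord 2) (by
    ext v
    simp [← hA, ← hb]
    linear_combination (-(x 2 * A * b * v 0)) * hb2)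
  have g1 := e1.congr_fderiv (g' := (-(x 2 * x 1 * A * x 0 * b ^ 3) + x 2 * x 1 * b * h * C) •
      coord 0 + (x 2 * A * b ^ 3 * x 0 ^ 2) • coord 1 + (x 1 * A * b) • coord 2) (by
    ext v
    simp [← hA, ← hb]
    linear_combination (-(x 2 * A * b * v 1)) * hb2)
  have g2 := e2.congr_fderiv (g' := (-(x 2 * h * A)) • coord 0 + C • coord 2) (by
    ext v
    simp [← hC]
    ring)
  obtain ⟨T, hT, hTe⟩ := exists_hasFDerivAt_of_coords (f := beam) (x := x)
    (D := ![_, _, _]) (by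
      intro i
      fin_cases i
      · exact g0
      · exact g1
      · exact g2)
  refine ⟨T, hT, ?_⟩
  rw [det_eq_entries, eq_div_iff hq.ne']
  have hAC : A ^ 2 + C ^ 2 = 1 := Real.sin_sq_add_cos_sq _
  simp [hTe, unitVec]
  have key : ∀ s t r : ℝ, b ^ 2 * (s ^ 2 + t ^ 2) = 1 →
      ((r * A * b ^ 3 * t ^ 2 + r * s * b * h * C) * (r * A * b ^ 3 * s ^ 2) * C
      - (-(r * s * A * t * b ^ 3)) * (-(r * t * A * s * b ^ 3) + r * t * b * h * C) * C
      + (-(r * s * A * t * b ^ 3)) * (t * A * b) * (-(r * h * A))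
      - (s * A * b) * (r * A * b ^ 3 * s ^ 2) * (-(r * h * A))) * (s ^ 2 + t ^ 2)
      = r ^ 2 * h * A * s := by
    intro s t r hst
    have hst' : b ^ 4 * (s ^ 2 + t ^ 2) ^ 2 = 1 := by
      rw [show b ^ 4 * (s ^ 2 + t ^ 2) ^ 2 = (b ^ 2 * (s ^ 2 + t ^ 2)) ^ 2 by ring, hst, one_pow]
    linear_combination (r ^ 2 * h * A * s) * (A ^ 2 + C ^ 2) * hst' + (r ^ 2 * h * A * s) * hAC
  linear_combination key (x 0) (x 1) (x 2) hb2

lemma le_sin {s : ℝ} (h0 : 0 ≤ s) (h1 : s ≤ 1) : s ≤ Real.sin (Real.pi * s / 2) := by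
  have hp := Real.pi_pos
  have := Real.mul_le_sin (x := Real.pi * s / 2) (by positivity) (by nlinarith)
  refine le_trans (le_of_eq ?_) this
  field_simp

lemma det_beam_bounds {s t : ℝ} (h1 : 0 < t) (h01 : t < s) (h : s ≤ 1) :
    1 / 2 ≤ (Real.pi / 2) * Real.sin (Real.pi * s / 2) * s / (s ^ 2 + t ^ 2) ∧
    (Real.pi / 2) * Real.sin (Real.pi * s / 2) * s / (s ^ 2 + t ^ 2) ≤ 4 := by
  have hp := Real.pi_gt_three
  have hp' := Real.pi_le_four
  have hs : 0 < s := h1.trans h01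
  have hA := le_sin hs.le h
  have hA' : Real.sin (Real.pi * s / 2) ≤ 2 * s := by
    refine (Real.sin_le (by positivity)).trans ?_
    nlinarith
  have hq : 0 < s ^ 2 + t ^ 2 := by positivity
  have hAs : 0 ≤ Real.sin (Real.pi * s / 2) * s := mul_nonneg (hs.le.trans hA) hs.le
  constructor
  · rw [le_div_iff₀ hq]
    nlinarith
  · rw [div_le_iff₀ hq]
    nlinarith

/-- The parametrization of a chamber does not contract distances by more than a factor. -/
lemma sub_le_norm_beam_sub {x y : E3} (hx1 : 0 ≤ x 1) (hx01 : x 1 ≤ x 0) (hx0 : x 0 ≤ 1)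
    (hx2 : 1 ≤ x 2) (hy1 : 0 ≤ y 1) (hy01 : y 1 ≤ y 0) (hy0 : y 0 ≤ 1) (hy2 : 1 ≤ y 2) :
    |x 2 - y 2| ≤ ‖beam x - beam y‖ ∧ |x 0 - y 0| ≤ 3 * ‖beam x - beam y‖ ∧
      |x 1 - y 1| ≤ 7 * ‖beam x - beam y‖ := by
  set δ := ‖beam x - beam y‖ with hδ
  have hp := Real.pi_pos
  have factor : ∀ x : E3, 0 ≤ x 1 → x 1 ≤ x 0 → x 0 ≤ 1 → 1 ≤ x 2 → ∃ k : ℝ, 1 / 2 ≤ k ∧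
      beam x 0 = k * x 0 ∧ beam x 1 = k * x 1 ∧
      Real.sqrt (beam x 0 ^ 2 + beam x 1 ^ 2) = x 2 * Real.sin (Real.pi * x 0 / 2) ∧
      beam x 2 = x 2 * Real.cos (Real.pi * x 0 / 2) := by
    intro x h1 h01 h0 h2
    obtain ⟨b0, b1, b2⟩ := beam_apply h1 h01
    have hA := le_sin (h1.trans h01) h0
    have hsq : Real.sqrt (beam x 0 ^ 2 + beam x 1 ^ 2) = x 2 * Real.sin (Real.pi * x 0 / 2) := by
      have hm : max |x 0| |x 1| = x 0 := by
        rw [abs_of_nonneg h1, abs_of_nonneg (h1.trans h01), max_eq_left h01]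
      have := hemi_sq (x 0) (x 1)
      rw [hm] at this
      rw [show beam x 0 ^ 2 + beam x 1 ^ 2 = (x 2 * Real.sin (Real.pi * x 0 / 2)) ^ 2 by
        rw [mul_pow, ← this]; simp only [beam, PiLp.smul_apply, smul_eq_mul]; ring]
      exact Real.sqrt_sq (mul_nonneg (by linarith) (by linarith))
    rcases (h1.trans h01).eq_or_lt with h | h
    · have h' : x 1 = 0 := le_antisymm (by linarith) h1
      refine ⟨1, by norm_num, ?_, ?_, hsq, b2⟩
      · rw [b0, ← h]; simp
      · rw [b1, h']; simp
    · refine ⟨x 2 * Real.sin (Real.pi * x 0 / 2) * (Real.sqrt (x 0 ^ 2 + x 1 ^ 2))⁻¹, ?_,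
        by rw [b0]; ring, by rw [b1]; ring, hsq, b2⟩
      have hq : 0 < Real.sqrt (x 0 ^ 2 + x 1 ^ 2) := Real.sqrt_pos.2 (by positivity)
      have hq' : Real.sqrt (x 0 ^ 2 + x 1 ^ 2) ≤ 2 * x 0 := by
        apply Real.sqrt_le_iff.2
        constructor
        · linarith
        · nlinarith
      rw [← div_eq_mul_inv, le_div_iff₀ hq]
      nlinarith
  have d2 : |x 2 - y 2| ≤ δ := by
    have := abs_norm_sub_norm_le (beam x) (beam y)
    rwa [norm_beam (by linarith), norm_beam (by linarith)] at this
  obtain ⟨k, hk, kx0, kx1, kxq, kx2⟩ := factor x hx1 hx01 hx0 hx2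
  obtain ⟨l, hl, ly0, ly1, lyq, ly2⟩ := factor y hy1 hy01 hy0 hy2
  have c0 : |beam x 0 - beam y 0| ≤ δ := abs_apply_le_norm (beam x - beam y) 0
  have c1 : |beam x 1 - beam y 1| ≤ δ := abs_apply_le_norm (beam x - beam y) 1
  have c2 : |beam x 2 - beam y 2| ≤ δ := abs_apply_le_norm (beam x - beam y) 2
  have cq : |x 2 * Real.sin (Real.pi * x 0 / 2) - y 2 * Real.sin (Real.pi * y 0 / 2)|
      ≤ 2 * δ := by
    have e : ∀ u v : ℝ, Real.sqrt (u ^ 2 + v ^ 2) = ‖(⟨u, v⟩ : ℂ)‖ := fun u v => by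
      rw [Complex.norm_eq_sqrt_sq_add_sq]
    rw [← kxq, ← lyq, e, e]
    refine (abs_norm_sub_norm_le _ _).trans ((Complex.norm_le_abs_re_add_abs_im _).trans ?_)
    simp only [Complex.sub_re, Complex.sub_im]
    linarith
  rw [kx2, ly2] at c2
  have d0 : |x 0 - y 0| ≤ 3 * δ := by
    have hJ : |x 0 - y 0| ≤ |Real.sin (Real.pi * (x 0 - y 0) / 2)| := by
      have habs : |x 0 - y 0| ≤ 1 := by rw [abs_le]; constructor <;> linarith
      have h1 := le_sin (abs_nonneg (x 0 - y 0)) habs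
      refine h1.trans ?_
      rcases abs_choice (x 0 - y 0) with h | h <;> rw [h]
      · exact le_abs_self _
      · rw [mul_neg, neg_div, Real.sin_neg]; exact neg_le_abs _
    set S := Real.sin (Real.pi * x 0 / 2)
    set C := Real.cos (Real.pi * x 0 / 2)
    set S' := Real.sin (Real.pi * y 0 / 2)
    set C' := Real.cos (Real.pi * y 0 / 2)
    have hsub : Real.sin (Real.pi * (x 0 - y 0) / 2) = S * C' - C * S' := by
      rw [← Real.sin_sub]; congr 1; ring
    have hid : x 2 * (S * C' - C * S') = (x 2 * S - y 2 * S') * C' - (x 2 * C - y 2 * C') * S' := by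
      ring
    have hC' : |C'| ≤ 1 := Real.abs_cos_le_one _
    have hS' : |S'| ≤ 1 := Real.abs_sin_le_one _
    rw [hsub] at hJ
    calc |x 0 - y 0| ≤ x 2 * |S * C' - C * S'| := by nlinarith [abs_nonneg (S * C' - C * S')]
      _ = |x 2 * (S * C' - C * S')| := by rw [abs_mul, abs_of_nonneg (by linarith : 0 ≤ x 2)]
      _ ≤ |x 2 * S - y 2 * S'| * |C'| + |x 2 * C - y 2 * C'| * |S'| := by
        rw [hid, ← abs_mul, ← abs_mul]; exact abs_sub _ _
      _ ≤ (2 * δ) * 1 + δ * 1 := by gcongr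
      _ = 3 * δ := by ring
  refine ⟨d2, d0, ?_⟩
  rw [kx0, ly0] at c0
  rw [kx1, ly1] at c1
  have hkl : |k - l| * y 1 ≤ δ + k * |x 0 - y 0| := by
    calc |k - l| * y 1 ≤ |k - l| * y 0 := by gcongr
      _ = |(k - l) * y 0| := by rw [abs_mul, abs_of_nonneg (hy1.trans hy01)]
      _ = |(k * x 0 - l * y 0) - k * (x 0 - y 0)| := by congr 1; ring
      _ ≤ |k * x 0 - l * y 0| + |k * (x 0 - y 0)| := abs_sub _ _
      _ ≤ _ := by rw [abs_mul, abs_of_nonneg (by linarith : 0 ≤ k)]; linarith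
  have hk1 : k * |x 1 - y 1| ≤ 2 * δ + k * |x 0 - y 0| := by
    calc k * |x 1 - y 1| = |k * (x 1 - y 1)| := by
          rw [abs_mul, abs_of_nonneg (by linarith : 0 ≤ k)]
      _ = |(k * x 1 - l * y 1) - (k - l) * y 1| := by congr 1; ring
      _ ≤ |k * x 1 - l * y 1| + |(k - l) * y 1| := abs_sub _ _
      _ ≤ _ := by rw [abs_mul, abs_of_nonneg hy1]; linarith
  have hδ0 : 0 ≤ δ := norm_nonneg _
  nlinarith

/-! ### Symmetries -/

/-- The reflection that changes the sign of the `i`-th coordinate. -/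
def flip (i : Fin 3) : E3 ≃ₗᵢ[ℝ] E3 :=
  LinearIsometryEquiv.piLpCongrRight 2 fun j =>
    if j = i then LinearIsometryEquiv.neg ℝ else LinearIsometryEquiv.refl ℝ ℝ

/-- The reflection that exchanges the first two coordinates. -/
def swap : E3 ≃ₗᵢ[ℝ] E3 := LinearIsometryEquiv.piLpCongrLeft 2 ℝ ℝ (Equiv.swap 0 1)

lemma flip_apply (i j : Fin 3) (x : E3) : flip i x j = if j = i then -x j else x j := by
  simp only [flip, LinearIsometryEquiv.piLpCongrRight_apply]
  split_ifs <;> simp [*]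

lemma swap_apply (x : E3) : swap x 0 = x 1 ∧ swap x 1 = x 0 ∧ swap x 2 = x 2 := by
  refine ⟨?_, ?_, ?_⟩ <;>
    simp [swap, LinearIsometryEquiv.piLpCongrLeft_apply, Equiv.piCongrLeft'_apply]
  rfl

/-- The reflections in the walls of the chambers. -/
inductive IsWallReflection : (E3 ≃ₗᵢ[ℝ] E3) → Prop
  | flip (i : Fin 3) : IsWallReflection (flip i)
  | swap : IsWallReflection swap

lemma IsWallReflection.involutive {ρ : E3 ≃ₗᵢ[ℝ] E3} (h : IsWallReflection ρ) (x : E3) :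
    ρ (ρ x) = x := by
  cases h with
  | flip i =>
    ext j
    rw [flip_apply, flip_apply]
    split_ifs <;> simp
  | swap =>
    obtain ⟨h0, h1, h2⟩ := swap_apply x
    obtain ⟨h0', h1', h2'⟩ := swap_apply (QRInterp.swap x)
    ext j
    fin_cases j
    · exact h0'.trans h1
    · exact h1'.trans h0
    · exact h2'.trans h2

/-- The chamber on which the symmetries act simply. -/
def chamber : Set E3 := {x | 0 ≤ x 1 ∧ x 1 ≤ x 0 ∧ 0 ≤ x 2}

/-- A property of sets that is invariant under the reflections and can be glued along planes
holds for the whole space if it holds for the chamber. -/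
lemma chamber_induction (p : Set E3 → Prop) (h0 : p chamber)
    (hρ : ∀ ρ, IsWallReflection ρ → ∀ D, p D → p (ρ ⁻¹' D))
    (hu : ∀ (l : E3 →L[ℝ] ℝ) (D : Set E3), Convex ℝ D → p (D ∩ {x | 0 ≤ l x}) →
      p (D ∩ {x | l x ≤ 0}) → p D) : p univ := by
  have half : ∀ l : E3 →L[ℝ] ℝ, Convex ℝ {x | 0 ≤ l x} := fun l =>
    convex_halfSpace_ge l.toLinearMap.isLinear 0
  have c1 : p ({x | 0 ≤ coord 2 x} ∩ {x | 0 ≤ coord 1 x} ∩ {x | 0 ≤ coord 0 x}) := by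
    refine hu (coord 0 - coord 1) _ (((half _).inter (half _)).inter (half _)) ?_ ?_
    · convert h0 using 1
      ext x
      simp only [chamber, mem_inter_iff, mem_ofPred_eq, _root_.sub_apply,
        PiLp.proj_apply]
      constructor
      · rintro ⟨⟨⟨a, b⟩, c⟩, d⟩
        exact ⟨b, by linarith, a⟩
      · rintro ⟨a, b, c⟩
        exact ⟨⟨⟨c, a⟩, by linarith⟩, by linarith⟩
    · convert hρ _ .swap _ h0 using 1
      ext x
      obtain ⟨h0, h1, h2⟩ := swap_apply x
      simp only [chamber, mem_inter_iff, mem_ofPred_eq, _root_.sub_apply,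
        PiLp.proj_apply, mem_preimage, h0, h1, h2]
      constructor
      · rintro ⟨⟨⟨a, b⟩, c⟩, d⟩
        exact ⟨c, by linarith, a⟩
      · rintro ⟨a, b, c⟩
        exact ⟨⟨⟨c, by linarith⟩, by linarith⟩, by linarith⟩
  have c2 : p ({x | 0 ≤ coord 2 x} ∩ {x | 0 ≤ coord 1 x}) := by
    refine hu (coord 0) _ ((half _).inter (half _)) c1 ?_
    convert hρ _ (.flip 0) _ c1 using 1
    ext x
    simp [flip_apply]
  have c3 : p {x | 0 ≤ coord 2 x} := by
    refine hu (coord 1) _ (half _) c2 ?_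
    convert hρ _ (.flip 1) _ c2 using 1
    ext x
    simp [flip_apply]
  refine hu (coord 2) _ convex_univ (by simpa using c3) ?_
  convert hρ _ (.flip 2) _ c3 using 1
  ext x
  simp [flip_apply]

/-- A property of points that is invariant under the reflections holds everywhere if it holds on
the chamber. -/
lemma chamber_induction_points (p : E3 → Prop) (h0 : ∀ x ∈ chamber, p x)
    (hρ : ∀ ρ, IsWallReflection ρ → ∀ x, p (ρ x) → p x) (x : E3) : p x := by
  refine chamber_induction (fun D => ∀ x ∈ D, p x) h0 ?_ ?_ x (mem_univ x)
  · intro ρ h D hD x hx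
    exact hρ ρ h x (hD _ hx)
  · intro l D _ h1 h2 x hx
    rcases le_total 0 (l x) with h | h
    · exact h1 x ⟨hx, h⟩
    · exact h2 x ⟨hx, h⟩

lemma lipschitzOnConvex_glue {L : NNReal} {f : E3 → E3} {D : Set E3} (l : E3 →L[ℝ] ℝ)
    (hD : Convex ℝ D) (h1 : LipschitzOnWith L f (D ∩ {x | 0 ≤ l x}))
    (h2 : LipschitzOnWith L f (D ∩ {x | l x ≤ 0})) : LipschitzOnWith L f D := by
  have key : ∀ x ∈ D, ∀ y ∈ D, 0 ≤ l x → l y ≤ 0 → dist (f x) (f y) ≤ L * dist x y := by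
    intro x hx y hy hlx hly
    rcases eq_or_lt_of_le (hly.trans hlx) with h | h
    · exact h2.dist_le_mul x ⟨hx, (h ▸ hly : l x ≤ 0)⟩ y ⟨hy, hly⟩
    set t := l x / (l x - l y) with ht
    have hd : 0 < l x - l y := by linarith
    have ht0 : 0 ≤ t := by positivity
    have ht1 : t ≤ 1 := by rw [ht, div_le_one hd]; linarith
    set z := x + t • (y - x) with hz
    have hzD : z ∈ D := hD.add_smul_sub_mem hx hy ⟨ht0, ht1⟩
    have hlz : l z = 0 := by
      rw [hz, map_add, map_smul, map_sub, smul_eq_mul, ht]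
      field_simp
      ring
    have hxz : dist x z = t * dist x y := by
      rw [dist_comm x z, dist_eq_norm, hz, add_sub_cancel_left, norm_smul,
        Real.norm_of_nonneg ht0, dist_comm x y, dist_eq_norm]
    have hzy : dist z y = (1 - t) * dist x y := by
      rw [dist_eq_norm, hz, show x + t • (y - x) - y = (1 - t) • (x - y) by module, norm_smul,
        Real.norm_of_nonneg (by linarith), dist_eq_norm]
    calc dist (f x) (f y) ≤ dist (f x) (f z) + dist (f z) (f y) := dist_triangle _ _ _
      _ ≤ L * dist x z + L * dist z y := add_le_add
          (h1.dist_le_mul x ⟨hx, hlx⟩ z ⟨hzD, hlz.ge⟩) (h2.dist_le_mul z ⟨hzD, hlz.le⟩ y ⟨hy, hly⟩)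
      _ = L * dist x y := by rw [hxz, hzy]; ring
  refine LipschitzOnWith.of_dist_le_mul fun x hx y hy => ?_
  rcases le_total 0 (l x) with hlx | hlx <;> rcases le_total 0 (l y) with hly | hly
  · exact h1.dist_le_mul x ⟨hx, hlx⟩ y ⟨hy, hly⟩
  · exact key x hx y hy hlx hly
  · rw [dist_comm, dist_comm x]; exact key y hy x hx hly hlx
  · exact h2.dist_le_mul x ⟨hx, hlx⟩ y ⟨hy, hly⟩

/-- A map that commutes with the reflections and is Lipschitz on the chamber is Lipschitz. -/
lemma LipschitzOnConvex.of_chamber {L : NNReal} {f : E3 → E3} {A : Set E3}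
    (hA : ∀ ρ, IsWallReflection ρ → ∀ x ∈ A, ρ x ∈ A)
    (hf : ∀ ρ, IsWallReflection ρ → ∀ x ∈ A, f (ρ x) = ρ (f x))
    (h : LipschitzOnWith L f (A ∩ chamber)) : LipschitzOnConvex L f A := by
  have := chamber_induction
    (fun D => ∀ B ⊆ A, Convex ℝ B → LipschitzOnWith L f (B ∩ D))
    (fun B hB _ => h.mono (inter_subset_inter_left _ hB))
    (fun ρ hρ D hD B hB hc => ?_) (fun l D hD h1 h2 B hB hc => ?_)
  · intro B hB hc
    simpa using this B hB hc
  · have hc' : Convex ℝ (ρ '' B) := hc.linear_image ρ.toLinearEquiv.toLinearMap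
    have hB' : ρ '' B ⊆ A := by
      rintro _ ⟨x, hx, rfl⟩
      exact hA ρ hρ x (hB hx)
    refine LipschitzOnWith.of_dist_le_mul fun x hx y hy => ?_
    have := (hD _ hB' hc').dist_le_mul (ρ x) ⟨⟨x, hx.1, rfl⟩, hx.2⟩ (ρ y) ⟨⟨y, hy.1, rfl⟩, hy.2⟩
    rwa [hf ρ hρ x (hB hx.1), hf ρ hρ y (hB hy.1), ρ.dist_map, ρ.dist_map] at this
  · refine lipschitzOnConvex_glue l (hc.inter hD) ?_ ?_
    · rw [inter_assoc]; exact h1 B hB hc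
    · rw [inter_assoc]; exact h2 B hB hc

lemma continuousOn_of_chamber {f : E3 → E3} {A : Set E3}
    (hA : ∀ ρ, IsWallReflection ρ → ∀ x ∈ A, ρ x ∈ A)
    (hf : ∀ ρ, IsWallReflection ρ → ∀ x ∈ A, f (ρ x) = ρ (f x))
    (h : ContinuousOn f (A ∩ chamber)) : ContinuousOn f A := by
  have := chamber_induction (fun D => ContinuousOn f (A ∩ D)) h
    (fun ρ hρ D hD => ?_) (fun l D _ h1 h2 => ?_)
  · simpa using this
  · have h1 : ContinuousOn (fun x => ρ (f (ρ x))) (A ∩ ρ ⁻¹' D) :=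
      ρ.continuous.comp_continuousOn
        (hD.comp ρ.continuous.continuousOn fun x hx => ⟨hA ρ hρ x hx.1, hx.2⟩)
    refine h1.congr fun x hx => ?_
    beta_reduce
    rw [hf ρ hρ x hx.1, hρ.involutive]
  · intro x hx
    have e : A ∩ D = A ∩ (D ∩ {x | 0 ≤ l x}) ∪ A ∩ (D ∩ {x | l x ≤ 0}) := by
      ext y
      simp only [mem_inter_iff, mem_union, mem_ofPred_eq]
      have := le_total 0 (l y)
      tauto
    have side : ∀ s : Set E3, IsClosed s → ContinuousOn f (A ∩ (D ∩ s)) →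
        ContinuousWithinAt f (A ∩ (D ∩ s)) x := by
      intro s hs hc
      by_cases hxs : x ∈ s
      · exact hc x ⟨hx.1, hx.2, hxs⟩
      · refine continuousWithinAt_of_notMem_closure fun hcl => hxs ?_
        exact closure_minimal (fun y hy => hy.2.2) hs hcl
    rw [e]
    exact (side _ (isClosed_le continuous_const l.continuous) h1).union
      (side _ (isClosed_le l.continuous continuous_const) h2)

/-- Points that lie on none of the planes that bound the chambers. -/
def OffWalls (x : E3) : Prop := x 0 ≠ 0 ∧ x 1 ≠ 0 ∧ x 2 ≠ 0 ∧ x 0 ≠ x 1 ∧ x 0 ≠ -x 1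

lemma OffWalls.reflect {ρ : E3 ≃ₗᵢ[ℝ] E3} (hρ : IsWallReflection ρ) {x : E3} (h : OffWalls x) :
    OffWalls (ρ x) := by
  obtain ⟨h0, h1, h2, h3, h4⟩ := h
  cases hρ with
  | flip i =>
    have h5 : -x 0 ≠ x 1 := fun h => h4 (by linarith)
    have h6 : -x 0 ≠ -x 1 := fun h => h3 (by linarith)
    fin_cases i <;> refine ⟨?_, ?_, ?_, ?_, ?_⟩ <;> simp [flip_apply] <;> assumption
  | swap =>
    obtain ⟨e0, e1, e2⟩ := swap_apply x
    rw [OffWalls, e0, e1, e2]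
    refine ⟨h1, h0, h2, h3.symm, fun h => h4 (by linarith)⟩

/-- The Jacobian of a map that commutes with a reflection is invariant. -/
lemma hasFDerivAt_of_reflect {f : E3 → E3} {x : E3} {ρ : E3 ≃ₗᵢ[ℝ] E3} (hρ : IsWallReflection ρ)
    (hf : ∀ᶠ y in 𝓝 x, f (ρ y) = ρ (f y)) {T : E3 →L[ℝ] E3} (hT : HasFDerivAt f T (ρ x)) :
    ∃ S : E3 →L[ℝ] E3, HasFDerivAt f S x ∧ S.det = T.det := by
  let R : E3 →L[ℝ] E3 := ρ.toContinuousLinearEquiv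
  have h1 : HasFDerivAt (fun y => ρ (f (ρ y))) (R.comp (T.comp R)) x := by
    have h2 := hT.comp x (f := ρ) (R.hasFDerivAt)
    exact R.hasFDerivAt.comp x h2
  refine ⟨_, h1.congr_of_eventuallyEq (hf.mono fun y hy => ?_), ?_⟩
  · beta_reduce
    rw [hy, hρ.involutive]
  · have hR : R.comp R = ContinuousLinearMap.id ℝ E3 := by
      ext1 y; exact hρ.involutive y
    have comp : ∀ A B : E3 →L[ℝ] E3, (A.comp B).det = A.det * B.det := fun A B =>
      LinearMap.det_comp (A : E3 →ₗ[ℝ] E3) (B : E3 →ₗ[ℝ] E3)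
    have hR' : R.det * R.det = 1 := by
      rw [← comp, hR]
      exact LinearMap.det_id
    rw [comp, comp]
    linear_combination T.det * hR'

lemma hemi_neg_left (s t : ℝ) : hemi (-s) t 0 = -hemi s t 0 := by
  simp only [hemi, PiLp.toLp_apply, Matrix.cons_val_zero, abs_neg, neg_sq]
  ring

lemma hemi_neg_right (s t : ℝ) : hemi s (-t) 0 = hemi s t 0 := by
  simp only [hemi, PiLp.toLp_apply, Matrix.cons_val_zero, abs_neg, neg_sq]

lemma roundMap_apply (v : E3) :
    roundMap v 0 = gauge v * hemi (v 0 / gauge v) (v 1 / gauge v) 0 ∧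
    roundMap v 1 = gauge v * hemi (v 1 / gauge v) (v 0 / gauge v) 0 ∧
    roundMap v 2 = gauge v * Real.sin (Real.pi * (v 2 / gauge v) / 2) := by
  simp only [roundMap, PiLp.smul_apply, smul_eq_mul, Matrix.cons_val_zero,
    Matrix.cons_val_one, Matrix.cons_val, hemi_one, and_self]

lemma gauge_reflect {ρ : E3 ≃ₗᵢ[ℝ] E3} (hρ : IsWallReflection ρ) (v : E3) :
    gauge (ρ v) = gauge v := by
  cases hρ with
  | flip i => fin_cases i <;> simp [gauge, flip_apply]
  | swap =>
    obtain ⟨e0, e1, e2⟩ := swap_apply v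
    rw [gauge, e0, e1, e2, max_comm, gauge]

lemma roundMap_reflect {ρ : E3 ≃ₗᵢ[ℝ] E3} (hρ : IsWallReflection ρ) (v : E3) :
    roundMap (ρ v) = ρ (roundMap v) := by
  obtain ⟨a0, a1, a2⟩ := roundMap_apply v
  obtain ⟨b0, b1, b2⟩ := roundMap_apply (ρ v)
  rw [gauge_reflect hρ] at b0 b1 b2
  cases hρ with
  | flip i =>
    ext j
    rw [flip_apply]
    obtain rfl | rfl | rfl : i = 0 ∨ i = 1 ∨ i = 2 := by fin_cases i <;> simp
    all_goals fin_cases j <;>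
      simp [a0, a1, a2, b0, b1, b2, flip_apply, neg_div, hemi_neg_left, hemi_neg_right]
  | swap =>
    obtain ⟨e0, e1, e2⟩ := swap_apply v
    obtain ⟨f0, f1, f2⟩ := swap_apply (roundMap v)
    rw [e0, e1] at b0 b1
    rw [e2] at b2
    ext j
    fin_cases j
    · exact b0.trans (a1.symm.trans f0.symm)
    · exact b1.trans (a0.symm.trans f1.symm)
    · exact b2.trans (a2.symm.trans f2.symm)

lemma roundMap_eq_beam {v : E3} (h1 : 0 ≤ v 1) (h01 : v 1 ≤ v 0) (h0 : 0 < v 0) (h2 : 0 ≤ v 2) :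
    roundMap v = beam !₂[v 0 / (v 0 + v 2), v 1 / (v 0 + v 2), v 0 + v 2] := by
  have hg : gauge v = v 0 + v 2 := by
    rw [gauge, abs_of_nonneg h0.le, abs_of_nonneg h1, abs_of_nonneg h2, max_eq_left h01]
  have hp : 0 < v 0 + v 2 := by linarith
  have hm : max |v 0 / (v 0 + v 2)| |v 1 / (v 0 + v 2)| = v 0 / (v 0 + v 2) := by
    rw [abs_of_nonneg (by positivity), abs_of_nonneg (by positivity), max_eq_left]
    gcongr
  have hs : Real.sin (Real.pi * (v 2 / (v 0 + v 2)) / 2)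
      = Real.cos (Real.pi * (v 0 / (v 0 + v 2)) / 2) := by
    rw [← Real.sin_pi_div_two_sub]
    congr 1
    field_simp
    ring
  rw [roundMap, beam, hg, hs]
  ext i
  fin_cases i
  · simp
  · simp
  · simp [hemi_two, hm]

lemma hasFDerivAt_roundMap_of_chamber {v : E3} (h1 : 0 < v 1) (h01 : v 1 < v 0) (h2 : 0 < v 2) :
    ∃ T : E3 →L[ℝ] E3, HasFDerivAt roundMap T v ∧ 1 / 2 ≤ T.det := by
  have h0 : 0 < v 0 := h1.trans h01
  set g := v 0 + v 2 with hg
  have hp : 0 < g := by positivity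
  let ψ : E3 → E3 := fun v => !₂[v 0 / (v 0 + v 2), v 1 / (v 0 + v 2), v 0 + v 2]
  have d0 := hasFDerivAt_coord 0 v
  have d1 := hasFDerivAt_coord 1 v
  have d2 := hasFDerivAt_coord 2 v
  have dg : HasFDerivAt (fun y : E3 => y 0 + y 2) (coord 0 + coord 2) v := d0.add d2
  have di : HasFDerivAt (fun y : E3 => (y 0 + y 2)⁻¹) ((-(g ^ 2)⁻¹) • (coord 0 + coord 2)) v :=
    HasDerivAt.comp_hasFDerivAt (h₂ := fun u : ℝ => u⁻¹) (f := fun y : E3 => y 0 + y 2) v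
      (hasDerivAt_inv hp.ne') dg
  have e0 : HasFDerivAt (fun y : E3 => ψ y 0)
      ((v 2 / g ^ 2) • coord 0 + (-(v 0) / g ^ 2) • coord 2) v := by
    refine (d0.mul di).congr_fderiv ?_
    ext w
    simp [← hg]
    field_simp
    rw [hg]; ring
  have e1 : HasFDerivAt (fun y : E3 => ψ y 1)
      ((-(v 1) / g ^ 2) • coord 0 + (1 / g) • coord 1 + (-(v 1) / g ^ 2) • coord 2) v := by
    refine (d1.mul di).congr_fderiv ?_
    ext w
    simp [← hg]
    field_simp
    ring
  obtain ⟨S, hS, hSe⟩ := exists_hasFDerivAt_of_coords (f := ψ) (x := v)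
    (D := ![_, _, _]) (by
      intro i
      fin_cases i
      · exact e0
      · exact e1
      · exact dg)
  have hSdet : S.det = 1 / g ^ 2 := by
    rw [det_eq_entries]
    simp [hSe, unitVec]
    field_simp
    rw [hg]; ring
  have a1 : 0 < v 1 / g := by positivity
  have a01 : v 1 / g < v 0 / g := by gcongr
  have a0 : v 0 / g ≤ 1 := by rw [div_le_one hp]; linarith
  obtain ⟨B, hB, hBdet⟩ := hasFDerivAt_beam (x := ψ v) a1 a01
  refine ⟨B.comp S, ?_, ?_⟩
  · refine (hB.comp v hS).congr_of_eventuallyEq ?_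
    filter_upwards [(coord 1).continuous.continuousAt.eventually_const_lt h1,
      (coord 2).continuous.continuousAt.eventually_const_lt h2,
      (coord 1).continuous.continuousAt.eventually_lt (coord 0).continuous.continuousAt h01]
      with y y1 y2 y01
    exact roundMap_eq_beam y1.le y01.le (lt_trans y1 y01) y2.le
  · have hdet : (B.comp S).det = B.det * S.det :=
      LinearMap.det_comp (B : E3 →ₗ[ℝ] E3) (S : E3 →ₗ[ℝ] E3)
    rw [hdet, hBdet, hSdet]
    have := (det_beam_bounds a1 a01 a0).1
    refine this.trans_eq ?_
    change _ = g ^ 2 * (Real.pi / 2) * Real.sin (Real.pi * (v 0 / g) / 2) * (v 0 / g)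
      / ((v 0 / g) ^ 2 + (v 1 / g) ^ 2) * (1 / g ^ 2)
    field_simp

lemma hasFDerivAt_roundMap {v : E3} (hv : OffWalls v) :
    ∃ T : E3 →L[ℝ] E3, HasFDerivAt roundMap T v ∧ 1 / 2 ≤ T.det := by
  revert hv
  refine chamber_induction_points (fun v => OffWalls v →
    ∃ T : E3 →L[ℝ] E3, HasFDerivAt roundMap T v ∧ 1 / 2 ≤ T.det) ?_ ?_ v
  · rintro x ⟨h1, h01, h2⟩ ⟨-, n1, n2, n01, -⟩
    exact hasFDerivAt_roundMap_of_chamber (lt_of_le_of_ne h1 n1.symm)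
      (lt_of_le_of_ne h01 n01.symm) (lt_of_le_of_ne h2 n2.symm)
  · intro ρ hρ x ih hx
    obtain ⟨T, hT, hd⟩ := ih (hx.reflect hρ)
    obtain ⟨S, hS, hSd⟩ := hasFDerivAt_of_reflect hρ
      (Eventually.of_forall fun y => roundMap_reflect hρ y) hT
    exact ⟨S, hS, hSd ▸ hd⟩

lemma locallyLipschitz_interp_apply (R : ℝ) :
    (LocallyLipschitz fun x : E3 => interp R x 0) ∧
    (LocallyLipschitz fun x : E3 => interp R x 1) ∧
    (LocallyLipschitz fun x : E3 => interp R x 2) := by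
  refine ⟨locallyLipschitz_planarRe R 0, locallyLipschitz_planarRe R 1, ?_⟩
  have h0 := locallyLipschitz_planarIm R 0
  have h1 := locallyLipschitz_planarIm R 1
  have h := LocallyLipschitz.mul_real (LocallyLipschitz.const (1 / 2 : ℝ))
    ((LocallyLipschitz.abs (h0.add h1)).sub (LocallyLipschitz.abs (h0.sub h1)))
  convert h using 1
  ext x
  change sgnMin _ _ = _
  rw [sgnMin]
  change _ = 1 / 2 * (|planarIm R (x 2) (x 0) + planarIm R (x 2) (x 1)|
    - |planarIm R (x 2) (x 0) - planarIm R (x 2) (x 1)|)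
  ring

lemma det_ne_zero_comp {T : E3 →L[ℝ] E3} (hT : T.det ≠ 0) {l : E3 →L[ℝ] ℝ} (hl : l ≠ 0) :
    l.comp T ≠ 0 := by
  intro h
  apply hl
  ext w
  obtain ⟨u, hu⟩ := (LinearMap.isUnit_iff_range_eq_top _).1
    ((LinearMap.isUnit_iff_isUnit_det (T : E3 →ₗ[ℝ] E3)).2 hT.isUnit) ▸ Submodule.mem_top (x := w)
  have := congrArg (fun k : E3 →L[ℝ] ℝ => k u) h
  simp only [ContinuousLinearMap.comp_apply] at this
  have hu' : T u = w := hu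
  rw [hu'] at this
  simpa using this

/-- The Jacobian of the interpolating map in the coordinates of the beam. -/
lemma ae_det_roundMap_interp {R : ℝ} (hR : 20 ≤ R) : ∀ᵐ x : E3, 1 < x 2 → x 2 < R →
    ∃ T : E3 →L[ℝ] E3, HasFDerivAt (fun y => roundMap (interp R y)) T x ∧ 3 / 4 ≤ T.det := by
  obtain ⟨l0, l1, l2⟩ := locallyLipschitz_interp_apply R
  filter_upwards [ae_det_interp hR, LocallyLipschitz.ae_eq_zero_imp l0,
    LocallyLipschitz.ae_eq_zero_imp l1, LocallyLipschitz.ae_eq_zero_imp l2,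
    LocallyLipschitz.ae_eq_zero_imp (l0.sub l1), LocallyLipschitz.ae_eq_zero_imp (l0.add l1)]
    with x hx z0 z1 z2 zs za h1 h2
  obtain ⟨T, hT, hd⟩ := hx h1 h2
  have hd0 : T.det ≠ 0 := by linarith
  have der : ∀ l : E3 →L[ℝ] ℝ, HasFDerivAt (fun y => l (interp R y)) (l.comp T) x := fun l =>
    l.hasFDerivAt.comp x hT
  have ne : ∀ l : E3 →L[ℝ] ℝ, ∀ i : Fin 3, l (unitVec i) ≠ 0 → l.comp T ≠ 0 := by
    intro l i hl
    refine det_ne_zero_comp hd0 ?_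
    rintro rfl
    exact hl rfl
  have off : OffWalls (interp R x) := by
    refine ⟨fun h => ?_, fun h => ?_, fun h => ?_, fun h => ?_, fun h => ?_⟩
    · exact ne (coord 0) 0 (by simp [unitVec]) (z0 _ (der (coord 0)) h)
    · exact ne (coord 1) 1 (by simp [unitVec]) (z1 _ (der (coord 1)) h)
    · exact ne (coord 2) 2 (by simp [unitVec]) (z2 _ (der (coord 2)) h)
    · exact ne (coord 0 - coord 1) 0 (by simp [unitVec])
        (zs _ (der (coord 0 - coord 1)) (sub_eq_zero.2 h))
    · exact ne (coord 0 + coord 1) 0 (by simp [unitVec])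
        (za _ (der (coord 0 + coord 1)) (by simp [h]))
  obtain ⟨S, hS, hSd⟩ := hasFDerivAt_roundMap off
  refine ⟨S.comp T, hS.comp x hT, ?_⟩
  have hdet : (S.comp T).det = S.det * T.det :=
    LinearMap.det_comp (S : E3 →ₗ[ℝ] E3) (T : E3 →ₗ[ℝ] E3)
  rw [hdet]
  nlinarith

/-! ### The map on the ring -/

lemma fold_one_sub_eq_or {s s' : ℝ} (h : fold s = fold s') :
    fold (1 - s') = fold (1 - s) ∨ fold (1 - s') = -fold (1 - s) := by
  rw [← abs_eq_abs, abs_fold_one_sub, abs_fold_one_sub, h]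

lemma heightSign_eq_zero {s t : ℝ} (h : heightSign s t = 0) :
    fold (1 - s) = 0 ∨ fold (1 - t) = 0 := by
  have hp := Real.pi_pos
  have hm := abs_sgnMin (fold (1 - s)) (fold (1 - t))
  have h1 : |sgnMin (fold (1 - s)) (fold (1 - t))| ≤ 1 :=
    hm.trans_le ((min_le_left _ _).trans (abs_fold_le _))
  obtain ⟨h2, h3⟩ := abs_le.1 h1
  rw [← sin_sgnMin_fold, Real.sin_eq_zero_iff_of_lt_of_lt (by nlinarith) (by nlinarith)] at h
  have h4 : sgnMin (fold (1 - s)) (fold (1 - t)) = 0 := by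
    have : Real.pi * sgnMin (fold (1 - s)) (fold (1 - t)) = 0 := by linarith
    exact (mul_eq_zero.1 this).resolve_left hp.ne'
  rw [h4, abs_zero] at hm
  rcases min_choice |fold (1 - s)| |fold (1 - t)| with h | h <;> rw [h] at hm
  · exact Or.inl (abs_eq_zero.1 hm.symm)
  · exact Or.inr (abs_eq_zero.1 hm.symm)

lemma bendIm_zero (R r : ℝ) : bendIm R r 0 = 0 := by
  have := bendIm_neg R r 0
  rw [neg_zero] at this
  linarith

lemma sgnMin_planarIm_of_heightSign_eq_zero {s t : ℝ} (h : heightSign s t = 0) (R r : ℝ) :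
    sgnMin (planarIm R r s) (planarIm R r t) = 0 := by
  rcases heightSign_eq_zero h with h | h <;> simp [planarIm, h, bendIm_zero, sgnMin]

lemma planarIm_of_neg {s s' : ℝ} (h : fold (1 - s') = -fold (1 - s)) (R r : ℝ) :
    planarIm R r s' = -planarIm R r s := by
  rw [planarIm, h, mul_neg, bendIm_neg, planarIm]

lemma interp_congr {s t s' t' : ℝ} (hs : fold s = fold s') (ht : fold t = fold t')
    (hh : heightSign s t = heightSign s' t') (R r : ℝ) :
    interp R !₂[s, t, r] = interp R !₂[s', t', r] := by
  have key : sgnMin (planarIm R r s) (planarIm R r t)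
      = sgnMin (planarIm R r s') (planarIm R r t') := by
    have a := sin_sgnMin_fold s t
    have b := sin_sgnMin_fold s' t'
    have sneg : ∀ u : ℝ, Real.sin (Real.pi * -u / 2) = -Real.sin (Real.pi * u / 2) := by
      intro u; rw [← Real.sin_neg]; congr 1; ring
    have z := fun h : heightSign s t = 0 =>
      (sgnMin_planarIm_of_heightSign_eq_zero h R r).trans
        (sgnMin_planarIm_of_heightSign_eq_zero (hh ▸ h : heightSign s' t' = 0) R r).symm
    rcases fold_one_sub_eq_or hs with e | e <;> rcases fold_one_sub_eq_or ht with e' | e'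
    · simp only [planarIm, e, e']
    · rw [e, e', sgnMin_neg_right, sneg] at b
      exact z (by linarith)
    · rw [e, e', sgnMin_neg_left, sneg] at b
      exact z (by linarith)
    · rw [planarIm_of_neg e, planarIm_of_neg e', sgnMin_neg_left, sgnMin_neg_right, neg_neg]
  ext i
  fin_cases i
  · simp [interp, planarRe, hs]
  · simp [interp, planarRe, ht]
  · simpa [interp] using key

lemma exists_lift_of_reflect {ρ : E3 ≃ₗᵢ[ℝ] E3} (hρ : IsWallReflection ρ) (s t : ℝ) :
    ∃ s' t' : ℝ, ∀ d : ℕ, Odd d → ∀ R r : ℝ,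
      interp R !₂[d * s', d * t', r] = ρ (interp R !₂[d * s, d * t, r]) := by
  have re_neg : ∀ R r u : ℝ, planarRe R r (-u) = -planarRe R r u := fun R r u => by
    rw [planarRe, fold_neg, mul_neg, bendRe_neg, planarRe]
  have im_neg : ∀ R r u : ℝ, planarIm R r (-u) = planarIm R r u := fun R r u => by
    rw [planarIm, sub_neg_eq_add, fold_one_add, planarIm]
  cases hρ with
  | flip i =>
    obtain rfl | rfl | rfl : i = 0 ∨ i = 1 ∨ i = 2 := by fin_cases i <;> simp
    · refine ⟨-s, t, fun d _ R r => ?_⟩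
      ext j
      rw [flip_apply]
      fin_cases j <;> simp [interp, re_neg, im_neg]
    · refine ⟨s, -t, fun d _ R r => ?_⟩
      ext j
      rw [flip_apply]
      fin_cases j <;> simp [interp, re_neg, im_neg]
    · refine ⟨2 - s, t, fun d hd R r => ?_⟩
      have hd' : Odd (d : ℤ) := by exact_mod_cast hd
      have e : (d : ℝ) * (2 - s) = 2 * (d : ℤ) - d * s := by push_cast; ring
      have h1 : planarRe R r (d * (2 - s)) = planarRe R r (d * s) := by
        rw [planarRe, e, fold_two_mul_sub hd', planarRe]
      have h2 : planarIm R r (d * (2 - s)) = -planarIm R r (d * s) :=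
        planarIm_of_neg (by rw [e, fold_one_sub_two_mul_sub hd']) R r
      ext j
      rw [flip_apply]
      fin_cases j <;> simp [interp, h1, h2, sgnMin_neg_left]
  | swap =>
    refine ⟨t, s, fun d _ R r => ?_⟩
    obtain ⟨e0, e1, e2⟩ := swap_apply (interp R !₂[d * s, d * t, r])
    ext j
    fin_cases j
    · exact e0.symm
    · exact e1.symm
    · refine Eq.trans ?_ e2.symm
      exact sgnMin_comm _ _

/-- The slope of the affine map from `[1, e^{1/d}]` onto `[1, e³]`. -/
def slope (d : ℕ) : ℝ := (Real.exp 3 - 1) / (Real.exp (1 / d) - 1)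

/-- The affine map that carries the ring in beam coordinates to the domain of `interp`. -/
def stretch (d : ℕ) (x : E3) : E3 := !₂[d * x 0, d * x 1, 1 + slope d * (x 2 - 1)]

open Classical in
/-- The interpolation between two Zorich power maps. -/
def ringMap (d : ℕ) (y : E3) : E3 :=
  if h : ∃ x, zorich x = y then
    roundMap (interp (Real.exp 3) (stretch d !₂[h.choose 0, h.choose 1, ‖y‖]))
  else 0

lemma ringMap_zorich {d : ℕ} (hd : Odd d) (x : E3) : ringMap d (zorich x) =
    roundMap (interp (Real.exp 3) (stretch d !₂[x 0, x 1, Real.exp (x 2)])) := by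
  have h : ∃ x', zorich x' = zorich x := ⟨x, rfl⟩
  rw [ringMap, dif_pos h, norm_zorich]
  obtain ⟨-, h0, h1, h2⟩ := zorich_eq_zorich (zorich_odd_smul hd h.choose_spec)
  exact congrArg roundMap (interp_congr h0 h1 h2 _ _)

lemma ringMap_zero (d : ℕ) : ringMap d 0 = 0 := by
  rw [ringMap, dif_neg]
  rintro ⟨x, hx⟩
  have := norm_zorich x
  rw [hx, norm_zero] at this
  exact (Real.exp_pos _).ne this

lemma ringMap_reflect {d : ℕ} (hd : Odd d) {ρ : E3 ≃ₗᵢ[ℝ] E3} (hρ : IsWallReflection ρ) (y : E3) :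
    ringMap d (ρ y) = ρ (ringMap d y) := by
  rcases eq_or_ne y 0 with rfl | hy
  · simp [ringMap_zero]
  obtain ⟨x, rfl⟩ := exists_zorich_eq y hy
  obtain ⟨s, t, hst⟩ := exists_lift_of_reflect hρ (x 0) (x 1)
  have hz : zorich !₂[s, t, x 2] = ρ (zorich x) := by
    have h := hst 1 odd_one 20 1
    rw [interp_inner le_rfl rfl, interp_inner le_rfl rfl] at h
    simp only [Nat.cast_one, one_mul, Matrix.cons_val_zero, Matrix.cons_val_one] at h
    rw [zorich_eq_roundMap, zorich_eq_roundMap, ← roundMap_reflect hρ, map_smul, ← h]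
    rfl
  rw [← hz, ringMap_zorich hd, ringMap_zorich hd, ← roundMap_reflect hρ]
  exact congrArg roundMap (hst d hd _ _)

lemma exp_three_ge : (20 : ℝ) ≤ Real.exp 3 := by
  have h := Real.exp_one_gt_d9
  have e : Real.exp 3 = Real.exp 1 ^ 3 := by rw [← Real.exp_nat_mul]; norm_num
  rw [e]
  calc (20 : ℝ) ≤ 2.718 ^ 3 := by norm_num
    _ ≤ _ := by gcongr; linarith

lemma slope_bounds {d : ℕ} (hd : 1 ≤ d) : d ≤ slope d ∧ slope d ≤ Real.exp 3 * d ∧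
    slope d * (Real.exp (1 / d) - 1) = Real.exp 3 - 1 := by
  have hR := exp_three_ge
  have hd0 : (1 : ℝ) ≤ d := by exact_mod_cast hd
  set u : ℝ := 1 / d with hu
  have hu0 : 0 < u := by positivity
  have hu1 : u ≤ 1 := by rw [hu, div_le_one (by linarith)]; exact hd0
  have hdu : d * u = 1 := by rw [hu]; field_simp
  have h1 := Real.add_one_le_exp u
  have h2 : Real.exp u - 1 ≤ 2 * u := by
    have := Real.abs_exp_sub_one_le (x := u) (by rwa [abs_of_pos hu0])
    rw [abs_of_pos hu0] at this
    exact (le_abs_self _).trans this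
  have h3 : 0 < Real.exp u - 1 := by linarith
  refine ⟨?_, ?_, ?_⟩
  · rw [slope, ← hu, le_div_iff₀ h3]
    nlinarith
  · rw [slope, ← hu, div_le_iff₀ h3]
    have : 1 ≤ d * (Real.exp u - 1) := by nlinarith
    nlinarith
  · rw [slope, ← hu, div_mul_cancel₀ _ h3.ne']

lemma ringMap_eq_powerMap_inner {d : ℕ} (hd : Odd d) {y : E3} (hy : ‖y‖ = 1) :
    ringMap d y = powerMap d y := by
  obtain ⟨x, rfl⟩ := exists_zorich_eq y (norm_pos_iff.1 (by rw [hy]; exact one_pos))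
  rw [norm_zorich, Real.exp_eq_one_iff] at hy
  rw [ringMap_zorich hd, powerMap_zorich hd, zorich_eq_roundMap,
    interp_inner exp_three_ge (by simp [stretch, hy])]
  simp [stretch, hy]

lemma ringMap_eq_powerMap_outer {d : ℕ} (hd : Odd d) {y : E3} (hy : ‖y‖ = Real.exp (1 / d)) :
    ringMap d y = powerMap (3 * d) y := by
  obtain ⟨x, rfl⟩ := exists_zorich_eq y (norm_pos_iff.1 (by rw [hy]; exact Real.exp_pos _))
  rw [norm_zorich, Real.exp_eq_exp] at hy
  have hd0 : (d : ℝ) ≠ 0 := by exact_mod_cast hd.pos.ne'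
  rw [ringMap_zorich hd, powerMap_zorich ((by decide : Odd 3).mul hd), zorich_eq_roundMap,
    interp_outer exp_three_ge (by simp [stretch, hy, -one_div, (slope_bounds hd.pos).2.2])]
  have e : (((3 * d : ℕ) : ℝ) • x) 2 = 3 := by
    simp [hy]
    field_simp
  rw [e]
  simp [stretch, mul_assoc]

lemma norm_ringMap_le {d : ℕ} (hd : Odd d) {y : E3} (h1 : 1 ≤ ‖y‖) (h2 : ‖y‖ ≤ Real.exp (1 / d)) :
    ‖ringMap d y‖ ≤ Real.exp 3 := by
  obtain ⟨x, rfl⟩ := exists_zorich_eq y (norm_pos_iff.1 (by linarith))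
  rw [norm_zorich] at h1 h2
  obtain ⟨s1, -, s3⟩ := slope_bounds hd.pos
  have hd0 : (0 : ℝ) ≤ d := Nat.cast_nonneg d
  rw [ringMap_zorich hd, norm_roundMap]
  refine gauge_interp_le ?_ ?_ <;> simp only [stretch, Matrix.cons_val] <;> nlinarith

lemma stretch_apply (d : ℕ) (x : E3) : stretch d x 0 = d * x 0 ∧ stretch d x 1 = d * x 1 ∧
    stretch d x 2 = 1 + slope d * (x 2 - 1) := ⟨rfl, rfl, rfl⟩

lemma exists_zorich_eq_of_chamber {y : E3} (hy : y ≠ 0) (hc : y ∈ chamber) :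
    ∃ x : E3, 0 ≤ x 1 ∧ x 1 ≤ x 0 ∧ x 0 ≤ 1 ∧ zorich x = y := by
  have hp := Real.pi_pos
  obtain ⟨z, rfl⟩ := exists_zorich_eq y hy
  obtain ⟨c1, c0, c2⟩ := hc
  have he := Real.exp_pos (z 2)
  have hs := abs_fold_le (z 0)
  have ht := abs_fold_le (z 1)
  set s := fold (z 0) with hs_def
  set t := fold (z 1) with ht_def
  have hz := zorich_eq z
  rw [← hs_def, ← ht_def] at hz
  have hm : max |s| |t| ≤ 1 := max_le hs ht
  have hm0 : 0 ≤ max |s| |t| := le_max_of_le_left (abs_nonneg _)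
  have hst : 0 ≤ t ∧ t ≤ s := by
    rcases hm0.eq_or_lt with h | h
    · have h0 : s = 0 := abs_nonpos_iff.1 ((le_max_left _ _).trans h.symm.le)
      have h1 : t = 0 := abs_nonpos_iff.1 ((le_max_right _ _).trans h.symm.le)
      simp [h0, h1]
    · have hsin : 0 < Real.sin (Real.pi * max |s| |t| / 2) :=
        Real.sin_pos_of_pos_of_lt_pi (by positivity) (by nlinarith)
      have hq : 0 < Real.sqrt (s ^ 2 + t ^ 2) := by
        apply Real.sqrt_pos.2
        rcases lt_max_iff.1 h with h | h
        · have := abs_pos.1 h; positivity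
        · have := abs_pos.1 h; positivity
      set k := Real.exp (z 2) * Real.sin (Real.pi * max |s| |t| / 2) / Real.sqrt (s ^ 2 + t ^ 2)
        with hk
      have hk0 : 0 < k := by positivity
      have e0 : zorich z 0 = k * s := by
        rw [hz, hk]
        simp only [hemi, PiLp.smul_apply, smul_eq_mul, Matrix.cons_val_zero]
        ring
      have e1 : zorich z 1 = k * t := by
        rw [hz, hk]
        simp only [hemi, PiLp.smul_apply, smul_eq_mul, Matrix.cons_val_one, Matrix.cons_val_zero]
        ring
      rw [e1] at c1
      rw [e0, e1] at c0
      exact ⟨nonneg_of_mul_nonneg_right c1 hk0, le_of_mul_le_mul_left c0 hk0⟩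
  have hs1 : s ≤ 1 := (le_abs_self s).trans hs
  refine ⟨!₂[s, t, z 2], hst.1, hst.2, hs1, ?_⟩
  have hh : heightSign (z 0) (z 1) = Real.cos (Real.pi * max |s| |t| / 2) := by
    refine (pow_left_inj₀ ?_ ?_ two_ne_zero).1 (heightSign_sq _ _)
    · rw [hz] at c2
      exact nonneg_of_mul_nonneg_right c2 he
    · apply Real.cos_nonneg_of_neg_pi_div_two_le_of_le <;> nlinarith
  rw [zorich_beam _ hs ht, hz, hh]
  rfl

lemma ringMap_beam {d : ℕ} (hd : Odd d) {x : E3} (h1 : 0 ≤ x 1) (h01 : x 1 ≤ x 0) (h0 : x 0 ≤ 1)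
    (h2 : 0 < x 2) : ringMap d (beam x) = roundMap (interp (Real.exp 3) (stretch d x)) := by
  have hz : zorich !₂[x 0, x 1, Real.log (x 2)] = beam x := by
    refine (zorich_beam !₂[x 0, x 1, Real.log (x 2)] (abs_le.2 ⟨by simp; linarith, h0⟩)
      (abs_le.2 ⟨by simp; linarith, h01.trans h0⟩)).trans ?_
    change Real.exp (Real.log (x 2)) • _ = _
    rw [Real.exp_log h2]
    rfl
  rw [← hz, ringMap_zorich hd]
  change roundMap (interp _ !₂[d * x 0, d * x 1, 1 + slope d * (Real.exp (Real.log (x 2)) - 1)]) = _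
  rw [Real.exp_log h2]
  rfl

lemma exists_beam_eq_of_chamber {y : E3} (hy : y ≠ 0) (hc : y ∈ chamber) :
    ∃ x : E3, 0 ≤ x 1 ∧ x 1 ≤ x 0 ∧ x 0 ≤ 1 ∧ x 2 = ‖y‖ ∧ beam x = y := by
  obtain ⟨x, h1, h01, h0, rfl⟩ := exists_zorich_eq_of_chamber hy hc
  refine ⟨!₂[x 0, x 1, Real.exp (x 2)], h1, h01, h0, (norm_zorich x).symm, ?_⟩
  rw [zorich_beam x (abs_le.2 ⟨by linarith, h0⟩) (abs_le.2 ⟨by linarith, h01.trans h0⟩)]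
  rfl

lemma norm_ringMap_sub_le_of_chamber {d : ℕ} (hd : Odd d) {y y' : E3}
    (hy : y ∈ closedRing 1 (Real.exp (1 / d)) ∩ chamber)
    (hy' : y' ∈ closedRing 1 (Real.exp (1 / d)) ∩ chamber) :
    ‖ringMap d y - ringMap d y'‖ ≤ 94500 * Real.exp 3 * d * ‖y - y'‖ := by
  obtain ⟨⟨n1, n2⟩, hc⟩ := hy
  obtain ⟨⟨n1', n2'⟩, hc'⟩ := hy'
  obtain ⟨x, h1, h01, h0, h2, rfl⟩ :=
    exists_beam_eq_of_chamber (norm_pos_iff.1 (by linarith)) hc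
  obtain ⟨x', h1', h01', h0', h2', rfl⟩ :=
    exists_beam_eq_of_chamber (norm_pos_iff.1 (by linarith)) hc'
  rw [← h2] at n1 n2
  rw [← h2'] at n1' n2'
  obtain ⟨s1, s2, s3⟩ := slope_bounds hd.pos
  have hd0 : (0 : ℝ) ≤ d := Nat.cast_nonneg d
  have hR := exp_three_ge
  obtain ⟨b2, b0, b1⟩ := sub_le_norm_beam_sub h1 h01 h0 n1 h1' h01' h0' n1'
  rw [ringMap_beam hd h1 h01 h0 (by linarith), ringMap_beam hd h1' h01' h0' (by linarith)]
  refine (norm_roundMap_sub_le _ _).trans ?_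
  have hi := norm_interp_sub_le (R := Real.exp 3) (x := stretch d x) (y := stretch d x')
    (by rw [(stretch_apply d x).2.2]; nlinarith) (by rw [(stretch_apply d x).2.2]; nlinarith)
  obtain ⟨u0, u1, u2⟩ := stretch_apply d x
  obtain ⟨v0, v1, v2⟩ := stretch_apply d x'
  rw [u0, u1, u2, v0, v1, v2, ← mul_sub, ← mul_sub, abs_mul, abs_mul, abs_of_nonneg hd0,
    show 1 + slope d * (x 2 - 1) - (1 + slope d * (x' 2 - 1)) = slope d * (x 2 - x' 2) by ring,
    abs_mul, abs_of_nonneg (hd0.trans s1)] at hi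
  set δ := ‖beam x - beam x'‖
  have hδ : 0 ≤ δ := norm_nonneg _
  have t2 : slope d * |x 2 - x' 2| ≤ Real.exp 3 * d * δ :=
    mul_le_mul s2 b2 (abs_nonneg _) (by positivity)
  have t0 : d * |x 0 - x' 0| ≤ d * (3 * δ) := by gcongr
  have t1 : d * |x 1 - x' 1| ≤ d * (7 * δ) := by gcongr
  have t3 : 30 * Real.exp 3 * (d * |x 0 - x' 0| + d * |x 1 - x' 1|)
      ≤ 30 * Real.exp 3 * (d * (3 * δ) + d * (7 * δ)) := by gcongr
  nlinarith

/-- In the interior of the chamber, the Jacobian of the map on the ring is bounded below. -/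
lemma ae_le_det_of_chamber {d : ℕ} (hd : Odd d) : ∀ᵐ y : E3, y ∈ chamber → OffWalls y →
    1 < ‖y‖ → ‖y‖ < Real.exp (1 / d) → DifferentiableAt ℝ (ringMap d) y →
      (d : ℝ) ^ 3 / 64 ≤ (fderiv ℝ (ringMap d) y).det := by
  set σ := slope d with hσ
  obtain ⟨s1, s2, s3⟩ := slope_bounds hd.pos
  rw [← hσ] at s1 s2 s3
  have hd1 : (1 : ℝ) ≤ d := by exact_mod_cast hd.pos
  have hσ0 : 0 < σ := by linarith
  have hd0 : (d : ℝ) ≠ 0 := by positivity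
  let shrink : E3 → E3 := fun u => !₂[(d : ℝ)⁻¹ * u 0, (d : ℝ)⁻¹ * u 1, 1 + σ⁻¹ * (u 2 - 1)]
  have hshrink : ∀ x, shrink (stretch d x) = x := by
    intro x
    ext i
    fin_cases i
    · change (d : ℝ)⁻¹ * (d * x 0) = x 0
      field_simp
    · change (d : ℝ)⁻¹ * (d * x 1) = x 1
      field_simp
    · change 1 + σ⁻¹ * (1 + σ * (x 2 - 1) - 1) = x 2
      field_simp
      ring
  have dshrink : Differentiable ℝ shrink := by
    intro u
    obtain ⟨T, hT, -⟩ := exists_hasFDerivAt_of_coords (f := shrink) (x := u)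
      (D := ![_, _, _]) (by
        intro i
        fin_cases i
        · exact (hasFDerivAt_coord 0 u).const_mul _
        · exact (hasFDerivAt_coord 1 u).const_mul _
        · exact (((hasFDerivAt_coord 2 u).sub_const 1).const_mul _).const_add 1)
    exact hT.differentiableAt
  have dstretch : ∀ x, ∃ S : E3 →L[ℝ] E3, HasFDerivAt (stretch d) S x ∧ S.det = d ^ 2 * σ := by
    intro x
    obtain ⟨S, hS, hSe⟩ := exists_hasFDerivAt_of_coords (f := stretch d) (x := x)
      (D := ![(d : ℝ) • coord 0, (d : ℝ) • coord 1, σ • coord 2]) (by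
        intro i
        fin_cases i
        · exact (hasFDerivAt_coord 0 x).const_mul _
        · exact (hasFDerivAt_coord 1 x).const_mul _
        · exact (((hasFDerivAt_coord 2 x).sub_const 1).const_mul _).const_add 1)
    refine ⟨S, hS, ?_⟩
    rw [det_eq_entries]
    simp [hSe, unitVec]
    exact Or.inl (by ring)
  set bad : Set E3 := {u | ¬ (1 < u 2 → u 2 < Real.exp 3 → ∃ T : E3 →L[ℝ] E3,
    HasFDerivAt (fun y => roundMap (interp (Real.exp 3) y)) T u ∧ 3 / 4 ≤ T.det)} ∩
    {u | 0 < shrink u 1 ∧ shrink u 1 < shrink u 0} with hbad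
  have bad_null : volume bad = 0 :=
    measure_mono_null inter_subset_left (ae_det_roundMap_interp exp_three_ge)
  have image_null : volume ((fun u => beam (shrink u)) '' bad) = 0 := by
    refine addHaar_image_eq_zero_of_differentiableOn_of_addHaar_eq_zero _ ?_ bad_null
    rintro u ⟨-, h1, h01⟩
    obtain ⟨B, hB, -⟩ := hasFDerivAt_beam h1 h01
    exact (hB.differentiableAt.comp u (dshrink u)).differentiableWithinAt
  filter_upwards [measure_eq_zero_iff_ae_notMem.1 image_null] with y hy hc hoff n1 n2 hP
  obtain ⟨x, h1, h01, h0, h2, rfl⟩ :=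
    exists_beam_eq_of_chamber (norm_pos_iff.1 (by linarith)) hc
  obtain ⟨a0, a1, a2⟩ := beam_apply h1 h01
  rw [← h2] at n1 n2
  have g1 : 0 < x 1 := lt_of_le_of_ne h1 fun h => hoff.2.1 (by rw [a1, ← h]; ring)
  have g01 : x 1 < x 0 := lt_of_le_of_ne h01 fun h => hoff.2.2.2.1 (by rw [a0, a1, h])
  have g0 : x 0 < 1 := lt_of_le_of_ne h0 fun h => hoff.2.2.1 (by
    rw [a2, h, mul_one, Real.cos_pi_div_two, mul_zero])
  have hgood : stretch d x ∉ bad := fun h => hy ⟨_, h, by simp only [hshrink]⟩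
  have hgood' : ∃ T : E3 →L[ℝ] E3,
      HasFDerivAt (fun y => roundMap (interp (Real.exp 3) y)) T (stretch d x) ∧ 3 / 4 ≤ T.det := by
    by_contra hcon
    refine hgood ⟨fun h => hcon (h ?_ ?_), ?_⟩
    · rw [(stretch_apply d x).2.2, ← hσ]; nlinarith
    · rw [(stretch_apply d x).2.2, ← hσ]; nlinarith
    · rw [mem_ofPred_eq, hshrink]; exact ⟨g1, g01⟩
  obtain ⟨T, hT, hTd⟩ := hgood'
  obtain ⟨S, hS, hSd⟩ := dstretch x
  obtain ⟨B, hB, hBd⟩ := hasFDerivAt_beam g1 g01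
  have e1 : HasFDerivAt (fun z => ringMap d (beam z)) ((fderiv ℝ (ringMap d) (beam x)).comp B) x :=
    hP.hasFDerivAt.comp x hB
  have e2 : HasFDerivAt (fun z => ringMap d (beam z)) (T.comp S) x := by
    refine (hT.comp x hS).congr_of_eventuallyEq ?_
    filter_upwards [(coord 1).continuous.continuousAt.eventually_const_lt g1,
      (coord 2).continuous.continuousAt.eventually_const_lt n1,
      (coord 0).continuous.continuousAt.eventually_lt_const g0,
      (coord 1).continuous.continuousAt.eventually_lt (coord 0).continuous.continuousAt g01]
      with z z1 z2 z0 z01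
    exact ringMap_beam hd z1.le z01.le z0.le (lt_trans one_pos z2)
  have det_comp : ∀ A B : E3 →L[ℝ] E3, (A.comp B).det = A.det * B.det := fun A B =>
    LinearMap.det_comp (A : E3 →ₗ[ℝ] E3) (B : E3 →ₗ[ℝ] E3)
  have e3 := congrArg ContinuousLinearMap.det (e1.unique e2)
  rw [det_comp, det_comp, hSd] at e3
  set J := (fderiv ℝ (ringMap d) (beam x)).det
  have hx2 : x 2 ^ 2 ≤ 8 := by
    have : Real.exp (1 / d) ≤ Real.exp 1 := Real.exp_le_exp.2 (by
      rw [div_le_one (by linarith)]; exact hd1)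
    have := Real.exp_one_lt_d9
    nlinarith
  obtain ⟨k1, k2⟩ := det_beam_bounds g1 g01 g0.le
  set k := (Real.pi / 2) * Real.sin (Real.pi * x 0 / 2) * x 0 / (x 0 ^ 2 + x 1 ^ 2)
  have hBd' : B.det = x 2 ^ 2 * k := by rw [hBd]; simp only [k]; ring
  have hB0 : 0 < B.det := by rw [hBd']; positivity
  have hB1 : B.det ≤ 32 := by rw [hBd']; nlinarith
  have hd3 : (d : ℝ) ^ 3 ≤ d ^ 2 * σ := by
    rw [pow_succ]; gcongr
  have hdp : (0 : ℝ) < d ^ 3 := by positivity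
  have hlow : 3 / 4 * (d : ℝ) ^ 3 ≤ J * B.det := by
    rw [e3]
    exact mul_le_mul hTd hd3 hdp.le (by linarith)
  have hJ : 0 < J := by
    by_contra h
    have := mul_nonpos_of_nonpos_of_nonneg (not_lt.1 h) hB0.le
    linarith
  have := mul_le_mul_of_nonneg_left hB1 hJ.le
  linarith

lemma ae_le_det {d : ℕ} (hd : Odd d) : ∀ᵐ y : E3, 1 < ‖y‖ → ‖y‖ < Real.exp (1 / d) →
    DifferentiableAt ℝ (ringMap d) y → (d : ℝ) ^ 3 / 64 ≤ (fderiv ℝ (ringMap d) y).det := by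
  have main := chamber_induction (fun D => ∀ᵐ y : E3, y ∈ D → OffWalls y →
    1 < ‖y‖ → ‖y‖ < Real.exp (1 / d) → DifferentiableAt ℝ (ringMap d) y →
      (d : ℝ) ^ 3 / 64 ≤ (fderiv ℝ (ringMap d) y).det) (ae_le_det_of_chamber hd) ?_ ?_
  · have walls : ∀ l : E3 →L[ℝ] ℝ, l ≠ 0 → ∀ᵐ y : E3, l y ≠ 0 := by
      intro l hl
      filter_upwards [LocallyLipschitz.ae_eq_zero_imp (u := l) l.lipschitz.locallyLipschitz]
        with y hy h
      exact hl (hy l l.hasFDerivAt h)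
    have ne : ∀ l : E3 →L[ℝ] ℝ, l (unitVec 0) ≠ 0 → l ≠ 0 := by
      rintro l hl rfl
      exact hl rfl
    filter_upwards [main, ae_coord_ne 0 0, ae_coord_ne 1 0, ae_coord_ne 2 0,
      walls (coord 0 - coord 1) (ne _ (by simp [unitVec])),
      walls (coord 0 + coord 1) (ne _ (by simp [unitVec]))] with y hy h0 h1 h2 h3 h4
    exact hy (mem_univ y) ⟨h0, h1, h2, fun h => h3 (by simp [h]), fun h => h4 (by simp [h])⟩
  · intro ρ hρ D hD
    filter_upwards [ρ.measurePreserving.quasiMeasurePreserving.ae hD] with y hy hyD hoff n1 n2 hP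
    have hinv := hρ.involutive y
    have hP' : HasFDerivAt (ringMap d) (fderiv ℝ (ringMap d) y) (ρ (ρ y)) := by
      rw [hinv]; exact hP.hasFDerivAt
    obtain ⟨S, hS, hSd⟩ := hasFDerivAt_of_reflect hρ
      (Eventually.of_forall fun z => ringMap_reflect hd hρ z) hP'
    rw [← hSd, ← hS.fderiv]
    exact hy hyD (hoff.reflect hρ) (by rwa [ρ.norm_map]) (by rwa [ρ.norm_map]) hS.differentiableAt
  · intro l D _ h1 h2
    filter_upwards [h1, h2] with y hy1 hy2 hyD
    rcases le_total 0 (l y) with h | h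
    · exact hy1 ⟨hyD, h⟩
    · exact hy2 ⟨hyD, h⟩

/-- The interpolation between the power maps has dilatation bounded independently of the degree. -/
lemma isQuasiregularOn_ringMap {d : ℕ} (hd : Odd d) :
    IsQuasiregularOn (ringMap d) (closedRing 1 (Real.exp (1 / d))) ∧
    maximalDilatation (ringMap d) (interior (closedRing 1 (Real.exp (1 / d)))) ≤
      ENNReal.ofReal (4096 * (94500 * Real.exp 3) ^ 6) := by
  set A := closedRing 1 (Real.exp (1 / d)) with hA
  set M := 94500 * Real.exp 3 with hM
  have hM1 : 1 ≤ M := by have := exp_three_ge; linarith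
  have hd1 : (1 : ℝ) ≤ d := by exact_mod_cast hd.pos
  have hAρ : ∀ ρ, IsWallReflection ρ → ∀ x ∈ A, ρ x ∈ A := by
    intro ρ _ x hx
    rw [hA, closedRing, mem_ofPred_eq, ρ.norm_map]
    exact hx
  have hfρ : ∀ ρ, IsWallReflection ρ → ∀ x ∈ A, ringMap d (ρ x) = ρ (ringMap d x) :=
    fun ρ hρ x _ => ringMap_reflect hd hρ x
  have hL : LipschitzOnWith (Real.toNNReal (M * d)) (ringMap d) (A ∩ chamber) := by
    refine LipschitzOnWith.of_dist_le_mul fun x hx y hy => ?_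
    rw [dist_eq_norm, dist_eq_norm, Real.coe_toNNReal _ (by positivity)]
    exact norm_ringMap_sub_le_of_chamber hd hx hy
  have h36 : M ^ 3 ≤ M ^ 6 := pow_le_pow_right₀ hM1 (by norm_num)
  have h06 : 1 ≤ M ^ 6 := one_le_pow₀ hM1
  refine isQuasiregularOn_of_lipschitz (c := (d : ℝ) ^ 3 / 64) (by positivity)
    (continuousOn_of_chamber hAρ hfρ hL.continuousOn) (LipschitzOnConvex.of_chamber hAρ hfρ hL)
    ?_ (by linarith) ?_ ?_
  · have sphere : ∀ r : ℝ, 0 < r → ∀ᵐ y : E3, ‖y‖ ≠ r := by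
      intro r hr
      have := measure_eq_zero_iff_ae_notMem.1 (Measure.addHaar_sphere volume (0 : E3) r)
      filter_upwards [this] with y hy h
      exact hy (by simpa using h)
    filter_upwards [ae_le_det hd, sphere 1 one_pos, sphere _ (Real.exp_pos (1 / d))]
      with y hy n1 n2 hyA
    obtain ⟨m1, m2⟩ := interior_subset hyA
    exact hy (lt_of_le_of_ne m1 n1.symm) (lt_of_le_of_ne m2 n2)
  · rw [Real.coe_toNNReal _ (by positivity), mul_pow]
    have : (0 : ℝ) < d ^ 3 := by positivity
    nlinarith
  · rw [Real.coe_toNNReal _ (by positivity), mul_pow]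
    apply le_of_eq
    ring

end QRInterp

end
theorem theorem1p2 :
    ∃ K : NNReal, ∀ d : ℕ, Odd d →
      ∃ P : QRInterp.E3 → QRInterp.E3,
        QRInterp.IsQuasiregularOn P (QRInterp.closedRing 1 (Real.exp (1 / (d : ℝ)))) ∧
        QRInterp.maximalDilatation P
          (interior (QRInterp.closedRing 1 (Real.exp (1 / (d : ℝ))))) ≤ (K : ENNReal) ∧
        Set.MapsTo P (QRInterp.closedRing 1 (Real.exp (1 / (d : ℝ))))
          (Metric.closedBall 0 (Real.exp 3)) ∧
        (∀ x : QRInterp.E3, ‖x‖ = 1 → P x = QRInterp.powerMap d x) ∧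
        (∀ x : QRInterp.E3, ‖x‖ = Real.exp (1 / (d : ℝ)) →
          P x = QRInterp.powerMap (3 * d) x) := by
  refine ⟨Real.toNNReal (4096 * (94500 * Real.exp 3) ^ 6), fun d hd => ⟨QRInterp.ringMap d, ?_⟩⟩
  obtain ⟨h1, h2⟩ := QRInterp.isQuasiregularOn_ringMap hd
  refine ⟨h1, h2, fun x hx => ?_, fun x hx => QRInterp.ringMap_eq_powerMap_inner hd hx,
    fun x hx => QRInterp.ringMap_eq_powerMap_outer hd hx⟩
  rw [mem_closedBall_zero_iff]
  exact QRInterp.norm_ringMap_le hd hx.1 hx.2
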